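/- Let $A$ be a set of $K\ge 3$ alternatives, and let $\pi=(\succ_1,\dots,\succ_n)$, $n\ge 1$, be a profile of strict total orders ("preferences") on $A$. Write $\mu_\pi(\succ)$ for the number of voters whose preference is $\succ$, $d(\succ,\succ')$ for the number of two-element subsets of $A$ that $\succ$ and $\succ'$ rank differently, and $T(K,j)$ for the number of permutations of $K$ elements with exactly $j$ inversions. The profile exhibits Flexible Consensus around $\succ_0$ if for all preferences $\succ',\succ$ on $A$: $\mu_\pi(\succ')>\mu_\pi(\succ)$ implies $d(\succ',\succ_0)\le d(\succ,\succ_0)$. It exhibits Flexible Consensus if it does so around some $\succ_0$. Let $n'\le\min(K!,n)$ be the number of distinct preferences in $\pi$. Checking algorithm (input $\pi$ and a preference $\succ_0$). Order the distinct preferences of $\pi$ as $\succ_1,\dots,\succ_{n'}$ by descending frequency, and within equal frequency by ascending distance from $\succ_0$ (remaining ties arbitrarily). If for some $i<n'$ both $\mu_\pi(\succ_i)>\mu_\pi(\succ_{i+1})$ and $d(\succ_i,\succ_0)>d(\succ_{i+1},\succ_0)$, return False. Otherwise let $\hat d=d(\succ_{n'},\succ_0)$ and return True if and only if $\sum_{j=0}^{\hat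 d-1}T(K,j)$ equals the number of distinct preferences in $\pi$ at distance at most $\hat d-1$ from $\succ_0$. Detection algorithm (input $\pi$). (1) Compute the distinct preferences of $\pi$ and their frequencies. (2) Order them by descending frequency (ties arbitrarily). (3) Go through the preferences of maximal frequency in this order, run the checking algorithm on each of them, and return the first one for which it answers True. If there is none, return "no consensus". Theorem. (a) Correctness. However ties are broken, for every preference $\succ_0$ the checking algorithm returns True if and only if $\pi$ exhibits Flexible Consensus around $\succ_0$. Every preference that the detection algorithm returns is one around which $\pi$ exhibits Flexible Consensus, and it returns "no consensus" if and only if $\pi$ does not exhibit Flexible Consensus. (b) Running time. Both algorithms can be implemented (with some way of breaking ties) on a word RAM whose words have a number of bits that is at least a suitable constant multiple of the logarithm of the input size, with the detection program consisting of a tabulation for step (1), an ordering for step (2), and for step (3) the loop through the candidates that runs the checking program on each of them, such that, with absolute implied constants: - the checking program, given the table of the distinct preferences and their frequencies in descending order of frequency, takes $O(n'K\sqrt{\log K}+n'\log n')$ steps; - in the detection program step (1), which reads the list of the $n$ preferences, takes $O(nK)$ steps, and steps (2) and (3) together take $O(n'^2K\sqrt{\log K}+n'^2\log n')$ steps; -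 in particular, if $n\le (K!)^2$, the whole detection program takes $O(N^2K\sqrt{\log K}+N^2\log N)$ steps, where $N=\min(K!,n)$. -/

import Mathlib

noncomputable section

open scoped Classical

/-! ### Preferences, profiles, and Flexible Consensus -/

/-- A preference on the `K` alternatives `0, …, K - 1`: a strict total order.
`p.rel a b` reads: `a` is preferred to `b`. -/
structure Preference (K : ℕ) where
  rel : Fin K → Fin K → Prop
  irrefl : ∀ a, ¬ rel a a
  trans : ∀ a b c, rel a b → rel b c → rel a c
  total : ∀ a b, a ≠ b → rel a b ∨ rel b a

/-- A profile of `n` voters. -/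
abbrev Profile (K n : ℕ) : Type := Fin n → Preference K

/-- The frequency of `p` in the profile `π`: the number of voters whose preference is `p`. -/
def freq {K n : ℕ} (π : Profile K n) (p : Preference K) : ℕ :=
  (Finset.univ.filter fun i : Fin n => π i = p).card

/-- The inversion distance. Each two-element set of alternatives that `p` and `q` rank differently
is counted once, as the ordered pair `(a, b)` with `a` preferred to `b` by `p`. -/
def invDist {K : ℕ} (p q : Preference K) : ℕ :=
  (Finset.univ.filter fun x : Fin K × Fin K => p.rel x.1 x.2 ∧ q.rel x.2 x.1).card

/-- Flexible Consensus of `π` around `p₀`. -/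
def FlexibleConsensusAround {K n : ℕ} (π : Profile K n) (p₀ : Preference K) : Prop :=
  ∀ p' p : Preference K, freq π p < freq π p' → invDist p' p₀ ≤ invDist p p₀

/-- `π` exhibits Flexible Consensus. -/
def FlexibleConsensus {K n : ℕ} (π : Profile K n) : Prop :=
  ∃ p₀ : Preference K, FlexibleConsensusAround π p₀

/-- The number of permutations of `K` elements with exactly `j` inversions. -/
def mahonian (K j : ℕ) : ℕ :=
  (Finset.univ.filter fun σ : Equiv.Perm (Fin K) =>
    (Finset.univ.filter fun x : Fin K × Fin K => x.1 < x.2 ∧ σ x.2 < σ x.1).card = j).card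

/-! ### The two algorithms, as mathematical procedures -/

/-- `l` lists the distinct preferences that occur in `π`, each of them once. -/
def IsListing {K n : ℕ} (π : Profile K n) (l : List (Preference K)) : Prop :=
  l.Nodup ∧ ∀ p, p ∈ l ↔ ∃ i, π i = p

/-- `l` lists the distinct preferences of `π` by descending frequency (ties in any order). -/
def IsFreqOrder {K n : ℕ} (π : Profile K n) (l : List (Preference K)) : Prop :=
  IsListing π l ∧ l.Pairwise fun p q => freq π q ≤ freq π p

/-- `l` lists the distinct preferences of `π` by descending frequency and, among preferences
of the same frequency, by ascending distance from `p₀` (remaining ties in any order). -/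
def IsFreqDistOrder {K n : ℕ} (π : Profile K n) (p₀ : Preference K)
    (l : List (Preference K)) : Prop :=
  IsListing π l ∧ l.Pairwise fun p q =>
    freq π q < freq π p ∨ (freq π q = freq π p ∧ invDist p p₀ ≤ invDist q p₀)

/-- The checking subroutine, run on `π` and `p₀` with the list `l` produced by its ordering step.
The scan returns `false` at an adjacent pair whose frequency drops and whose distance drops.
Otherwise, with `d` the distance of the last preference, the number of permutations with at most
`d - 1` inversions is compared with the number of listed preferences at distance at most
`d - 1` (both are `0` if `d = 0`). -/
def checkAlg {K n : ℕ} (π : Profile K n) (p₀ : Preference K) (l : List (Preference K)) : Bool :=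
  if ∃ (i : ℕ) (h : i + 1 < l.length),
      freq π l[i + 1] < freq π l[i] ∧ invDist l[i + 1] p₀ < invDist l[i] p₀ then
    false
  else
    let d : ℕ := (l.map fun p => invDist p p₀).getLastD 0
    decide (∑ j ∈ Finset.range d, mahonian K j =
      (l.filter fun p => decide (invDist p p₀ < d)).length)

/-- The detection algorithm, run on `π`, where `l` is the frequency order that it uses and
`ord p₀` the list that the subroutine uses on the candidate `p₀`. It goes through `l` as long as
the frequency is maximal, and returns the first candidate that passes the check;
`none` stands for the answer "no consensus". -/
def detectAlg {K n : ℕ} (π : Profile K n) (l : List (Preference K))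
    (ord : Preference K → List (Preference K)) : Option (Preference K) :=
  let M : ℕ := (l.map fun p => freq π p).headD 0
  (l.takeWhile fun p => decide (freq π p = M)).find? fun p => checkAlg π p (ord p)

/-! ### The word RAM

Words are natural numbers below `2 ^ w`. A program uses finitely many registers and a
random-access memory of `2 ^ w` words. Every instruction and every test costs one step. -/

/-- Binary word operations. -/
inductive WordOp where
  | add | sub | mul | div | band | bor | xor | shl | shr

/-- The value of a word operation, reduced modulo `2 ^ w`. -/
def WordOp.eval (w : ℕ) : WordOp → ℕ → ℕ → ℕ
  | .add, a, b => (a + b) % 2 ^ w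
  | .sub, a, b => (a + (2 ^ w - b)) % 2 ^ w
  | .mul, a, b => (a * b) % 2 ^ w
  | .div, a, b => (a / b) % 2 ^ w
  | .band, a, b => (a &&& b) % 2 ^ w
  | .bor, a, b => (a ||| b) % 2 ^ w
  | .xor, a, b => (a ^^^ b) % 2 ^ w
  | .shl, a, b => (a <<< b) % 2 ^ w
  | .shr, a, b => (a >>> b) % 2 ^ w

/-- Tests on two registers. -/
inductive RegTest where
  | lt (a b : ℕ)
  | eq (a b : ℕ)

/-- Programs. Registers are named by natural numbers. -/
inductive Cmd where
  | skip
  | const (r k : ℕ)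
  | op (o : WordOp) (r a b : ℕ)
  | load (r a : ℕ)
  | store (a r : ℕ)
  | seq (c₁ c₂ : Cmd)
  | ite (b : RegTest) (c₁ c₂ : Cmd)
  | loop (b : RegTest) (c : Cmd)

/-- Machine states. -/
structure RamState where
  reg : ℕ → ℕ
  mem : ℕ → ℕ

def RegTest.Holds (s : RamState) : RegTest → Prop
  | .lt a b => s.reg a < s.reg b
  | .eq a b => s.reg a = s.reg b

def RamState.setReg (s : RamState) (r v : ℕ) : RamState :=
  { s with reg := Function.update s.reg r v }

def RamState.setMem (s : RamState) (a v : ℕ) : RamState :=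
  { s with mem := Function.update s.mem a v }

/-- All registers and memory cells hold words. -/
def RamState.IsWord (w : ℕ) (s : RamState) : Prop :=
  (∀ r, s.reg r < 2 ^ w) ∧ ∀ a, s.mem a < 2 ^ w

/-- `Exec w c s s' t`: with word length `w`, the program `c` started in the state `s` halts
in the state `s'` after exactly `t` steps. -/
inductive Exec (w : ℕ) : Cmd → RamState → RamState → ℕ → Prop where
  | skip (s : RamState) : Exec w .skip s s 1
  | const (r k : ℕ) (s : RamState) : Exec w (.const r k) s (s.setReg r (k % 2 ^ w)) 1
  | op (o : WordOp) (r a b : ℕ) (s : RamState) :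
      Exec w (.op o r a b) s (s.setReg r (o.eval w (s.reg a) (s.reg b))) 1
  | load (r a : ℕ) (s : RamState) : Exec w (.load r a) s (s.setReg r (s.mem (s.reg a))) 1
  | store (a r : ℕ) (s : RamState) : Exec w (.store a r) s (s.setMem (s.reg a) (s.reg r)) 1
  | seq {c₁ c₂ : Cmd} {s s₁ s₂ : RamState} {t₁ t₂ : ℕ} :
      Exec w c₁ s s₁ t₁ → Exec w c₂ s₁ s₂ t₂ → Exec w (.seq c₁ c₂) s s₂ (t₁ + t₂)
  | iteTrue {b : RegTest} {c₁ c₂ : Cmd} {s s' : RamState} {t : ℕ} :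
      b.Holds s → Exec w c₁ s s' t → Exec w (.ite b c₁ c₂) s s' (t + 1)
  | iteFalse {b : RegTest} {c₁ c₂ : Cmd} {s s' : RamState} {t : ℕ} :
      ¬ b.Holds s → Exec w c₂ s s' t → Exec w (.ite b c₁ c₂) s s' (t + 1)
  | loopDone {b : RegTest} {c : Cmd} {s : RamState} :
      ¬ b.Holds s → Exec w (.loop b c) s s 1
  | loopStep {b : RegTest} {c : Cmd} {s s₁ s₂ : RamState} {t₁ t₂ : ℕ} :
      b.Holds s → Exec w c s s₁ t₁ → Exec w (.loop b c) s₁ s₂ t₂ →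
        Exec w (.loop b c) s s₂ (t₁ + t₂ + 1)

/-! ### Data layout and the detection program

Registers: `0` number of alternatives; `1` number of rows (voters, later distinct preferences);
`2` address of the rows; `3` address of the frequencies; `4` first free address;
`5` address of the candidate; `6` index of the candidate; `7` maximum frequency;
`8` loop flag; `9` answer flag; `10` constant `0`; `11` constant `1`; `12` temporary;
`13` verdict of the check. Registers from `14` on are free for use. -/

/-- From address `a` on, the memory holds the preference `p` as the list of the alternatives
from best to worst. -/
def HoldsPref {K : ℕ} (mem : ℕ → ℕ) (a : ℕ) (p : Preference K) : Prop :=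
  ∃ r : Fin K → Fin K, (∀ i j, p.rel (r i) (r j) ↔ i < j) ∧ ∀ i : Fin K, mem (a + i) = r i

/-- The start state: `K`, `n`, and the list of the preferences of the `n` voters from address `0`
on; all other registers and cells are zero. -/
structure IsInput {K n : ℕ} (π : Profile K n) (s : RamState) : Prop where
  alternatives : s.reg 0 = K
  voters : s.reg 1 = n
  regs_zero : ∀ r, 2 ≤ r → s.reg r = 0
  prefs : ∀ i : Fin n, HoldsPref s.mem (i * K) (π i)
  mem_zero : ∀ a, n * K ≤ a → s.mem a = 0

/-- The state holds, below the first free address, the preferences in `l` in this order,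
with their frequencies in `π`. -/
structure HoldsTable {K n : ℕ} (π : Profile K n) (l : List (Preference K)) (s : RamState) :
    Prop where
  alternatives : s.reg 0 = K
  rows : s.reg 1 = l.length
  prefs : ∀ (i : ℕ) (h : i < l.length), HoldsPref s.mem (s.reg 2 + i * K) l[i]
  freqs : ∀ (i : ℕ) (h : i < l.length), s.mem (s.reg 3 + i) = freq π l[i]
  prefs_le : s.reg 2 + l.length * K ≤ s.reg 4
  freqs_le : s.reg 3 + l.length ≤ s.reg 4

/-- The candidate loop of the detection algorithm, with `check` as the subroutine: for the rows
in order, as long as the frequency equals that of the first row, run `check`; stop with answer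
flag `1` at the first row that passes, and with answer flag `0` when no row is left. -/
def searchProg (check : Cmd) : Cmd :=
  .seq (.const 10 0) <| .seq (.const 11 1) <|
  .seq (.load 7 3) <|
  .seq (.const 6 0) <| .seq (.op .add 5 2 10) <|
  .seq (.const 9 0) <| .seq (.const 8 1) <|
  .loop (.eq 8 11) <|
    .seq check <|
    .ite (.eq 13 11)
      (.seq (.const 9 1) (.const 8 0)) <|
      .seq (.op .add 6 6 11) <| .seq (.op .add 5 5 0) <|
      .ite (.lt 6 1)
        (.seq (.op .add 12 3 6) <| .seq (.load 12 12) <|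
          .ite (.eq 12 7) .skip (.const 8 0))
        (.const 8 0)

/-- The detection program: tabulate the distinct preferences and their frequencies, order the
table by descending frequency, and search through the candidates. -/
def detectProg (tabulate order check : Cmd) : Cmd :=
  .seq tabulate (.seq order (searchProg check))

/-- `m K √(log K) + m log m`. -/
def checkTime (m K : ℕ) : ℝ := m * K * √(Real.log K) + m * Real.log m

/-- `m² K √(log K) + m² log m`. -/
def detectTime (m K : ℕ) : ℝ := (m : ℝ) ^ 2 * K * √(Real.log K) + (m : ℝ) ^ 2 * Real.log m

/-- `check` is a program for the checking subroutine that takes at most `C * checkTime m K` steps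
on every profile with `m` distinct preferences, given as a table in descending order of
frequency, and every preference `p₀` (whether or not it occurs in the profile); it works with any
contents of the free memory and of the free registers, provided that at least `(m K) ^ c` cells
are free, and it changes neither the memory below the first free address nor the registers
that belong to the caller. -/
def IsCheckProg (c : ℕ) (C : ℝ) (check : Cmd) : Prop :=
  ∀ (K n w : ℕ) (π : Profile K n) (l : List (Preference K)) (p₀ : Preference K) (s : RamState),
    3 ≤ K → 0 < n → IsFreqOrder π l → s.IsWord w → HoldsTable π l s →
    HoldsPref s.mem (s.reg 5) p₀ → s.reg 5 + K ≤ s.reg 4 →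
    s.reg 4 + (l.length * K) ^ c ≤ 2 ^ w →
    ∃ (s' : RamState) (t : ℕ), Exec w check s s' t ∧
      (t : ℝ) ≤ C * checkTime l.length K ∧
      (∀ a, a < s.reg 4 → s'.mem a = s.mem a) ∧
      (∀ r, r < 13 → s'.reg r = s.reg r) ∧
      ∃ l' : List (Preference K), IsFreqDistOrder π p₀ l' ∧
        s'.reg 13 = if checkAlg π p₀ l' = true then 1 else 0

/-- The final state reports the answer: flag `0` for "no consensus", and flag `1` together with
the address of the returned preference. -/
def Reports {K : ℕ} (s : RamState) : Option (Preference K) → Prop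
  | none => s.reg 9 = 0
  | some p => s.reg 9 = 1 ∧ HoldsPref s.mem (s.reg 5) p

end

/-! Correctness rests on one reformulation. A preference that does not occur has frequency zero, so
Flexible Consensus around `p₀` says two things about the occurring ones: a higher frequency never
goes with a larger distance, and every preference strictly closer to `p₀` than an occurring one
occurs too (`flexibleConsensusAround_iff`). If the scan rejects no adjacent pair, the tie-break
forces the distances to be nondecreasing along the list. The first condition then holds, and the
second says that the open ball of radius `d`, the largest distance, is fully listed, which is the
comparison of cardinalities (`checkAlg_iff`). A centre must have maximal frequency, so the search
loses no candidate.

For the running time, the check has the same answer under all tie-breaks, so a program may decide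
Flexible Consensus by any means. It need not sort by distance, count inversions or compute Mahonian
numbers. With `m` distinct preferences it takes `O(m K)` steps, which is within the claimed bound
because `log K ≥ 1` for `K ≥ 3`. Four ideas achieve this.

Lookup: rankings are kept in a trie whose edges live in a dictionary that tolerates uninitialised
memory, so no array of quadratic size is ever cleared and one lookup costs `O(K)` (`internKey_spec`,
`intern_spec`).

Distances: a row other than the candidate has a descent relative to it, and undoing a descent gives
a preference exactly one closer (`inversions_mul_adjSwap`). If that neighbour is not in the table,
consensus fails. Otherwise the rows form a tree rooted at the candidate in which depth is distance,
and pointer jumping computes all depths (`jumpProg_spec`).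

Frequencies: the table is sorted by frequency, so one pass with running maxima of the distance
detects every conflict (`isTopValue_higher`, `isOpposed_succ`).

Full layers: the edges of the weak order between layers `e` and `e + 1` are counted by the ascents
in the lower layer and by the descents in the upper one. If layer `e` is complete, the descents of
the listed part of layer `e + 1` reach this number only if nothing is missing, since every
non-identity permutation has a descent (`layers_full_iff`). Only listed rows enter these sums.

Detection tabulates with the same trie in `O(n K)`, sorts by exchanges in `O(m² K)`, and runs at
most `m` checks. If `n ≤ (K!)²`, then `n ≤ N²`, which absorbs the tabulation.

All programs are analysed in a semantics that forbids overflow, so registers carry exact natural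
numbers; the space bounds discharge the overflow conditions. -/

/-! ### Overflow-free execution -/

/-- The operation does not overflow. -/
def WordOp.Safe (w : ℕ) : WordOp → ℕ → ℕ → Prop
  | .add, a, b => a + b < 2 ^ w
  | .sub, a, b => b ≤ a ∧ a < 2 ^ w
  | .mul, a, b => a * b < 2 ^ w
  | _, _, _ => False

/-- The value of an operation that does not overflow. -/
def WordOp.val : WordOp → ℕ → ℕ → ℕ
  | .add, a, b => a + b
  | .sub, a, b => a - b
  | .mul, a, b => a * b
  | _, _, _ => 0

theorem WordOp.eval_of_safe {w : ℕ} {o : WordOp} {a b : ℕ} (h : o.Safe w a b) :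
    o.eval w a b = o.val a b := by
  cases o <;> simp only [WordOp.Safe] at h <;> simp only [WordOp.eval, WordOp.val]
  · exact Nat.mod_eq_of_lt h
  · have h2 : a + (2 ^ w - b) = (a - b) + 2 ^ w := by omega
    rw [h2, Nat.add_mod_right]
    exact Nat.mod_eq_of_lt (by omega)
  · exact Nat.mod_eq_of_lt h

/-- Executions without overflow. -/
inductive SafeExec (w : ℕ) : Cmd → RamState → RamState → ℕ → Prop where
  | skip (s : RamState) : SafeExec w .skip s s 1
  | const {r k : ℕ} {s : RamState} (h : k < 2 ^ w) : SafeExec w (.const r k) s (s.setReg r k) 1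
  | op {o : WordOp} {r a b : ℕ} {s : RamState} (h : o.Safe w (s.reg a) (s.reg b)) :
      SafeExec w (.op o r a b) s (s.setReg r (o.val (s.reg a) (s.reg b))) 1
  | load (r a : ℕ) (s : RamState) : SafeExec w (.load r a) s (s.setReg r (s.mem (s.reg a))) 1
  | store (a r : ℕ) (s : RamState) :
      SafeExec w (.store a r) s (s.setMem (s.reg a) (s.reg r)) 1
  | seq {c₁ c₂ : Cmd} {s s₁ s₂ : RamState} {t₁ t₂ : ℕ} :
      SafeExec w c₁ s s₁ t₁ → SafeExec w c₂ s₁ s₂ t₂ → SafeExec w (.seq c₁ c₂) s s₂ (t₁ + t₂)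
  | iteTrue {b : RegTest} {c₁ c₂ : Cmd} {s s' : RamState} {t : ℕ} :
      b.Holds s → SafeExec w c₁ s s' t → SafeExec w (.ite b c₁ c₂) s s' (t + 1)
  | iteFalse {b : RegTest} {c₁ c₂ : Cmd} {s s' : RamState} {t : ℕ} :
      ¬ b.Holds s → SafeExec w c₂ s s' t → SafeExec w (.ite b c₁ c₂) s s' (t + 1)
  | loopDone {b : RegTest} {c : Cmd} {s : RamState} :
      ¬ b.Holds s → SafeExec w (.loop b c) s s 1
  | loopStep {b : RegTest} {c : Cmd} {s s₁ s₂ : RamState} {t₁ t₂ : ℕ} :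
      b.Holds s → SafeExec w c s s₁ t₁ → SafeExec w (.loop b c) s₁ s₂ t₂ →
        SafeExec w (.loop b c) s s₂ (t₁ + t₂ + 1)

theorem SafeExec.exec {w : ℕ} {c : Cmd} {s s' : RamState} {t : ℕ} (h : SafeExec w c s s' t) :
    Exec w c s s' t := by
  induction h with
  | skip s => exact .skip s
  | @const r k s h =>
    have := Exec.const (w := w) r k s
    rwa [Nat.mod_eq_of_lt h] at this
  | @op o r a b s h =>
    have := Exec.op (w := w) o r a b s
    rwa [WordOp.eval_of_safe h] at this
  | load r a s => exact .load r a s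
  | store a r s => exact .store a r s
  | seq _ _ h₁ h₂ => exact .seq h₁ h₂
  | iteTrue hb _ h => exact .iteTrue hb h
  | iteFalse hb _ h => exact .iteFalse hb h
  | loopDone hb => exact .loopDone hb
  | loopStep hb _ _ h₁ h₂ => exact .loopStep hb h₁ h₂

/-- Started in `s`, the program halts without overflow, and the final state and the number of
steps satisfy `Q`. -/
def Run (w : ℕ) (c : Cmd) (s : RamState) (Q : RamState → ℕ → Prop) : Prop :=
  ∃ s' t, SafeExec w c s s' t ∧ Q s' t

theorem Run.mono {w : ℕ} {c : Cmd} {s : RamState} {Q Q' : RamState → ℕ → Prop}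
    (h : Run w c s Q) (hQ : ∀ s' t, Q s' t → Q' s' t) : Run w c s Q' := by
  obtain ⟨s', t, h, hq⟩ := h
  exact ⟨s', t, h, hQ _ _ hq⟩

/-! ### Weakest preconditions: equivalences by which `simp` executes programs symbolically -/

section
variable {w : ℕ} {s : RamState} {Q : RamState → ℕ → Prop}

@[simp] theorem run_skip : Run w .skip s Q ↔ Q s 1 :=
  ⟨fun ⟨_, _, h, hq⟩ => by cases h; exact hq, fun h => ⟨_, _, .skip s, h⟩⟩

@[simp] theorem run_const {r k : ℕ} :
    Run w (.const r k) s Q ↔ k < 2 ^ w ∧ Q (s.setReg r k) 1 :=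
  ⟨fun ⟨_, _, h, hq⟩ => by cases h with | const h => exact ⟨h, hq⟩,
    fun ⟨h, hq⟩ => ⟨_, _, .const h, hq⟩⟩

theorem run_op {o : WordOp} {r a b : ℕ} :
    Run w (.op o r a b) s Q ↔ o.Safe w (s.reg a) (s.reg b) ∧
      Q (s.setReg r (o.val (s.reg a) (s.reg b))) 1 :=
  ⟨fun ⟨_, _, h, hq⟩ => by cases h with | op h => exact ⟨h, hq⟩,
    fun ⟨h, hq⟩ => ⟨_, _, .op h, hq⟩⟩

@[simp] theorem run_add {r a b : ℕ} :
    Run w (.op .add r a b) s Q ↔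
      s.reg a + s.reg b < 2 ^ w ∧ Q (s.setReg r (s.reg a + s.reg b)) 1 := run_op

@[simp] theorem run_sub {r a b : ℕ} :
    Run w (.op .sub r a b) s Q ↔
      (s.reg b ≤ s.reg a ∧ s.reg a < 2 ^ w) ∧ Q (s.setReg r (s.reg a - s.reg b)) 1 := run_op

@[simp] theorem run_mul {r a b : ℕ} :
    Run w (.op .mul r a b) s Q ↔
      s.reg a * s.reg b < 2 ^ w ∧ Q (s.setReg r (s.reg a * s.reg b)) 1 := run_op

@[simp] theorem run_load {r a : ℕ} :
    Run w (.load r a) s Q ↔ Q (s.setReg r (s.mem (s.reg a))) 1 :=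
  ⟨fun ⟨_, _, h, hq⟩ => by cases h; exact hq, fun h => ⟨_, _, .load r a s, h⟩⟩

@[simp] theorem run_store {r a : ℕ} :
    Run w (.store a r) s Q ↔ Q (s.setMem (s.reg a) (s.reg r)) 1 :=
  ⟨fun ⟨_, _, h, hq⟩ => by cases h; exact hq, fun h => ⟨_, _, .store a r s, h⟩⟩

@[simp] theorem run_seq {c₁ c₂ : Cmd} :
    Run w (.seq c₁ c₂) s Q ↔
      Run w c₁ s fun s₁ t₁ => Run w c₂ s₁ fun s₂ t₂ => Q s₂ (t₁ + t₂) := by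
  constructor
  · rintro ⟨_, _, h, hq⟩
    cases h with | seq h₁ h₂ => exact ⟨_, _, h₁, _, _, h₂, hq⟩
  · rintro ⟨_, _, h₁, _, _, h₂, hq⟩
    exact ⟨_, _, .seq h₁ h₂, hq⟩

@[simp] theorem run_ite {b : RegTest} {c₁ c₂ : Cmd} :
    Run w (.ite b c₁ c₂) s Q ↔
      (b.Holds s → Run w c₁ s fun s' t => Q s' (t + 1)) ∧
      (¬ b.Holds s → Run w c₂ s fun s' t => Q s' (t + 1)) := by
  constructor
  · rintro ⟨_, _, h, hq⟩
    cases h with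
    | iteTrue hb h => exact ⟨fun _ => ⟨_, _, h, hq⟩, fun hn => absurd hb hn⟩
    | iteFalse hb h => exact ⟨fun hn => absurd hn hb, fun _ => ⟨_, _, h, hq⟩⟩
  · rintro ⟨h₁, h₂⟩
    by_cases hb : b.Holds s
    · obtain ⟨_, _, h, hq⟩ := h₁ hb
      exact ⟨_, _, .iteTrue hb h, hq⟩
    · obtain ⟨_, _, h, hq⟩ := h₂ hb
      exact ⟨_, _, .iteFalse hb h, hq⟩

@[simp] theorem holds_lt {a b : ℕ} : (RegTest.lt a b).Holds s ↔ s.reg a < s.reg b := Iff.rfl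
@[simp] theorem holds_eq {a b : ℕ} : (RegTest.eq a b).Holds s ↔ s.reg a = s.reg b := Iff.rfl

@[simp] theorem reg_setReg {r v x : ℕ} :
    (s.setReg r v).reg x = if x = r then v else s.reg x := by
  simp [RamState.setReg, Function.update_apply]
@[simp] theorem mem_setReg {r v : ℕ} : (s.setReg r v).mem = s.mem := rfl
@[simp] theorem reg_setMem {a v : ℕ} : (s.setMem a v).reg = s.reg := rfl
@[simp] theorem mem_setMem {a v x : ℕ} :
    (s.setMem a v).mem x = if x = a then v else s.mem x := by
  simp [RamState.setMem, Function.update_apply]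

end

/-! ### Registers that a program leaves alone -/

/-- The registers that a program can write to. -/
def Cmd.writes : Cmd → List ℕ
  | .skip => []
  | .const r _ => [r]
  | .op _ r _ _ => [r]
  | .load r _ => [r]
  | .store _ _ => []
  | .seq c₁ c₂ => c₁.writes ++ c₂.writes
  | .ite _ c₁ c₂ => c₁.writes ++ c₂.writes
  | .loop _ c => c.writes

theorem SafeExec.reg_eq {w : ℕ} {c : Cmd} {s s' : RamState} {t : ℕ} (h : SafeExec w c s s' t) :
    ∀ r, r ∉ c.writes → s'.reg r = s.reg r := by
  induction h with
  | skip | store => intro r _; rfl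
  | const | op | load => intro r hr; simp_all [Cmd.writes]
  | seq _ _ h₁ h₂ =>
    intro r hr
    simp only [Cmd.writes, List.mem_append, not_or] at hr
    rw [h₂ r hr.2, h₁ r hr.1]
  | iteTrue _ _ h =>
    intro r hr
    simp only [Cmd.writes, List.mem_append, not_or] at hr
    exact h r hr.1
  | iteFalse _ _ h =>
    intro r hr
    simp only [Cmd.writes, List.mem_append, not_or] at hr
    exact h r hr.2
  | loopDone => intro r _; rfl
  | loopStep _ _ _ h₁ h₂ =>
    intro r hr
    rw [h₂ r hr, h₁ r hr]

/-- Makes preservation of registers a syntactic matter: the write set of a concrete program is a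
concrete list, so `decide` usually settles membership, and loop invariants need to mention only what
changes. -/
theorem Run.frame {w : ℕ} {c : Cmd} {s : RamState} {Q : RamState → ℕ → Prop}
    (h : Run w c s Q) :
    Run w c s fun s' t => Q s' t ∧ ∀ r, r ∉ c.writes → s'.reg r = s.reg r := by
  obtain ⟨s', t, h, hq⟩ := h
  exact ⟨s', t, h, hq, h.reg_eq⟩

/-- Counted loops. -/
theorem Run.loop {w : ℕ} {b : RegTest} {c : Cmd} {s : RamState} (N B : ℕ)
    (I : ℕ → RamState → Prop) (h0 : I 0 s)
    (hstep : ∀ k < N, ∀ s', I k s' → (∀ r, r ∉ c.writes → s'.reg r = s.reg r) →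
      b.Holds s' ∧ Run w c s' fun s'' t => I (k + 1) s'' ∧ t ≤ B)
    (hend : ∀ s', I N s' → (∀ r, r ∉ c.writes → s'.reg r = s.reg r) → ¬ b.Holds s') :
    Run w (.loop b c) s fun s' t =>
      (I N s' ∧ ∀ r, r ∉ c.writes → s'.reg r = s.reg r) ∧ t ≤ N * (B + 1) + 1 := by
  -- Induction on the number `n` of iterations left. Each iteration costs its body and one test; the
  -- final `1` is the failing test.
  have key : ∀ n k, k + n = N → ∀ s', I k s' → (∀ r, r ∉ c.writes → s'.reg r = s.reg r) →
      Run w (.loop b c) s' fun s' t =>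
        (I N s' ∧ ∀ r, r ∉ c.writes → s'.reg r = s.reg r) ∧ t ≤ n * (B + 1) + 1 := by
    intro n
    induction n with
    | zero =>
      intro k hk s' hI hf
      obtain rfl : k = N := by omega
      exact ⟨s', 1, .loopDone (hend s' hI hf), ⟨hI, hf⟩, by omega⟩
    | succ n ih =>
      intro k hk s' hI hf
      obtain ⟨hb, s'', t, he, hI', ht⟩ := hstep k (by omega) s' hI hf
      obtain ⟨s₃, t₃, he₃, h₃, ht₃⟩ := ih (k + 1) (by omega) s'' hI'
        fun r hr => (he.reg_eq r hr).trans (hf r hr)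
      refine ⟨s₃, _, .loopStep hb he he₃, h₃, ?_⟩
      rw [Nat.succ_mul]
      omega
  exact key N 0 (by omega) s h0 fun _ _ => rfl

noncomputable section

open scoped Classical

/-! ### Inversions of permutations -/

/-- The number of inversions of a permutation. -/
def inversions {K : ℕ} (σ : Equiv.Perm (Fin K)) : ℕ :=
  (Finset.univ.filter fun x : Fin K × Fin K => x.1 < x.2 ∧ σ x.2 < σ x.1).card

/-- The transposition of the positions `j` and `j + 1`. -/
def adjSwap (K j : ℕ) : Equiv.Perm (Fin K) :=
  if h : j + 1 < K then Equiv.swap ⟨j, by omega⟩ ⟨j + 1, h⟩ else 1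

/-- `σ` has a descent at `j`. -/
def IsDescent {K : ℕ} (σ : Equiv.Perm (Fin K)) (j : ℕ) : Prop :=
  ∃ h : j + 1 < K, σ ⟨j + 1, h⟩ < σ ⟨j, by omega⟩

theorem adjSwap_mul_self (K j : ℕ) : adjSwap K j * adjSwap K j = 1 := by
  unfold adjSwap
  split_ifs <;> simp

/-- Only two neighbouring positions trade places, so no pair of positions other than these two can
change its order. -/
theorem adjSwap_lt {K j : ℕ} (h : j + 1 < K) {a b : Fin K} (hab : a < b)
    (hne : (a, b) ≠ (⟨j, by omega⟩, ⟨j + 1, h⟩)) : adjSwap K j a < adjSwap K j b := by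
  simp only [adjSwap, dif_pos h, Equiv.swap_apply_def]
  simp only [ne_eq, Prod.mk.injEq, Fin.ext_iff, Fin.lt_def] at *
  split_ifs <;> (try dsimp only) <;> omega

/-- Applying the transposition to both positions of a pair matches the inversions of the product
with those inversions of `σ` that are not the descent itself. -/
theorem inversions_mul_adjSwap {K j : ℕ} {σ : Equiv.Perm (Fin K)} (hd : IsDescent σ j) :
    inversions (σ * adjSwap K j) + 1 = inversions σ := by
  obtain ⟨h, hd⟩ := hd
  set i : Fin K := ⟨j, by omega⟩ with hi
  set i' : Fin K := ⟨j + 1, h⟩ with hi'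
  have hs : ∀ a, adjSwap K j (adjSwap K j a) = a := fun a => by
    rw [← Equiv.Perm.mul_apply, adjSwap_mul_self, Equiv.Perm.one_apply]
  have hsi : adjSwap K j i = i' := by simp [adjSwap, dif_pos h, hi, hi']
  have hsi' : adjSwap K j i' = i := by simp [adjSwap, dif_pos h, hi, hi']
  have hlt : i < i' := by simp [hi, hi', Fin.lt_def]
  have hmem : (i, i') ∈ Finset.univ.filter fun x : Fin K × Fin K => x.1 < x.2 ∧ σ x.2 < σ x.1 := by
    simp [hlt, hd]
  unfold inversions
  rw [← Finset.card_erase_add_one hmem]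
  congr 1
  refine Finset.card_bij' (fun x _ => (adjSwap K j x.1, adjSwap K j x.2))
    (fun x _ => (adjSwap K j x.1, adjSwap K j x.2)) ?_ ?_ ?_ ?_
  · rintro ⟨a, b⟩ hx
    replace hx := (Finset.mem_filter.1 hx).2
    simp only [Equiv.Perm.mul_apply] at hx
    have hne : (a, b) ≠ (i, i') := by
      rintro hab
      simp only [Prod.mk.injEq] at hab
      rw [hab.1, hab.2, hsi, hsi'] at hx
      exact absurd (hx.2.trans hd) (lt_irrefl _)
    simp only [Finset.mem_erase, Finset.mem_filter, Finset.mem_univ, true_and]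
    refine ⟨fun hab => ?_, adjSwap_lt h hx.1 hne, hx.2⟩
    simp only [Prod.mk.injEq] at hab
    have h1 : a = i' := by rw [← hs a, hab.1, hsi]
    have h2 : b = i := by rw [← hs b, hab.2, hsi']
    rw [h1, h2] at hx
    exact absurd (hx.1.trans hlt) (lt_irrefl _)
  · rintro ⟨a, b⟩ hx
    simp only [Finset.mem_erase, Finset.mem_filter, Finset.mem_univ, true_and] at hx
    refine Finset.mem_filter.2 ⟨Finset.mem_univ _, ?_⟩
    simp only [Equiv.Perm.mul_apply, hs]
    exact ⟨adjSwap_lt h hx.2.1 hx.1, hx.2.2⟩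
  · rintro ⟨a, b⟩ _
    simp [hs]
  · rintro ⟨a, b⟩ _
    simp [hs]

theorem isDescent_mul_adjSwap {K j : ℕ} (h : j + 1 < K) (σ : Equiv.Perm (Fin K)) :
    IsDescent (σ * adjSwap K j) j ↔ ¬ IsDescent σ j := by
  simp only [IsDescent, h, exists_true_left, Equiv.Perm.mul_apply, adjSwap, dif_pos,
    Equiv.swap_apply_left, Equiv.swap_apply_right, not_lt]
  refine ⟨le_of_lt, fun hle => lt_of_le_of_ne hle fun he => ?_⟩
  simpa [Fin.ext_iff] using σ.injective he

/-- The number of descents. -/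
def descents {K : ℕ} (σ : Equiv.Perm (Fin K)) : ℕ :=
  ((Finset.range (K - 1)).filter fun j => IsDescent σ j).card

theorem descents_le {K : ℕ} (σ : Equiv.Perm (Fin K)) : descents σ ≤ K - 1 := by
  exact (Finset.card_filter_le _ _).trans (by simp)

theorem card_ascents {K : ℕ} (σ : Equiv.Perm (Fin K)) :
    ((Finset.range (K - 1)).filter fun j => ¬ IsDescent σ j).card = K - 1 - descents σ := by
  have h : _ + _ = (Finset.range (K - 1)).card :=
    Finset.card_filter_add_card_filter_not (s := Finset.range (K - 1)) (IsDescent σ)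
  rw [Finset.card_range] at h
  exact Nat.eq_sub_of_add_eq' h

/-- The edges between two consecutive layers of the weak order, counted from both sides. -/
theorem sum_ascents_eq_sum_descents (K e : ℕ) :
    ∑ σ : Equiv.Perm (Fin K) with inversions σ = e, (K - 1 - descents σ) =
      ∑ σ : Equiv.Perm (Fin K) with inversions σ = e + 1, descents σ := by
  simp only [← card_ascents]
  simp only [descents]
  rw [← Finset.card_sigma, ← Finset.card_sigma]
  -- An edge of the weak order is an ascent of its lower end and a descent of its upper end at the
  -- same place `j`; the transposition is an involution, so one map serves in both directions.
  refine Finset.card_bij' (fun x _ => ⟨x.1 * adjSwap K x.2, x.2⟩)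
    (fun x _ => ⟨x.1 * adjSwap K x.2, x.2⟩) ?_ ?_ ?_ ?_
  · rintro ⟨σ, j⟩ hx
    simp only [Finset.mem_sigma, Finset.mem_filter, Finset.mem_univ, true_and,
      Finset.mem_range] at hx ⊢
    obtain ⟨h1, h2, h3⟩ := hx
    have hd := (isDescent_mul_adjSwap (by omega) σ).2 h3
    have := inversions_mul_adjSwap hd
    rw [mul_assoc, adjSwap_mul_self, mul_one] at this
    exact ⟨by omega, h2, hd⟩
  · rintro ⟨σ, j⟩ hx
    simp only [Finset.mem_sigma, Finset.mem_filter, Finset.mem_univ, true_and,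
      Finset.mem_range] at hx ⊢
    obtain ⟨h1, h2, h3⟩ := hx
    have := inversions_mul_adjSwap h3
    exact ⟨by omega, h2, fun h => (isDescent_mul_adjSwap (by omega) σ).1 h h3⟩
  · rintro ⟨σ, j⟩ _
    simp [mul_assoc, adjSwap_mul_self]
  · rintro ⟨σ, j⟩ _
    simp [mul_assoc, adjSwap_mul_self]

/-- A strictly increasing self-map of `Fin K` lies above the identity; this applies to `σ` and to
its inverse. -/
theorem eq_one_of_strictMono {K : ℕ} {σ : Equiv.Perm (Fin K)} (h : StrictMono σ) : σ = 1 := by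
  ext x
  have h1 : x ≤ σ x := h.le_apply
  have h2 : StrictMono σ.symm := fun a b hab => by
    by_contra hn
    have := h.monotone (not_lt.1 hn)
    simp only [Equiv.apply_symm_apply] at this
    exact absurd (hab.trans_le this) (lt_irrefl _)
  have h3 : σ x ≤ σ.symm (σ x) := h2.le_apply
  rw [Equiv.symm_apply_apply] at h3
  exact congrArg Fin.val (le_antisymm h3 h1)

theorem exists_isDescent {K : ℕ} {σ : Equiv.Perm (Fin K)} (hσ : σ ≠ 1) : ∃ j, IsDescent σ j := by
  by_contra! hn
  apply hσ
  have hmono : StrictMono σ := by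
    rcases K with _ | K
    · exact fun a => a.elim0
    · refine Fin.strictMono_iff_lt_succ.2 fun i => ?_
      have h1 : ¬ σ i.succ < σ i.castSucc := fun h => hn i ⟨by omega, h⟩
      exact lt_of_le_of_ne (not_lt.1 h1) fun he => by
        simpa [Fin.ext_iff] using σ.injective he
  exact eq_one_of_strictMono hmono

theorem inversions_one (K : ℕ) : inversions (1 : Equiv.Perm (Fin K)) = 0 := by
  refine Finset.card_eq_zero.2 (Finset.filter_eq_empty_iff.2 ?_)
  rintro ⟨a, b⟩ _ h
  exact absurd (h.1.trans h.2) (lt_irrefl _)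

theorem inversions_eq_zero {K : ℕ} {σ : Equiv.Perm (Fin K)} : inversions σ = 0 ↔ σ = 1 := by
  refine ⟨fun h => ?_, fun h => h ▸ inversions_one K⟩
  by_contra hσ
  obtain ⟨j, hj⟩ := exists_isDescent hσ
  have := inversions_mul_adjSwap hj
  omega

/-- Used twice: a missing preference leaves a strictly positive deficit in the descent count of its
layer, and a row without descents must be the candidate. -/
theorem descents_pos {K : ℕ} {σ : Equiv.Perm (Fin K)} (hσ : σ ≠ 1) : 0 < descents σ := by
  obtain ⟨j, hj⟩ := exists_isDescent hσ
  refine Finset.card_pos.2 ⟨j, Finset.mem_filter.2 ⟨Finset.mem_range.2 ?_, hj⟩⟩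
  have := hj.1
  omega

theorem inversions_le {K : ℕ} (σ : Equiv.Perm (Fin K)) : inversions σ ≤ K * K := by
  refine (Finset.card_filter_le _ _).trans ?_
  simp

/-! ### Preferences as permutations -/

namespace Preference

variable {K : ℕ}

theorem ext_rel {p q : Preference K} (h : ∀ a b, p.rel a b ↔ q.rel a b) : p = q := by
  obtain ⟨r, _, _, _⟩ := p
  obtain ⟨r', _, _, _⟩ := q
  obtain rfl : r = r' := by
    funext a b
    exact propext (h a b)
  rfl

/-- The position of an alternative. -/
def pos (p : Preference K) (a : Fin K) : Fin K :=
  ⟨(Finset.univ.filter fun b => p.rel b a).card, by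
    calc _ < (Finset.univ : Finset (Fin K)).card := Finset.card_lt_card ⟨Finset.subset_univ _,
          fun h => p.irrefl a (by simpa using h (Finset.mem_univ a))⟩
      _ = K := by simp⟩

theorem pos_lt_pos (p : Preference K) {a b : Fin K} (h : p.rel a b) : p.pos a < p.pos b := by
  change (Finset.univ.filter fun c => p.rel c a).card < (Finset.univ.filter fun c => p.rel c b).card
  refine Finset.card_lt_card ⟨fun c hc => ?_, fun hs => ?_⟩
  · simp only [Finset.mem_filter, Finset.mem_univ, true_and] at hc ⊢
    exact p.trans _ _ _ hc h
  · exact p.irrefl a (by simpa using hs (by simpa using h))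

theorem pos_injective (p : Preference K) : Function.Injective p.pos := by
  intro a b hab
  by_contra hne
  rcases p.total a b hne with h | h
  · exact absurd (p.pos_lt_pos h) (by simp [hab])
  · exact absurd (p.pos_lt_pos h) (by simp [hab])

/-- The alternatives from best to worst. -/
def ranking (p : Preference K) : Equiv.Perm (Fin K) :=
  (Equiv.ofBijective p.pos (Finite.injective_iff_bijective.1 p.pos_injective)).symm

theorem rel_iff (p : Preference K) {a b : Fin K} :
    p.rel a b ↔ p.ranking⁻¹ a < p.ranking⁻¹ b := by
  have h : ∀ c, p.ranking⁻¹ c = p.pos c := fun c => rfl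
  rw [h, h]
  refine ⟨p.pos_lt_pos, fun hlt => ?_⟩
  rcases p.total a b (fun hab => by simp [hab] at hlt) with h | h
  · exact h
  · exact absurd (hlt.trans (p.pos_lt_pos h)) (lt_irrefl _)

/-- The preference with the given ranking. -/
def ofPerm (σ : Equiv.Perm (Fin K)) : Preference K where
  rel a b := σ⁻¹ a < σ⁻¹ b
  irrefl _ := lt_irrefl _
  trans _ _ _ := lt_trans
  total _ _ h := lt_or_gt_of_ne fun he => h (σ⁻¹.injective he)

/-- Followed by the inverse ranking, such a listing becomes a strictly increasing permutation, hence
the identity. So the memory image of a preference is unique. -/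
theorem eq_ranking {p : Preference K} {r : Fin K → Fin K}
    (h : ∀ i j, p.rel (r i) (r j) ↔ i < j) : r = p.ranking := by
  have hm : StrictMono (fun i => p.ranking⁻¹ (r i)) := fun i j hij => p.rel_iff.1 ((h i j).2 hij)
  have hb : Function.Bijective (fun i => p.ranking⁻¹ (r i)) :=
    Finite.injective_iff_bijective.1 hm.injective
  have h1 := eq_one_of_strictMono (σ := Equiv.ofBijective _ hb) hm
  funext i
  have h2 : p.ranking⁻¹ (r i) = i := congrArg (fun σ => σ i) h1
  exact ((Equiv.symm_apply_eq _).1 h2)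

theorem ranking_ofPerm (σ : Equiv.Perm (Fin K)) : (ofPerm σ).ranking = σ := by
  have : (σ : Fin K → Fin K) = (ofPerm σ).ranking := eq_ranking fun i j => by simp [ofPerm]
  exact (DFunLike.coe_injective this).symm

theorem ofPerm_ranking (p : Preference K) : ofPerm p.ranking = p :=
  ext_rel fun _ _ => (rel_iff p).symm

/-- Preferences correspond to permutations. -/
def equivPerm (K : ℕ) : Preference K ≃ Equiv.Perm (Fin K) where
  toFun := ranking
  invFun := ofPerm
  left_inv := ofPerm_ranking
  right_inv := ranking_ofPerm

instance : Fintype (Preference K) := Fintype.ofEquiv _ (equivPerm K).symm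

theorem ranking_injective : Function.Injective (ranking (K := K)) := (equivPerm K).injective

/-- The ranking of `p` in terms of the positions in `q`. -/
def relTo (q p : Preference K) : Equiv.Perm (Fin K) := q.ranking⁻¹ * p.ranking

theorem relTo_injective (q : Preference K) : Function.Injective q.relTo := fun _ _ h =>
  ranking_injective (mul_left_cancel h)

theorem relTo_self (q : Preference K) : q.relTo q = 1 := by simp [relTo]

theorem relTo_eq_one {q p : Preference K} : q.relTo p = 1 ↔ p = q :=
  ⟨fun h => q.relTo_injective (h.trans q.relTo_self.symm), fun h => h ▸ q.relTo_self⟩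

/-- Interchange of the alternatives at the positions `j` and `j + 1`. -/
def swapAt (p : Preference K) (j : ℕ) : Preference K := ofPerm (p.ranking * adjSwap K j)

theorem relTo_swapAt (q p : Preference K) (j : ℕ) :
    q.relTo (p.swapAt j) = q.relTo p * adjSwap K j := by
  simp [relTo, swapAt, ranking_ofPerm, mul_assoc]

end Preference

open Preference

/-- Replacing alternatives by their positions in `p` turns disagreements into inversions of the
relative permutation, so the geometry around `q` is that of the symmetric group around `1`. -/
theorem invDist_eq {K : ℕ} (p q : Preference K) : invDist p q = inversions (q.relTo p) := by
  unfold invDist inversions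
  refine Finset.card_bij' (fun x _ => (p.ranking⁻¹ x.1, p.ranking⁻¹ x.2))
    (fun x _ => (p.ranking x.1, p.ranking x.2)) ?_ ?_ ?_ ?_
  · rintro ⟨a, b⟩ hx
    simp only [Finset.mem_filter, Finset.mem_univ, true_and] at hx ⊢
    rw [rel_iff, rel_iff] at hx
    simpa [relTo] using hx
  · rintro ⟨a, b⟩ hx
    simp only [Finset.mem_filter, Finset.mem_univ, true_and] at hx ⊢
    rw [rel_iff, rel_iff]
    simpa [relTo] using hx
  · simp
  · simp

theorem invDist_self {K : ℕ} (p : Preference K) : invDist p p = 0 := by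
  rw [invDist_eq, relTo_self, inversions_one]

theorem invDist_eq_zero {K : ℕ} {p q : Preference K} : invDist p q = 0 ↔ p = q := by
  rw [invDist_eq, inversions_eq_zero, relTo_eq_one]

theorem invDist_le {K : ℕ} (p q : Preference K) : invDist p q ≤ K * K := by
  rw [invDist_eq]
  exact inversions_le _

theorem invDist_swapAt {K j : ℕ} {p q : Preference K} (h : IsDescent (q.relTo p) j) :
    invDist (p.swapAt j) q + 1 = invDist p q := by
  rw [invDist_eq, invDist_eq, relTo_swapAt, inversions_mul_adjSwap h]

/-- Relabelling the alternatives by their positions in `q` carries `q` to the identity, so the size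
of a layer does not depend on the centre. -/
theorem mahonian_eq {K : ℕ} (q : Preference K) (j : ℕ) :
    mahonian K j = (Finset.univ.filter fun p => invDist p q = j).card := by
  have : mahonian K j =
      (Finset.univ.filter fun σ : Equiv.Perm (Fin K) => inversions σ = j).card := by
    unfold mahonian inversions
    congr
  rw [this]
  refine (Finset.card_bij (fun p _ => q.relTo p) ?_ ?_ ?_).symm
  · intro p hp
    simpa [invDist_eq] using hp
  · intro p _ p' _ h
    exact q.relTo_injective h
  · intro σ hσ
    refine ⟨ofPerm (q.ranking * σ), ?_, ?_⟩ <;> simp_all [invDist_eq, relTo, ranking_ofPerm]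

theorem sum_mahonian {K : ℕ} (q : Preference K) (d : ℕ) :
    ∑ j ∈ Finset.range d, mahonian K j = (Finset.univ.filter fun p => invDist p q < d).card := by
  induction d with
  | zero => simp
  | succ d ih =>
    rw [Finset.sum_range_succ, ih, mahonian_eq q, ← Finset.card_union_of_disjoint]
    · congr 1
      ext p
      simp only [Finset.mem_union, Finset.mem_filter, Finset.mem_univ, true_and]
      omega
    · rw [Finset.disjoint_filter]
      intro p _ h
      omega

theorem sum_layer_ascents {K : ℕ} (q : Preference K) (e : ℕ) :
    ∑ p with invDist p q = e, (K - 1 - descents (q.relTo p)) =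
      ∑ p with invDist p q = e + 1, descents (q.relTo p) := by
  have key : ∀ (f : Equiv.Perm (Fin K) → ℕ) (e : ℕ), ∑ p with invDist p q = e, f (q.relTo p) =
      ∑ σ : Equiv.Perm (Fin K) with inversions σ = e, f σ := by
    intro f e
    refine Finset.sum_bij (fun p _ => q.relTo p) ?_ ?_ ?_ ?_
    · intro p hp
      simpa [invDist_eq] using hp
    · intro p _ p' _ h
      exact q.relTo_injective h
    · intro σ hσ
      refine ⟨ofPerm (q.ranking * σ), ?_, ?_⟩ <;> simp_all [invDist_eq, relTo, ranking_ofPerm]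
    · intro p _
      rfl
  rw [key (fun σ => K - 1 - descents σ), key descents]
  exact sum_ascents_eq_sum_descents K e

end

noncomputable section

open scoped Classical
open Preference

/-! ### Correctness of the two algorithms -/

section Correctness

variable {K n : ℕ} {π : Profile K n} {l : List (Preference K)} {p₀ : Preference K}

theorem freq_pos_iff {p : Preference K} : 0 < freq π p ↔ ∃ i, π i = p := by
  simp [freq, Finset.card_pos, Finset.Nonempty]

theorem IsListing.mem_iff (h : IsListing π l) {p : Preference K} : p ∈ l ↔ 0 < freq π p := by
  rw [h.2, freq_pos_iff]

theorem IsListing.length_pos (h : IsListing π l) (hn : 0 < n) : 0 < l.length :=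
  List.length_pos_of_mem ((h.2 (π ⟨0, hn⟩)).2 ⟨_, rfl⟩)

/-- Splits the comparisons according to whether the rarer preference occurs. If it does not, its
frequency is zero and every occurring preference beats it, which forces closure under smaller
distance. -/
theorem flexibleConsensusAround_iff (h : IsListing π l) :
    FlexibleConsensusAround π p₀ ↔
      (∀ p ∈ l, ∀ p' ∈ l, freq π p < freq π p' → invDist p' p₀ ≤ invDist p p₀) ∧
      ∀ p ∈ l, ∀ q, invDist q p₀ < invDist p p₀ → q ∈ l := by
  constructor
  · intro hf
    refine ⟨fun p _ p' _ hlt => hf p' p hlt, fun p hp q hq => ?_⟩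
    by_contra hn
    rw [h.mem_iff] at hn hp
    have := hf p q (by omega)
    omega
  · rintro ⟨h1, h2⟩ p' p hlt
    have hp' : p' ∈ l := h.mem_iff.2 (by omega)
    by_cases hp : p ∈ l
    · exact h1 p hp p' hp' hlt
    · by_contra hn
      exact hp (h2 p' hp' p (by omega))

theorem checkAlg_iff (hn : 0 < n) (h : IsFreqDistOrder π p₀ l) :
    checkAlg π p₀ l = true ↔ FlexibleConsensusAround π p₀ := by
  obtain ⟨hl, ho⟩ := h
  have hpos := hl.length_pos hn
  rw [flexibleConsensusAround_iff hl]
  unfold checkAlg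
  split_ifs with hbad
  · obtain ⟨i, hi, h1, h2⟩ := hbad
    simp only [false_iff, not_and]
    intro h3
    have := h3 _ (List.getElem_mem hi) _ (List.getElem_mem (Nat.lt_of_succ_lt hi)) h1
    omega
  -- If the distance drops between neighbours, the tie-break excludes equal frequency, so the
  -- frequency drops as well, and this is the pair that the scan rejects. Hence adjacent tests
  -- suffice.
  · have hmono : ∀ i j (hij : i ≤ j) (hj : j < l.length),
        invDist l[i] p₀ ≤ invDist l[j] p₀ := by
      intro i j hij
      induction j, hij using Nat.le_induction with
      | base => intro _; exact le_rfl
      | succ j hij ih =>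
        intro hj
        refine (ih (by omega)).trans ?_
        by_contra hlt
        rcases List.pairwise_iff_getElem.1 ho j (j + 1) (by omega) hj (by omega) with h1 | h1
        · exact hbad ⟨j, hj, h1, by omega⟩
        · omega
    have hd : (l.map fun p => invDist p p₀).getLastD 0 = invDist l[l.length - 1] p₀ := by
      rw [List.getLastD_eq_getLast?, List.getLast?_eq_getElem?]
      simp [List.getElem?_eq_getElem (show l.length - 1 < l.length by omega)]
    have hmax : ∀ p ∈ l, invDist p p₀ ≤ invDist l[l.length - 1] p₀ := by
      intro p hp
      obtain ⟨i, hi, rfl⟩ := List.getElem_of_mem hp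
      exact hmono _ _ (by omega) _
    simp only [hd, decide_eq_true_eq]
    set D := invDist l[l.length - 1] p₀ with hD
    have hcard : (l.filter fun p => decide (invDist p p₀ < D)).length =
        (l.toFinset.filter fun p => invDist p p₀ < D).card := by
      rw [← List.toFinset_card_of_nodup (hl.1.filter _), List.toFinset_filter]
      simp
    have hsub : (l.toFinset.filter fun p => invDist p p₀ < D) ⊆
        Finset.univ.filter fun p => invDist p p₀ < D :=
      Finset.filter_subset_filter _ (Finset.subset_univ _)
    rw [sum_mahonian p₀, hcard]
    constructor
    -- The listed part of the open ball is a subset of the ball, so equal cardinalities mean equal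
    -- sets.
    · intro he
      have heq := Finset.eq_of_subset_of_card_le hsub he.le
      refine ⟨fun p hp p' hp' hlt => ?_, fun p hp q hq => ?_⟩
      · obtain ⟨i, hi, rfl⟩ := List.getElem_of_mem hp
        obtain ⟨j, hj, rfl⟩ := List.getElem_of_mem hp'
        rcases lt_trichotomy i j with hij | rfl | hij
        · have := List.pairwise_iff_getElem.1 ho i j hi hj hij
          omega
        · omega
        · exact hmono _ _ hij.le _
      · have : q ∈ Finset.univ.filter fun p => invDist p p₀ < D := by
          have := hmax p hp
          simp only [Finset.mem_filter, Finset.mem_univ, true_and]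
          omega
        rw [← heq] at this
        simpa using (Finset.mem_filter.1 this).1
    · rintro ⟨-, h2⟩
      congr 1
      refine (Finset.Subset.antisymm hsub fun q hq => ?_).symm
      simp only [Finset.mem_filter, Finset.mem_univ, true_and] at hq
      simp only [Finset.mem_filter, List.mem_toFinset]
      exact ⟨h2 _ (List.getElem_mem _) q hq, hq⟩

theorem IsFreqOrder.exists_max (h : IsFreqOrder π l) {p : Preference K} (hp : p ∈ l) :
    freq π p ≤ (l.map fun p => freq π p).headD 0 := by
  obtain ⟨_, ho⟩ := h
  rcases l with _ | ⟨a, l⟩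
  · simp at hp
  · rcases List.mem_cons.1 hp with rfl | hp
    · simp
    · simpa using (List.pairwise_cons.1 ho).1 p hp

/-- A centre of Flexible Consensus has maximal frequency. -/
theorem FlexibleConsensusAround.freq_le (h : FlexibleConsensusAround π p₀) (p : Preference K) :
    freq π p ≤ freq π p₀ := by
  by_contra hlt
  -- A more frequent `p` would be at distance at most `0` from the centre, hence be the centre.
  have := h p p₀ (by omega)
  rw [invDist_self, Nat.le_zero, invDist_eq_zero] at this
  rw [this] at hlt
  exact hlt le_rfl

theorem FlexibleConsensusAround.mem (hn : 0 < n) (hl : IsListing π l)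
    (h : FlexibleConsensusAround π p₀) : p₀ ∈ l := by
  have := h.freq_le (π ⟨0, hn⟩)
  have h2 : 0 < freq π (π ⟨0, hn⟩) := freq_pos_iff.2 ⟨_, rfl⟩
  exact hl.mem_iff.2 (by omega)

/-- In a list sorted by descending value the maximal entries form an initial segment, so stopping at
the first non-maximal one skips no candidate. -/
theorem mem_takeWhile_of_pairwise {α : Type*} {f : α → ℕ} :
    ∀ {l : List α} (_ : l.Pairwise fun p q => f q ≤ f p) {M : ℕ} (_ : ∀ p ∈ l, f p ≤ M)
      {p : α}, p ∈ l → f p = M → p ∈ l.takeWhile fun p => decide (f p = M)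
  | [], _, _, _, _, hp, _ => by simp at hp
  | a :: l, h, M, hM, p, hp, he => by
    have ha : f a = M := by
      have h1 := hM a (by simp)
      rcases List.mem_cons.1 hp with rfl | hp
      · exact he
      · have := (List.pairwise_cons.1 h).1 p hp
        omega
    rw [List.takeWhile_cons_of_pos (by simpa using ha)]
    rcases List.mem_cons.1 hp with rfl | hp
    · simp
    · exact List.mem_cons_of_mem _ (mem_takeWhile_of_pairwise (List.pairwise_cons.1 h).2
        (fun q hq => hM q (List.mem_cons_of_mem _ hq)) hp he)

theorem detectAlg_correct (hn : 0 < n) {ord : Preference K → List (Preference K)}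
    (h : IsFreqOrder π l) (ho : ∀ p₀, IsFreqDistOrder π p₀ (ord p₀)) :
    (∀ p, detectAlg π l ord = some p → FlexibleConsensusAround π p) ∧
      (detectAlg π l ord = none ↔ ¬ FlexibleConsensus π) := by
  constructor
  · intro p hp
    exact (checkAlg_iff hn (ho p)).1 (by simpa using List.find?_some hp)
  · unfold detectAlg FlexibleConsensus
    simp only [List.find?_eq_none]
    constructor
    · rintro hnone ⟨p, hp⟩
      have hmem := hp.mem hn h.1
      refine hnone p (mem_takeWhile_of_pairwise h.2 (fun q hq => h.exists_max hq) hmem ?_)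
        ((checkAlg_iff hn (ho p)).2 hp)
      refine le_antisymm (h.exists_max hmem) ?_
      rcases l with _ | ⟨a, l⟩
      · simp at hmem
      · simpa using hp.freq_le a
    · rintro hno p - hc
      exact hno ⟨p, (checkAlg_iff hn (ho p)).1 hc⟩

/-- Needed only as an existence statement: the program never produces this order, but its verdict is
compared with the procedure run on one. -/
theorem exists_isFreqDistOrder (hl : IsListing π l) (p₀ : Preference K) :
    ∃ l', IsFreqDistOrder π p₀ l' := by
  let r : Preference K → Preference K → Prop := fun p q =>
    freq π q < freq π p ∨ (freq π q = freq π p ∧ invDist p p₀ ≤ invDist q p₀)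
  have ht : IsTrans _ r := ⟨fun a b c h1 h2 => by simp only [r] at *; omega⟩
  have hto : Std.Total r := ⟨fun a b => by simp only [r]; omega⟩
  refine ⟨l.insertionSort r, ⟨?_, fun p => ?_⟩, List.pairwise_insertionSort r l⟩
  · exact (List.perm_insertionSort r l).nodup_iff.2 hl.1
  · rw [(List.perm_insertionSort r l).mem_iff, hl.2]

end Correctness

/-! ### Full layers -/

/-- Replaces Mahonian numbers by sums over listed preferences. Layer `0` consists of `q` alone. When
layer `e` is complete, its ascents count all descents of the full layer `e + 1`, and a missing
element of that layer would take away at least one of them. -/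
theorem layers_full_iff {K : ℕ} {q : Preference K} {S : Finset (Preference K)} (hq : q ∈ S)
    (D : ℕ) :
    (∀ p, invDist p q < D → p ∈ S) ↔
      ∀ e, e + 1 < D → ∑ p ∈ S with invDist p q = e, (K - 1 - descents (q.relTo p)) =
        ∑ p ∈ S with invDist p q = e + 1, descents (q.relTo p) := by
  have hfull : ∀ e, (∀ p, invDist p q = e → p ∈ S) →
      (S.filter fun p => invDist p q = e) = Finset.univ.filter fun p => invDist p q = e := by
    intro e he
    ext p
    simp only [Finset.mem_filter, Finset.mem_univ, true_and, and_iff_right_iff_imp]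
    exact he p
  constructor
  · intro h e he
    rw [hfull e fun p hp => h p (by omega), hfull (e + 1) fun p hp => h p (by omega)]
    exact sum_layer_ascents q e
  · intro h
    have key : ∀ e, e < D → ∀ p, invDist p q = e → p ∈ S := by
      intro e
      induction e with
      | zero =>
        intro _ p hp
        rwa [invDist_eq_zero.1 hp]
      | succ e ih =>
        intro he p hp
        by_contra hpS
        have h1 := h e he
        rw [hfull e (ih (by omega)), sum_layer_ascents q e] at h1
        -- The missing `p` has a positive number of descents because its distance `e + 1` excludes
        -- `p = q`; so the sum over the listed part is strictly smaller.
        refine absurd h1 (ne_of_gt (Finset.sum_lt_sum_of_subset (i := p) ?_ ?_ ?_ ?_ ?_))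
        · exact Finset.filter_subset_filter _ (Finset.subset_univ _)
        · simpa using hp
        · simp [hpS]
        · refine descents_pos fun h1 => ?_
          rw [invDist_eq, h1, inversions_one] at hp
          omega
        · intros
          omega
    exact fun p hp => key _ hp p rfl

/-- If every listed preference other than the centre has a listed one next to it, the distances
are below the number of listed preferences. -/
theorem invDist_lt_card {K : ℕ} {q : Preference K} {S : Finset (Preference K)}
    (hS : ∀ p ∈ S, p ≠ q → ∃ p' ∈ S, invDist p' q + 1 = invDist p q) {p : Preference K}
    (hp : p ∈ S) : invDist p q < S.card := by
  have key : ∀ d p, p ∈ S → invDist p q = d → ∀ e ≤ d, ∃ p' ∈ S, invDist p' q = e := by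
    intro d
    induction d with
    | zero => exact fun p hp hd e he => ⟨p, hp, by omega⟩
    | succ d ih =>
      intro p hp hd e he
      rcases Nat.lt_or_ge d e with h | h
      · exact ⟨p, hp, by omega⟩
      · obtain ⟨p', hp', hd'⟩ := hS p hp fun h => by
          rw [h, invDist_self] at hd
          omega
        exact ih p' hp' (by omega) e h
  -- Descending one step at a time meets every distance from `0` up to that of `p`. The bound lets
  -- distances index arrays with one cell per row.
  have hsub : Finset.range (invDist p q + 1) ⊆ S.image fun p => invDist p q := by
    intro e he
    obtain ⟨p', hp', h'⟩ := key _ p hp rfl e (by simpa [Nat.lt_succ_iff] using he)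
    exact Finset.mem_image.2 ⟨p', hp', h'⟩
  have h1 := Finset.card_le_card hsub
  have h2 := Finset.card_image_le (s := S) (f := fun p => invDist p q)
  rw [Finset.card_range] at h1
  omega

end

noncomputable section

open scoped Classical
open Preference

/-! ### Rankings in memory -/

namespace Preference

variable {K : ℕ}

/-- The alternative at position `j`, as a number. -/
def code (p : Preference K) (j : ℕ) : ℕ := if h : j < K then p.ranking ⟨j, h⟩ else 0

theorem code_lt (p : Preference K) {j : ℕ} (h : j < K) : p.code j < K := by
  simp [code, h]

theorem code_injective {p q : Preference K} (h : ∀ j < K, p.code j = q.code j) : p = q := by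
  apply ranking_injective
  ext j
  simpa [code] using h j j.2

end Preference

theorem holdsPref_iff {K : ℕ} {mem : ℕ → ℕ} {a : ℕ} {p : Preference K} :
    HoldsPref mem a p ↔ ∀ j < K, mem (a + j) = p.code j := by
  constructor
  · rintro ⟨r, h1, h2⟩ j hj
    rw [eq_ranking h1] at h2
    simpa [code, hj] using h2 ⟨j, hj⟩
  · intro h
    refine ⟨p.ranking, fun i j => ?_, fun i => ?_⟩
    · rw [rel_iff]
      simp
    · simpa [code] using h i i.2

/-! ### A dictionary in uninitialised memory -/

/-- Append `x` unless it occurs already. -/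
def insertEnd {α : Type*} (l : List α) (x : α) : List α := if x ∈ l then l else l ++ [x]

theorem mem_insertEnd {α : Type*} {l : List α} {x y : α} :
    y ∈ insertEnd l x ↔ y ∈ l ∨ y = x := by
  unfold insertEnd
  split_ifs with h <;> simp
  rintro rfl
  exact h

theorem nodup_insertEnd {α : Type*} {l : List α} {x : α} (h : l.Nodup) :
    (insertEnd l x).Nodup := by
  unfold insertEnd
  split_ifs with hx
  · exact h
  · exact List.nodup_append.2 ⟨h, by simp, fun y hy z hz he => hx (by simp_all)⟩

theorem prefix_insertEnd {α : Type*} (l : List α) (x : α) : l <+: insertEnd l x := by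
  unfold insertEnd
  split_ifs <;> simp

theorem length_insertEnd_le {α : Type*} (l : List α) (x : α) :
    (insertEnd l x).length ≤ l.length + 1 := by
  unfold insertEnd
  split_ifs <;> simp

/-- A number once assigned remains valid when the dictionary grows. -/
theorem idxOf_eq_of_prefix {α : Type*} [BEq α] [LawfulBEq α] {l l' : List α} {x : α} (h : l <+: l')
    (hx : x ∈ l) : l'.idxOf x = l.idxOf x := by
  obtain ⟨t, rfl⟩ := h
  exact List.idxOf_append_of_mem hx

/-- The memory holds a dictionary: cell `B + i` contains the key number `i`, and cell `T + k`
contains the number of the key `k`. Cells `T + k` for other `k` may contain anything. -/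
structure IsDict (mem : ℕ → ℕ) (T B : ℕ) (keys : List ℕ) : Prop where
  nodup : keys.Nodup
  back : ∀ (i : ℕ) (h : i < keys.length), mem (B + i) = keys[i]
  table : ∀ (i : ℕ) (h : i < keys.length), mem (T + keys[i]) = i

theorem IsDict.congr {mem mem' : ℕ → ℕ} {T B : ℕ} {keys : List ℕ} (h : IsDict mem T B keys)
    (hB : ∀ i < keys.length, mem' (B + i) = mem (B + i))
    (hT : ∀ k ∈ keys, mem' (T + k) = mem (T + k)) : IsDict mem' T B keys :=
  ⟨h.nodup, fun i hi => (hB i hi).trans (h.back i hi),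
    fun i hi => (hT _ (List.getElem_mem hi)).trans (h.table i hi)⟩

/-- Enter the key in register `28` at the end of the dictionary. -/
def appendKey (x : ℕ) : Cmd :=
  .seq (.op .add 28 (x + 2) 14) <| .seq (.store 29 28) <|
  .seq (.op .add 30 (x + 1) 28) <| .seq (.store 30 27) <| .op .add (x + 2) (x + 2) 15

/-- Put the number of the key in register `27` into register `28`; a new key is entered. The
addresses of the dictionary are in the registers `x` and `x + 1`, its size in `x + 2`. -/
def internKey (x : ℕ) : Cmd :=
  .seq (.op .add 29 x 27) <| .seq (.load 28 29) <|
  .ite (.lt 28 (x + 2))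
    (.seq (.op .add 30 (x + 1) 28) <| .seq (.load 30 30) <|
      .ite (.eq 30 27) .skip (appendKey x))
    (appendKey x)

/-- The two arrays certify each other: an entry of the table is trusted only if it is below the
current size and the array of keys points back to the key. Arbitrary old contents therefore do no
harm, no initialisation is needed, and the cost is constant. -/
theorem internKey_spec {w x L : ℕ} {s : RamState} {keys : List ℕ} (hx : x = 16 ∨ x = 19)
    (h14 : s.reg 14 = 0) (h15 : s.reg 15 = 1)
    (hB : s.reg (x + 1) = s.reg x + L) (hcnt : s.reg (x + 2) = keys.length)
    (hd : IsDict s.mem (s.reg x) (s.reg x + L) keys)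
    (hkeys : ∀ k ∈ keys, k < L) (hkey : s.reg 27 < L) (hlen : keys.length < L)
    (hw : s.reg x + 2 * L ≤ 2 ^ w) :
    Run w (internKey x) s fun s' t =>
      (s'.reg 28 = (insertEnd keys (s.reg 27)).idxOf (s.reg 27) ∧
      s'.reg (x + 2) = (insertEnd keys (s.reg 27)).length ∧
      IsDict s'.mem (s.reg x) (s.reg x + L) (insertEnd keys (s.reg 27)) ∧
      (∀ a, a < s.reg x ∨ s.reg x + 2 * L ≤ a → s'.mem a = s.mem a) ∧
      t ≤ 12) ∧ ∀ r, r ∉ (internKey x).writes → s'.reg r = s.reg r := by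
  have happ : s.reg 27 ∉ keys → ∀ i < keys.length,
      s.reg x + s.reg 27 ≠ s.reg x + keys.getD i 0 := by
    intro h i hi he
    rw [List.getD_eq_getElem _ _ hi] at he
    exact h ((by omega : s.reg 27 = keys[i]) ▸ List.getElem_mem hi)
  have hdict : s.reg 27 ∉ keys → ∀ mem' : ℕ → ℕ,
      (∀ a, mem' a = if a = s.reg x + L + keys.length then s.reg 27 else
        if a = s.reg x + s.reg 27 then keys.length else s.mem a) →
      IsDict mem' (s.reg x) (s.reg x + L) (keys ++ [s.reg 27]) := by
    intro hn mem' hm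
    refine ⟨List.nodup_append.2 ⟨hd.nodup, by simp, fun y hy z hz he => hn (by simp_all)⟩,
      fun i hi => ?_, fun i hi => ?_⟩
    · simp only [List.length_append, List.length_cons, List.length_nil] at hi
      rw [hm]
      rcases Nat.lt_or_ge i keys.length with h | h
      · rw [if_neg (by omega), if_neg (by omega), hd.back i h, List.getElem_append_left h]
      · obtain rfl : i = keys.length := by omega
        simp
    · simp only [List.length_append, List.length_cons, List.length_nil] at hi
      rw [hm]
      rcases Nat.lt_or_ge i keys.length with h | h
      · rw [List.getElem_append_left h]
        have h1 := hkeys _ (List.getElem_mem h)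
        have h2 := happ hn i h
        rw [List.getD_eq_getElem _ _ h] at h2
        rw [if_neg (by omega), if_neg (by omega), hd.table i h]
      · obtain rfl : i = keys.length := by omega
        rw [if_neg (by simp; omega)]
        simp
  refine Run.frame ?_
  by_cases hmem : s.reg 27 ∈ keys
  · obtain ⟨i, hi, hk⟩ := List.getElem_of_mem hmem
    have hidx : keys.idxOf (s.reg 27) = i := by
      rw [← hk]
      exact hd.nodup.idxOf_getElem i hi
    have ht := hd.table i hi
    have hb := hd.back i hi
    rw [hk] at ht hb
    have he : insertEnd keys (s.reg 27) = keys := by simp [insertEnd, hmem]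
    simp only [he, hidx]
    rcases hx with rfl | rfl <;>
    · simp at hB hcnt
      simp [internKey, hB, hcnt, ht, hb, hi, hd]
      omega
  · have he : insertEnd keys (s.reg 27) = keys ++ [s.reg 27] := by simp [insertEnd, hmem]
    have hidx : (keys ++ [s.reg 27]).idxOf (s.reg 27) = keys.length := by
      simp [List.idxOf_append_of_notMem hmem]
    simp only [he, hidx, List.length_append, List.length_cons, List.length_nil]
    -- For an unknown key the table cell may hold garbage below the current size; the array of keys
    -- then shows a different key.
    have hno : ∀ i < keys.length, s.mem (s.reg x + L + i) ≠ s.reg 27 := by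
      intro i hi h
      rw [hd.back i hi] at h
      exact hmem (h ▸ List.getElem_mem hi)
    have hd' := hdict hmem
    clear hdict happ hd
    rcases hx with rfl | rfl <;>
    · simp at hB hcnt
      simp [internKey, appendKey, h14, h15, hB, hcnt]
      refine ⟨by omega, fun h => ⟨by omega, fun h' => absurd h' (hno _ h), fun _ => ?_⟩,
        fun _ => ?_⟩ <;>
      refine ⟨by omega, by omega, by omega, hd' _ fun a => by simp, fun a ha => ?_⟩ <;>
      rw [if_neg (by omega), if_neg (by omega)]

end

noncomputable section

open scoped Classical
open Preference

/-! ### A trie of rankings -/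

/-- Reading `x 0, …, x (n - 1)` from the root `0` of the trie leads to the node `b`. The edge
from the node `c` with the label `v` has the key `c * K + v`, and the edge number `i` leads to
the node `i + 1`. -/
def TriePath (K : ℕ) (keys : List ℕ) (x : ℕ → ℕ) : ℕ → ℕ → Prop
  | 0, b => b = 0
  | n + 1, b => ∃ c, TriePath K keys x n c ∧ c * K + x n ∈ keys ∧
      b = keys.idxOf (c * K + x n) + 1

namespace TriePath

variable {K n b b' : ℕ} {keys keys' : List ℕ} {x y : ℕ → ℕ}

theorem mono (hk : keys <+: keys') (h : TriePath K keys x n b) : TriePath K keys' x n b := by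
  induction n generalizing b with
  | zero => exact h
  | succ n ih =>
    obtain ⟨c, h1, h2, h3⟩ := h
    exact ⟨c, ih h1, hk.mem h2, by rw [h3, idxOf_eq_of_prefix hk h2]⟩

theorem unique (h : TriePath K keys x n b) (h' : TriePath K keys x n b') : b = b' := by
  induction n generalizing b b' with
  | zero => exact h.trans h'.symm
  | succ n ih =>
    obtain ⟨c, h1, _, h3⟩ := h
    obtain ⟨c', h1', _, h3'⟩ := h'
    rw [h3, h3', ih h1 h1']

theorem le_length (h : TriePath K keys x n b) : b ≤ keys.length := by
  cases n with
  | zero => exact h ▸ Nat.zero_le _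
  | succ n =>
    obtain ⟨c, _, h2, h3⟩ := h
    have := List.idxOf_lt_length_of_mem h2
    omega

/-- Every edge has its own target, and since labels are below `K` the key `c * K + v` determines
both the source and the label. So the word can be read off backwards from its last node. -/
theorem injective (hx : ∀ j < n, x j < K) (hy : ∀ j < n, y j < K) (h : TriePath K keys x n b)
    (h' : TriePath K keys y n b) : ∀ j < n, x j = y j := by
  induction n generalizing b with
  | zero => exact fun j hj => absurd hj (Nat.not_lt_zero j)
  | succ n ih =>
    obtain ⟨c, h1, h2, h3⟩ := h
    obtain ⟨c', h1', h2', h3'⟩ := h'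
    have hk : c * K + x n = c' * K + y n := List.idxOf_inj h2 |>.1 (by omega)
    have hxn := hx n (by omega)
    have hyn := hy n (by omega)
    have hxy : x n = y n := by
      have := congrArg (· % K) hk
      simpa [Nat.mul_add_mod', Nat.mod_eq_of_lt hxn, Nat.mod_eq_of_lt hyn] using this
    have hc : c = c' := by
      rw [hxy] at hk
      exact Nat.eq_of_mul_eq_mul_right (by omega) (Nat.add_right_cancel hk)
    intro j hj
    rcases Nat.lt_succ_iff_lt_or_eq.1 hj with h | rfl
    · exact ih (fun j hj => hx j (by omega)) (fun j hj => hy j (by omega)) h1 (hc ▸ h1') j h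
    · exact hxy

end TriePath

/-- The machine holds a trie with the list `ps` of preferences, built in `u` insertions. -/
structure Interner {K : ℕ} (L u : ℕ) (ps : List (Preference K)) (s : RamState) : Prop where
  nodup : ps.Nodup
  length_le : ps.length ≤ u
  reg17 : s.reg 17 = s.reg 16 + L
  reg19 : s.reg 19 = s.reg 16 + 2 * L
  reg20 : s.reg 20 = s.reg 16 + 3 * L
  reg21 : s.reg 21 = ps.length
  trie : ∃ edges leaves : List ℕ, s.reg 18 = edges.length ∧ leaves.length = ps.length ∧
    IsDict s.mem (s.reg 16) (s.reg 16 + L) edges ∧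
    IsDict s.mem (s.reg 16 + 2 * L) (s.reg 16 + 2 * L + L) leaves ∧
    edges.length ≤ u * K ∧ (∀ k ∈ edges, k < (edges.length + 1) * K) ∧
    ∀ (i : ℕ) (h : i < ps.length) (h' : i < leaves.length),
      TriePath K edges (ps[i]).code K leaves[i]

/-- The size that suffices for `u` insertions. -/
def Fits (K L u : ℕ) : Prop := (u * K + 1) * K ≤ L

/-- The trie occupies four blocks of `L` cells. After `u` insertions there are at most `u * K`
edges, so edge keys are below `(u * K + 1) * K`, and leaf keys are node numbers; `Fits` keeps every
relevant cell inside its block. -/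
theorem Interner.congr {K L u : ℕ} {ps : List (Preference K)} {s s' : RamState}
    (h : Interner L u ps s) (hf : Fits K L u) (hK : 0 < K)
    (hr : ∀ r, 16 ≤ r → r ≤ 21 → s'.reg r = s.reg r)
    (hm : ∀ a, s.reg 16 ≤ a → a < s.reg 16 + 4 * L → s'.mem a = s.mem a) :
    Interner L u ps s' := by
  obtain ⟨edges, leaves, h1, h2, h3, h4, h5, h6, h7⟩ := h.trie
  have hL : u * K + 1 ≤ L := (Nat.le_mul_of_pos_right _ hK).trans hf
  have hu : ps.length ≤ u * K := h.length_le.trans (Nat.le_mul_of_pos_right _ hK)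
  refine ⟨h.nodup, h.length_le, ?_, ?_, ?_, ?_, edges, leaves, ?_, h2, ?_, ?_, h5, h6, h7⟩
  · rw [hr 17 (by omega) (by omega), hr 16 (by omega) (by omega), h.reg17]
  · rw [hr 19 (by omega) (by omega), hr 16 (by omega) (by omega), h.reg19]
  · rw [hr 20 (by omega) (by omega), hr 16 (by omega) (by omega), h.reg20]
  · rw [hr 21 (by omega) (by omega), h.reg21]
  · rw [hr 18 (by omega) (by omega), h1]
  · rw [hr 16 (by omega) (by omega)]
    refine h3.congr (fun i hi => hm _ (by omega) (by omega)) fun k hk => ?_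
    have hkL : k < L := (h6 k hk).trans_le ((Nat.mul_le_mul_right K (by omega)).trans hf)
    exact hm _ (by omega) (by omega)
  · rw [hr 16 (by omega) (by omega)]
    refine h4.congr (fun i hi => hm _ (by omega) (by omega)) fun k hk => ?_
    obtain ⟨i, hi, rfl⟩ := List.getElem_of_mem hk
    have := (h7 i (by omega) hi).le_length
    exact hm _ (by omega) (by omega)

/-- Read one letter and go to the next node. -/
def trieStep : Cmd :=
  .seq (.op .add 26 22 24) <| .seq (.load 26 26) <| .seq (.op .mul 27 25 0) <|
  .seq (.op .add 27 27 26) <| .seq (internKey 16) <| .seq (.op .add 25 28 15) <|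
  .op .add 24 24 15

/-- Put the number of the ranking at the address in register `22` into register `23`; a new
ranking is entered into the trie. -/
def intern : Cmd :=
  .seq (.const 24 0) <| .seq (.const 25 0) <| .seq (.loop (.lt 24 0) trieStep) <|
  .seq (.op .add 27 25 14) <| .seq (internKey 19) <| .op .add 23 28 14

/-- The state of the trie while the first `j` letters of `q` have been read. -/
structure TrieWalk {K : ℕ} (L : ℕ) (q : Preference K) (edges₀ : List ℕ) (s : RamState) (j : ℕ)
    (s' : RamState) (edges : List ℕ) : Prop where
  reg24 : s'.reg 24 = j
  pre : edges₀ <+: edges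
  reg18 : s'.reg 18 = edges.length
  dict : IsDict s'.mem (s.reg 16) (s.reg 16 + L) edges
  length_le : edges.length ≤ edges₀.length + j
  lt : ∀ k ∈ edges, k < (edges.length + 1) * K
  path : TriePath K edges q.code j (s'.reg 25)
  mem : ∀ a, a < s.reg 16 ∨ s.reg 16 + 2 * L ≤ a → s'.mem a = s.mem a

theorem trieStep_spec {w K L u j : ℕ} {s s' : RamState} {q : Preference K}
    {edges₀ edges : List ℕ} (h0 : s'.reg 0 = K) (h14 : s'.reg 14 = 0) (h15 : s'.reg 15 = 1)
    (h16 : s'.reg 16 = s.reg 16) (h17 : s'.reg 17 = s.reg 16 + L) (h22 : s'.reg 22 = s.reg 22)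
    (he₀ : edges₀.length ≤ u * K) (hf : Fits K L (u + 1)) (hw : s.reg 16 + 4 * L ≤ 2 ^ w)
    (hq : ∀ j < K, s.mem (s.reg 22 + j) = q.code j) (hqw : s.reg 22 + K ≤ 2 ^ w)
    (hdis : s.reg 22 + K ≤ s.reg 16 ∨ s.reg 16 + 4 * L ≤ s.reg 22) (hj : j < K)
    (hT : TrieWalk L q edges₀ s j s' edges) :
    Run w trieStep s' fun s'' t =>
      (∃ edges', TrieWalk L q edges₀ s (j + 1) s'' edges') ∧ t ≤ 18 := by
  obtain ⟨h24, hpre, h18, hd, hle, hlt, hp, hm⟩ := hT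
  have hlett : s'.mem (s.reg 22 + j) = q.code j := by
    rw [hm _ (by omega), hq j hj]
  have hcode := q.code_lt hj
  have hnode := hp.le_length
  have hlen : edges.length + 1 ≤ (u + 1) * K := by
    rw [Nat.succ_mul]
    omega
  -- Room for one more insertion bounds the nodes met during the walk, so the product, the new key
  -- and the new entry all stay in range.
  have hLK : (edges.length + 1) * K + K ≤ L := by
    refine le_trans ?_ hf
    rw [← Nat.succ_mul]
    exact Nat.mul_le_mul_right K (by omega)
  have hLe : edges.length + 1 ≤ (edges.length + 1) * K := Nat.le_mul_of_pos_right _ (by omega)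
  have hkey : s'.reg 25 * K + q.code j < (edges.length + 1) * K := by
    have := Nat.mul_le_mul_right K hnode
    rw [Nat.succ_mul]
    omega
  have hKlt : K ≤ (edges.length + 1) * K := Nat.le_mul_of_pos_left _ (by omega)
  simp only [trieStep, run_seq, run_add, run_load, run_mul]
  refine ⟨by omega, by simp [h0]; omega, by simp [h22, h24, hlett, h0]; omega, ?_⟩
  set key := s'.reg 25 * K + q.code j with hkeydef
  refine (internKey_spec (L := L) (keys := edges) (Or.inl rfl) (by simp [h14]) (by simp [h15])
    (by simp [h16, h17]) (by simp [h18]) (by simpa [h16] using hd)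
    (fun k hk => by have := hlt k hk; omega) (by simp [h22, h24, hlett, h0]; omega) (by omega)
    (by simp [h16]; omega)).mono ?_
  intro s₂ t ⟨⟨g28, g18, gd, gm, gt⟩, gf⟩
  have g24 := gf 24 (by decide)
  have g15 := gf 15 (by decide)
  simp [h22, h24, hlett, h0, h16, ← hkeydef, h15] at g28 g18 gd gm g24 g15
  have hmem : key ∈ insertEnd edges key := mem_insertEnd.2 (Or.inr rfl)
  have hidx := List.idxOf_lt_length_of_mem hmem
  have hle' := length_insertEnd_le edges key
  have hge := (prefix_insertEnd edges key).length_le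
  simp [g24, g15, g28]
  refine ⟨by omega, by omega, ⟨insertEnd edges key, ?_⟩, by omega⟩
  refine ⟨by simp, hpre.trans (prefix_insertEnd _ _), by simp [g18], by simpa using gd, by omega,
    fun k hk => ?_, ?_, fun a ha => by simp [gm a ha, hm a ha]⟩
  · have h1 : (edges.length + 1) * K ≤ ((insertEnd edges key).length + 1) * K :=
      Nat.mul_le_mul_right K (by omega)
    rcases mem_insertEnd.1 hk with hk | rfl
    · have := hlt k hk
      omega
    · omega
  · simpa using ⟨s'.reg 25, hp.mono (prefix_insertEnd _ _), hmem, rfl⟩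

/-- `K` dictionary operations lead from the root to the node of `q`, and a second dictionary numbers
the final nodes. The cost does not depend on how many rankings are stored. -/
theorem intern_spec {w K L u : ℕ} {s : RamState} {ps : List (Preference K)} {q : Preference K}
    (hK : 0 < K) (h0 : s.reg 0 = K) (h14 : s.reg 14 = 0) (h15 : s.reg 15 = 1)
    (hi : Interner L u ps s) (hf : Fits K L (u + 1)) (hw : s.reg 16 + 4 * L ≤ 2 ^ w)
    (hq : ∀ j < K, s.mem (s.reg 22 + j) = q.code j) (hqw : s.reg 22 + K ≤ 2 ^ w)
    (hdis : s.reg 22 + K ≤ s.reg 16 ∨ s.reg 16 + 4 * L ≤ s.reg 22) :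
    Run w intern s fun s' t =>
      (s'.reg 23 = (insertEnd ps q).idxOf q ∧ Interner L (u + 1) (insertEnd ps q) s' ∧
      (∀ a, a < s.reg 16 ∨ s.reg 16 + 4 * L ≤ a → s'.mem a = s.mem a) ∧
      t ≤ 40 * K) ∧ ∀ r, r ∉ intern.writes → s'.reg r = s.reg r := by
  obtain ⟨edges, leaves, e18, elen, ed, ld, ele, elt, epath⟩ := hi.trie
  have hL : (u + 1) * K + 1 ≤ L := (Nat.le_mul_of_pos_right _ hK).trans hf
  rw [Nat.succ_mul] at hL
  have hu : u ≤ u * K := Nat.le_mul_of_pos_right _ hK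
  have hps := hi.length_le
  refine Run.frame ?_
  simp only [intern, run_seq, run_const]
  refine ⟨by omega, by omega, ?_⟩
  refine (Run.loop (N := K) (B := 18)
    (I := fun j s' => ∃ edges', TrieWalk L q edges s j s' edges') ?_ ?_ ?_).mono ?_
  · exact ⟨edges, by simp, List.prefix_rfl, by simp [e18], by simpa using ed, by simp, elt,
      by simp [TriePath], fun a _ => by simp⟩
  · rintro j hj s' ⟨edges', hT⟩ hfr
    have f0 := hfr 0 (by decide)
    have f14 := hfr 14 (by decide)
    have f15 := hfr 15 (by decide)
    have f16 := hfr 16 (by decide)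
    have f17 := hfr 17 (by decide)
    have f22 := hfr 22 (by decide)
    simp [h0, h14, h15, hi.reg17] at f0 f14 f15 f16 f17 f22
    refine ⟨by simp [f0, hT.reg24, hj], ?_⟩
    exact trieStep_spec f0 f14 f15 f16 f17 f22 ele hf hw hq hqw hdis hj hT
  · rintro s' ⟨edges', hT⟩ hfr
    have f0 := hfr 0 (by decide)
    simp [h0] at f0
    simp [f0, hT.reg24]
  · rintro s₁ t₁ ⟨⟨⟨edges₁, hT⟩, hfr⟩, ht₁⟩
    obtain ⟨h24, hpre, h18, hd, hle, hlt, hp, hm⟩ := hT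
    have f14 := hfr 14 (by decide)
    have f15 := hfr 15 (by decide)
    have f16 := hfr 16 (by decide)
    have f17 := hfr 17 (by decide)
    have f19 := hfr 19 (by decide)
    have f20 := hfr 20 (by decide)
    have f21 := hfr 21 (by decide)
    simp [h14, h15, hi.reg17, hi.reg19, hi.reg20, hi.reg21] at f14 f15 f16 f17 f19 f20 f21
    have hnode := hp.le_length
    simp only [run_add]
    refine ⟨by simp [f14]; omega, ?_⟩
    refine (internKey_spec (L := L) (keys := leaves) (Or.inr rfl) (by simp [f14]) (by simp [f15])
      (by simp [f19, f20]; omega) (by simp [f21, elen]) ?_ ?_ (by simp [f14]; omega)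
      (by omega) (by simp [f19]; omega)).mono ?_
    · simp [f19]
      refine ld.congr (fun i hi => hm _ (by omega)) fun k hk => hm _ (by omega)
    · intro k hk
      obtain ⟨i, hi, rfl⟩ := List.getElem_of_mem hk
      have := (epath i (by omega) hi).le_length
      omega
    intro s₂ t₂ ⟨⟨g23, g21, gd, gm, gt⟩, gf⟩
    have g14 := gf 14 (by decide)
    have g16 := gf 16 (by decide)
    have g17 := gf 17 (by decide)
    have g18 := gf 18 (by decide)
    have g19 := gf 19 (by decide)
    have g20 := gf 20 (by decide)
    simp [f14, f16, f17, f19, f20, h18] at g23 g21 gd gm g14 g16 g17 g18 g19 g20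
    set b := s₁.reg 25 with hb
    have hpaths : ∀ (i : ℕ) (h : i < ps.length) (h' : i < leaves.length),
        TriePath K edges₁ (ps[i]).code K leaves[i] := fun i h h' => (epath i h h').mono hpre
    -- A ranking has only one final node, and a node is final for only one ranking. Hence the list
    -- of leaves and the list of preferences grow in step, and positions agree.
    have hiff : b ∈ leaves ↔ q ∈ ps := by
      constructor
      · intro hbl
        obtain ⟨i, hi, hib⟩ := List.getElem_of_mem hbl
        have h1 := hpaths i (by omega) hi
        rw [hib] at h1
        have := code_injective (TriePath.injective (fun j hj => code_lt _ hj)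
          (fun j hj => code_lt _ hj) h1 hp)
        exact this ▸ List.getElem_mem _
      · intro hqp
        obtain ⟨i, hi, rfl⟩ := List.getElem_of_mem hqp
        rw [hp.unique (hpaths i hi (by omega))]
        exact List.getElem_mem _
    have hlen : (insertEnd leaves b).length = (insertEnd ps q).length := by
      by_cases h : q ∈ ps
      · simp [insertEnd, h, hiff.2 h, elen]
      · simp [insertEnd, h, mt hiff.1 h, elen]
    have hidx : (insertEnd leaves b).idxOf b = (insertEnd ps q).idxOf q := by
      by_cases h : q ∈ ps
      · obtain ⟨i, hi', rfl⟩ := List.getElem_of_mem h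
        rw [insertEnd, if_pos (hiff.2 h), insertEnd, if_pos h, hi.nodup.idxOf_getElem,
          hp.unique (hpaths i hi' (by omega)), ld.nodup.idxOf_getElem]
      · rw [insertEnd, if_neg (mt hiff.1 h), insertEnd, if_neg h,
          List.idxOf_append_of_notMem h, List.idxOf_append_of_notMem (mt hiff.1 h)]
        simp [elen]
    have hlt2 := length_insertEnd_le ps q
    have hlt3 : (insertEnd ps q).idxOf q < (insertEnd ps q).length :=
      List.idxOf_lt_length_of_mem (mem_insertEnd.2 (Or.inr rfl))
    have hge := hpre.length_le
    simp [g14, g23, hidx]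
    refine ⟨by omega, ?_, fun a ha => ?_, by omega⟩
    · refine ⟨nodup_insertEnd hi.nodup, by omega, by simp [g17, g16], by simp [g19, g16],
        by simp [g20, g16], by simp [g21, hlen], edges₁, insertEnd leaves b, by simp [g18], hlen,
        ?_, ?_, ?_, hlt, ?_⟩
      · simp only [mem_setReg, reg_setReg, g16]
        simp
        refine hd.congr (fun i hi => gm _ (by omega)) fun k hk => gm _ ?_
        have h1 := hlt k hk
        have h2 : (edges₁.length + 1) * K ≤ ((u + 1) * K + 1) * K := by
          refine Nat.mul_le_mul_right K ?_
          rw [Nat.succ_mul]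
          omega
        have h3 : ((u + 1) * K + 1) * K ≤ L := hf
        omega
      · simpa [g16] using gd
      · rw [Nat.succ_mul]
        omega
      · intro i h h'
        rcases Nat.lt_or_ge i ps.length with h1 | h1
        · have e1 : (insertEnd ps q)[i] = ps[i] :=
            ((prefix_insertEnd ps q).getElem h1).symm
          have e2 : (insertEnd leaves b)[i] = leaves[i] :=
            ((prefix_insertEnd leaves b).getElem (by omega)).symm
          rw [e1, e2]
          exact hpaths i h1 (by omega)
        · have hn : q ∉ ps := fun hq => by
            simp [insertEnd, hq] at h
            omega
          have hnb := mt hiff.1 hn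
          simp only [insertEnd, hn, hnb, if_false, List.length_append, List.length_cons,
            List.length_nil] at h h' ⊢
          obtain rfl : i = ps.length := by omega
          simp only [List.getElem_concat_length, ← elen]
          exact hp
    · rw [gm a (by omega), hm a (by omega)]

end

noncomputable section

open scoped Classical
open Preference

/-! ### The checking program: preparation -/

/-- The registers that keep their values during the checking program. -/
structure CheckRegs (K m L F R Q c : ℕ) (s : RamState) : Prop where
  r0 : s.reg 0 = K
  r1 : s.reg 1 = m
  r2 : s.reg 2 = R
  r3 : s.reg 3 = Q
  r4 : s.reg 4 = F
  r5 : s.reg 5 = c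
  r14 : s.reg 14 = 0
  r15 : s.reg 15 = 1
  r16 : s.reg 16 = F
  r31 : s.reg 31 = F + 4 * L
  r32 : s.reg 32 = F + 5 * L
  r33 : s.reg 33 = F + 6 * L
  r34 : s.reg 34 = F + 7 * L
  r35 : s.reg 35 = F + 8 * L
  r36 : s.reg 36 = F + 9 * L
  r37 : s.reg 37 = F + 10 * L

/-- The registers in `CheckRegs`. -/
def checkRegs : List ℕ := [0, 1, 2, 3, 4, 5, 14, 15, 16, 31, 32, 33, 34, 35, 36, 37]

theorem CheckRegs.frame {K m L F R Q c : ℕ} {s s' : RamState} (h : CheckRegs K m L F R Q c s)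
    {W : List ℕ} (hf : ∀ r, r ∉ W → s'.reg r = s.reg r) (hW : ∀ r ∈ checkRegs, r ∉ W) :
    CheckRegs K m L F R Q c s' := by
  have key : ∀ r ∈ checkRegs, s'.reg r = s.reg r := fun r hr => hf r (hW r hr)
  simp only [checkRegs, List.forall_mem_cons] at key
  obtain ⟨h0, h1, h2, h3, h4, h5, h14, h15, h16, h31, h32, h33, h34, h35, h36, h37, -⟩ := key
  exact ⟨h0.trans h.r0, h1.trans h.r1, h2.trans h.r2, h3.trans h.r3, h4.trans h.r4,
    h5.trans h.r5, h14.trans h.r14, h15.trans h.r15, h16.trans h.r16, h31.trans h.r31,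
    h32.trans h.r32, h33.trans h.r33, h34.trans h.r34, h35.trans h.r35, h36.trans h.r36,
    h37.trans h.r37⟩

/-- Set up the constants and the addresses of the arrays. -/
def checkSetup : Cmd :=
  .seq (.const 14 0) <| .seq (.const 15 1) <|
  .seq (.op .mul 38 1 0) <| .seq (.op .mul 38 38 38) <| .seq (.const 24 4) <|
  .seq (.op .mul 38 38 24) <|
  .seq (.op .add 16 4 14) <| .seq (.op .add 17 16 38) <| .seq (.op .add 19 17 38) <|
  .seq (.op .add 20 19 38) <| .seq (.op .add 31 20 38) <| .seq (.op .add 32 31 38) <|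
  .seq (.op .add 33 32 38) <| .seq (.op .add 34 33 38) <| .seq (.op .add 35 34 38) <|
  .seq (.op .add 36 35 38) <| .seq (.op .add 37 36 38) <|
  .seq (.const 18 0) <| .seq (.const 21 0) <| .const 39 1

/-- Nothing is required of the memory: an empty dictionary trusts no cell. Setting up the trie thus
takes constant time although the blocks are far larger than the permitted running time. -/
theorem Interner.nil {K L : ℕ} {s : RamState} (h17 : s.reg 17 = s.reg 16 + L)
    (h18 : s.reg 18 = 0) (h19 : s.reg 19 = s.reg 16 + 2 * L) (h20 : s.reg 20 = s.reg 16 + 3 * L)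
    (h21 : s.reg 21 = 0) : Interner (K := K) L 0 [] s :=
  ⟨List.nodup_nil, le_rfl, h17, h19, h20, h21, [], [], h18, rfl,
    ⟨List.nodup_nil, by simp, by simp⟩, ⟨List.nodup_nil, by simp, by simp⟩, by simp, by simp,
    by simp⟩

theorem checkSetup_spec {w K m L F R Q c : ℕ} {s : RamState} (hL : L = (m * K) * (m * K) * 4)
    (hpos : 0 < m * K) (h0 : s.reg 0 = K) (h1 : s.reg 1 = m) (h2 : s.reg 2 = R)
    (h3 : s.reg 3 = Q) (h4 : s.reg 4 = F) (h5 : s.reg 5 = c) (hw : F + 11 * L ≤ 2 ^ w) :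
    Run w checkSetup s fun s' t =>
      (CheckRegs K m L F R Q c s' ∧ Interner (K := K) L 0 [] s' ∧ s'.reg 39 = 1 ∧
      s'.mem = s.mem ∧ t ≤ 20) ∧ ∀ r, r ∉ checkSetup.writes → s'.reg r = s.reg r := by
  have h6 : m * K ≤ (m * K) * (m * K) := Nat.le_mul_of_pos_left _ hpos
  have hw0 : w ≠ 0 := by
    rintro rfl
    omega
  refine Run.frame ?_
  simp [checkSetup, h0, h1, h4, ← hL]
  refine ⟨hw0, by omega, by omega, by omega, by omega, by omega, by omega, by omega,
    by omega, by omega, by omega, by omega, by omega, by omega, by omega, by omega, hw0, ?_, ?_⟩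
  · constructor <;> simp [h0, h1, h2, h3, h4, h5] <;> omega
  · apply Interner.nil <;> simp <;> omega

/-- Compute the position of every alternative in the ranking of the candidate. -/
def rankProg : Cmd :=
  .seq (.const 40 0) <| .loop (.lt 40 0) <|
    .seq (.op .add 41 5 40) <| .seq (.load 41 41) <| .seq (.op .add 41 31 41) <|
    .seq (.store 41 40) <| .op .add 40 40 15

/-- The table of the positions in the ranking of `q`. -/
def HoldsRanks {K : ℕ} (mem : ℕ → ℕ) (a : ℕ) (q : Preference K) : Prop :=
  ∀ j < K, mem (a + q.code j) = j

theorem Preference.code_inj {K : ℕ} (q : Preference K) {i j : ℕ} (hi : i < K) (hj : j < K)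
    (h : q.code i = q.code j) : i = j := by
  simp only [code, hi, hj, dif_pos] at h
  simpa using q.ranking.injective (Fin.ext h)

theorem rankProg_spec {w K m L F R Q c : ℕ} {s : RamState} {q : Preference K}
    (hs : CheckRegs K m L F R Q c s) (hKL : K ≤ L) (hw : F + 11 * L ≤ 2 ^ w)
    (hq : ∀ j < K, s.mem (c + j) = q.code j) (hc : c + K ≤ F) :
    Run w rankProg s fun s' t =>
      (HoldsRanks s'.mem (F + 4 * L) q ∧
      (∀ a, a < F + 4 * L ∨ F + 5 * L ≤ a → s'.mem a = s.mem a) ∧ t ≤ 6 * K + 2) ∧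
      ∀ r, r ∉ rankProg.writes → s'.reg r = s.reg r := by
  refine Run.frame ?_
  simp only [rankProg, run_seq, run_const]
  refine ⟨by positivity, ?_⟩
  refine (Run.loop (N := K) (B := 5) (I := fun j s' => s'.reg 40 = j ∧
    (∀ i < j, s'.mem (F + 4 * L + q.code i) = i) ∧
    ∀ a, a < F + 4 * L ∨ F + 5 * L ≤ a → s'.mem a = s.mem a) ?_ ?_ ?_).mono ?_
  · simp
  · rintro j hj s' ⟨h40, hr, hm⟩ hf
    have f0 := hf 0 (by decide)
    have f5 := hf 5 (by decide)
    have f15 := hf 15 (by decide)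
    have f31 := hf 31 (by decide)
    simp [hs.r0, hs.r5, hs.r15, hs.r31] at f0 f5 f15 f31
    have hmem : s'.mem (c + j) = q.code j := by rw [hm _ (by omega), hq j hj]
    have hlt := q.code_lt hj
    simp [f0, f5, f15, f31, h40, hmem]
    refine ⟨hj, by omega, by omega, by omega, fun i hi => ?_, fun a ha => ?_⟩
    · split_ifs with h
      · exact (q.code_inj (by omega) hj h).symm
      · have : i ≠ j := fun hij => h (by rw [hij])
        exact hr i (by omega)
    · rw [if_neg (by omega), hm a ha]
  · rintro s' ⟨h40, -, -⟩ hf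
    have f0 := hf 0 (by decide)
    simp [hs.r0] at f0
    simp [f0, h40]
  · rintro s' t ⟨⟨⟨-, hr, hm⟩, -⟩, ht⟩
    exact ⟨hr, hm, by omega⟩

/-- Enter the rows of the table into the trie. -/
def internRows : Cmd :=
  .seq (.const 40 0) <| .seq (.op .add 22 2 14) <| .loop (.lt 40 1) <|
    .seq intern <| .seq (.op .add 22 22 0) <| .op .add 40 40 15

theorem row_le {i m K : ℕ} (h : i < m) : i * K + K ≤ m * K := by
  rw [← Nat.succ_mul]
  exact Nat.mul_le_mul_right K h

theorem Fits.mono {K L u u' : ℕ} (h : Fits K L u) (hu : u' ≤ u) : Fits K L u' :=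
  (Nat.mul_le_mul_right K (Nat.succ_le_succ (Nat.mul_le_mul_right K hu))).trans h

/-- The rows of the memory from `R` on are the preferences in `l`. -/
def HoldsRows {K : ℕ} (mem : ℕ → ℕ) (R : ℕ) (l : List (Preference K)) : Prop :=
  ∀ (i : ℕ) (h : i < l.length), ∀ j < K, mem (R + i * K + j) = l[i].code j

theorem internRows_spec {w K m L F R Q c : ℕ} {s : RamState} {l : List (Preference K)}
    (hs : CheckRegs K m L F R Q c s) (hK : 0 < K) (hm : l.length = m) (hl : l.Nodup)
    (hi : Interner (K := K) L 0 [] s) (hfit : Fits K L m) (hmL : m ≤ L)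
    (hw : F + 11 * L ≤ 2 ^ w) (hrows : HoldsRows s.mem R l) (hR : R + m * K ≤ F) :
    Run w internRows s fun s' t =>
      (Interner L m l s' ∧ (∀ a, a < F ∨ F + 4 * L ≤ a → s'.mem a = s.mem a) ∧
      t ≤ m * (40 * K + 3) + 3) ∧ ∀ r, r ∉ internRows.writes → s'.reg r = s.reg r := by
  refine Run.frame ?_
  have hmpos : K ≤ L := by
    refine le_trans ?_ hfit
    exact Nat.le_mul_of_pos_left _ (by omega)
  simp only [internRows, run_seq, run_const, run_add]
  refine ⟨by omega, by simp [hs.r2, hs.r14]; omega, ?_⟩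
  refine (Run.loop (N := m) (B := 40 * K + 2) (I := fun k s' => s'.reg 40 = k ∧
    s'.reg 22 = R + k * K ∧ s'.reg 16 = F ∧ Interner L k (l.take k) s' ∧
    ∀ a, a < F ∨ F + 4 * L ≤ a → s'.mem a = s.mem a) ?_ ?_ ?_).mono ?_
  · refine ⟨by simp, by simp [hs.r2, hs.r14], by simp [hs.r16], ?_, by simp⟩
    apply Interner.nil
    all_goals simp [hi.reg17, hi.reg19, hi.reg20, hi.reg21]
    obtain ⟨edges, leaves, h1, h2, -, -, h3, -⟩ := hi.trie
    omega
  · rintro k hk s' ⟨h40, h22, h16, hI, hmem⟩ hf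
    have f0 := hf 0 (by decide)
    have f1 := hf 1 (by decide)
    have f14 := hf 14 (by decide)
    have f15 := hf 15 (by decide)
    simp [hs.r0, hs.r1, hs.r14, hs.r15] at f0 f1 f14 f15
    have hrow := row_le (K := K) hk
    refine ⟨by simp [h40, f1, hk], ?_⟩
    simp only [run_seq, run_add]
    refine (intern_spec (q := l[k]) hK f0 f14 f15 hI (hfit.mono hk) (by omega)
      (fun j hj => ?_) (by omega) (by omega)).mono ?_
    · rw [h22, hmem _ (by omega), hrows k (by omega) j hj]
    · rintro s₂ t ⟨⟨-, gI, gm, gt⟩, gf⟩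
      have g0 := gf 0 (by decide)
      have g15 := gf 15 (by decide)
      have g16 := gf 16 (by decide)
      have g22 := gf 22 (by decide)
      have g40 := gf 40 (by decide)
      -- The rows are distinct, so each insertion is new and the number of a row in the trie is its
      -- index.
      have htake : insertEnd (l.take k) l[k] = l.take (k + 1) := by
        rw [insertEnd, if_neg, List.take_concat_get' l k (by omega)]
        intro hmem
        obtain ⟨i, hi, he⟩ := List.mem_take_iff_getElem.1 hmem
        have := (hl.getElem_inj_iff).1 he
        omega
      rw [htake] at gI
      simp [g0, g15, g16, g22, g40, f0, f15, h16, h22, h40]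
      refine ⟨by omega, by omega, ⟨by rw [Nat.succ_mul]; omega, ?_, ?_⟩, by omega⟩
      · refine gI.congr (hfit.mono hk) hK (fun r h1 h2 => ?_) (fun a _ _ => by simp)
        simp only [reg_setReg]
        rw [if_neg (by omega), if_neg (by omega)]
      · intro a ha
        rw [gm a (by omega), hmem a ha]
  · rintro s' ⟨h40, -⟩ hf
    have f1 := hf 1 (by decide)
    simp [hs.r1] at f1
    simp [f1, h40]
  · rintro s' t ⟨⟨⟨-, -, -, hI, hmem⟩, -⟩, ht⟩
    rw [List.take_of_length_le (by omega)] at hI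
    refine ⟨hI, hmem, ?_⟩
    rw [show 40 * K + 2 + 1 = 40 * K + 3 by ring] at ht
    omega

end

noncomputable section

open scoped Classical
open Preference

/-! ### The checking program: a neighbour of every row that is closer to the candidate -/

namespace Preference

variable {K : ℕ}

/-- The position in `q` of the alternative at position `j` in `p`. -/
def relCode (q p : Preference K) (j : ℕ) : ℕ := if h : j < K then (q.relTo p ⟨j, h⟩ : ℕ) else 0

theorem relCode_lt (q p : Preference K) {j : ℕ} (h : j < K) : q.relCode p j < K := by
  simp [relCode, h]

theorem code_relCode (q p : Preference K) {j : ℕ} (h : j < K) :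
    q.code (q.relCode p j) = p.code j := by
  have h1 : q.relCode p j = (q.relTo p ⟨j, h⟩ : ℕ) := by simp [relCode, h]
  simp [code, h, h1, relTo]

theorem isDescent_iff {q p : Preference K} {j : ℕ} (h : j + 1 < K) :
    IsDescent (q.relTo p) j ↔ q.relCode p (j + 1) < q.relCode p j := by
  have h' : j < K := by omega
  simp [IsDescent, relCode, h, h']

theorem code_swapAt (p : Preference K) {i j : ℕ} (hi : i + 1 < K) (hj : j < K) :
    (p.swapAt i).code j = if j = i then p.code (i + 1) else if j = i + 1 then p.code i
      else p.code j := by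
  have hi' : i < K := by omega
  simp only [code, swapAt, ranking_ofPerm, hj, hi, hi', dif_pos, Equiv.Perm.mul_apply, adjSwap,
    Equiv.swap_apply_def, Fin.mk.injEq]
  split_ifs <;> rfl

end Preference

/-- One table access yields a letter of the relative permutation, so its descents can be found in a
single scan of the row. -/
theorem HoldsRanks.apply {K : ℕ} {mem : ℕ → ℕ} {a : ℕ} {q : Preference K}
    (h : HoldsRanks mem a q) (p : Preference K) {j : ℕ} (hj : j < K) :
    mem (a + p.code j) = q.relCode p j := by
  rw [← q.code_relCode p hj]
  exact h _ (q.relCode_lt p hj)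

/-- Copy the row at the address in register `42` to the buffer, count its descents in register
`44`, and put the position after the last descent into register `45`. -/
def scanStep : Cmd :=
  .seq (.op .add 46 42 41) <| .seq (.load 46 46) <| .seq (.op .add 47 32 41) <|
  .seq (.store 47 46) <| .seq (.op .add 46 31 46) <| .seq (.load 46 46) <|
  .seq (.ite (.lt 46 43) (.seq (.op .add 44 44 15) (.op .add 45 41 14)) .skip) <|
  .seq (.op .add 43 46 14) <| .op .add 41 41 15

/-- The loop around `scanStep`. -/
def scanProg : Cmd :=
  .seq (.const 41 0) <| .seq (.const 43 0) <| .seq (.const 44 0) <| .seq (.const 45 0) <|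
  .loop (.lt 41 0) scanStep

/-- The number of descents among the first `j` letters. -/
def descentsBelow {K : ℕ} (σ : Equiv.Perm (Fin K)) (j : ℕ) : ℕ :=
  ((Finset.range (j - 1)).filter fun i => IsDescent σ i).card

theorem descentsBelow_succ {K j : ℕ} (σ : Equiv.Perm (Fin K)) :
    descentsBelow σ (j + 2) = descentsBelow σ (j + 1) + if IsDescent σ j then 1 else 0 := by
  simp only [descentsBelow, Nat.add_sub_cancel, show j + 2 - 1 = j + 1 by omega,
    Finset.range_add_one, Finset.filter_insert]
  split_ifs with h
  · rw [Finset.card_insert_of_notMem (by simp)]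
  · rfl

/-- The state of the scan after `j` letters of `p`. -/
structure ScanState {K : ℕ} (L F : ℕ) (q p : Preference K) (s : RamState) (j : ℕ)
    (s' : RamState) : Prop where
  r41 : s'.reg 41 = j
  r43 : s'.reg 43 = if j = 0 then 0 else q.relCode p (j - 1)
  r44 : s'.reg 44 = descentsBelow (q.relTo p) j
  r45 : (s'.reg 44 = 0 ∧ s'.reg 45 = 0) ∨ (s'.reg 44 ≠ 0 ∧ ∃ i, s'.reg 45 = i + 1 ∧ i + 1 < K ∧
    IsDescent (q.relTo p) i)
  buf : ∀ i < j, s'.mem (F + 5 * L + i) = p.code i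
  mem : ∀ a, a < F + 5 * L ∨ F + 6 * L ≤ a → s'.mem a = s.mem a

theorem scanStep_spec {w K m L F R Q c j a : ℕ} {s s' : RamState} {q p : Preference K}
    (hs : CheckRegs K m L F R Q c s') (hKL : K ≤ L) (hw : F + 11 * L ≤ 2 ^ w)
    (ha : s'.reg 42 = a) (haK : a + K ≤ F) (hp : ∀ j < K, s.mem (a + j) = p.code j)
    (hr : HoldsRanks s.mem (F + 4 * L) q) (hj : j < K) (hS : ScanState L F q p s j s') :
    Run w scanStep s' fun s'' t => ScanState L F q p s (j + 1) s'' ∧ t ≤ 11 := by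
  obtain ⟨h41, h43, h44, h45, hb, hm⟩ := hS
  have hlt := p.code_lt hj
  have hlt2 := q.relCode_lt p hj
  have hp' : s'.mem (a + j) = p.code j := by rw [hm _ (by omega), hp j hj]
  have hr' : s'.mem (F + 4 * L + p.code j) = q.relCode p j := by
    rw [hm _ (by omega), hr.apply p hj]
  have hne : F + 4 * L + p.code j ≠ F + 5 * L + j := by omega
  have hd : descentsBelow (q.relTo p) j ≤ K := by
    refine (Finset.card_filter_le _ _).trans ?_
    simp
    omega
  have hbuf : ∀ i < j + 1, (if i = j then p.code j else s'.mem (F + 5 * L + i)) = p.code i := by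
    intro i hi
    split_ifs with h
    · rw [h]
    · exact hb i (by omega)
  have hmm : ∀ a, a < F + 5 * L ∨ F + 6 * L ≤ a →
      (if a = F + 5 * L + j then p.code j else s'.mem a) = s.mem a := by
    intro a ha
    rw [if_neg (by omega), hm a ha]
  -- The previous letter is initialised to `0`, and no number is below `0`, so the first letter
  -- never counts as a descent.
  have hprev : (q.relCode p j < s'.reg 43 → ∃ i, j = i + 1 ∧ IsDescent (q.relTo p) i) ∧
      (¬ q.relCode p j < s'.reg 43 → ∀ i, j = i + 1 → ¬ IsDescent (q.relTo p) i) := by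
    rw [h43]
    rcases j with _ | i
    · simp
    · simp only [Nat.add_eq_zero_iff, one_ne_zero, and_false, if_false, Nat.add_sub_cancel]
      rw [← isDescent_iff hj]
      exact ⟨fun h => ⟨i, rfl, h⟩, fun h i' hi' => by
        obtain rfl : i = i' := by omega
        exact h⟩
  simp [scanStep, hs.r14, hs.r15, hs.r31, hs.r32, ha, h41, hp', hne, hr']
  refine ⟨by omega, by omega, by omega, fun hlt => ?_, fun hge => ?_⟩
  · obtain ⟨i, rfl, hdes⟩ := hprev.1 hlt
    refine ⟨by omega, by omega, by omega, by omega, ?_⟩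
    refine ⟨by simp, by simp, ?_, ?_, by simpa using hbuf, by simpa using hmm⟩
    · simp [h44, descentsBelow_succ, hdes]
    · simpa using ⟨hj, hdes⟩
  · refine ⟨by omega, by omega, ?_⟩
    refine ⟨by simp, by simp, ?_, by simpa using h45, by simpa using hbuf, by simpa using hmm⟩
    rcases j with _ | i
    · simpa [descentsBelow] using h44
    · simp [h44, descentsBelow_succ, hprev.2 (not_lt.2 hge) i rfl]

theorem scanProg_spec {w K m L F R Q c a : ℕ} {s : RamState} {q p : Preference K}
    (hs : CheckRegs K m L F R Q c s) (hKL : K ≤ L) (hw : F + 11 * L ≤ 2 ^ w)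
    (ha : s.reg 42 = a) (haK : a + K ≤ F) (hp : ∀ j < K, s.mem (a + j) = p.code j)
    (hr : HoldsRanks s.mem (F + 4 * L) q) :
    Run w scanProg s fun s' t =>
      (ScanState L F q p s K s' ∧ t ≤ 12 * K + 5) ∧
      ∀ r, r ∉ scanProg.writes → s'.reg r = s.reg r := by
  refine Run.frame ?_
  simp only [scanProg, run_seq, run_const]
  refine ⟨by positivity, by positivity, by positivity, by positivity, ?_⟩
  refine (Run.loop (N := K) (B := 11) (I := ScanState L F q p s) ?_ ?_ ?_).mono ?_
  · constructor <;> simp [descentsBelow]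
  · intro j hj s' hS hf
    have hs' : CheckRegs K m L F R Q c s' := by
      refine (CheckRegs.frame ?_ hf (by decide))
      exact hs.frame (W := [41, 43, 44, 45]) (fun r hr => by simp_all) (by decide)
    have f42 := hf 42 (by decide)
    simp [ha] at f42
    exact ⟨by simp [hs'.r0, hS.r41, hj], scanStep_spec hs' hKL hw f42 haK hp hr hj hS⟩
  · intro s' hS hf
    have f0 := hf 0 (by decide)
    simp [hs.r0] at f0
    simp [f0, hS.r41]
  · rintro s' t ⟨⟨hS, -⟩, ht⟩
    exact ⟨hS, by omega⟩

/-- Record the current row as its own neighbour. -/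
def rootRow : Cmd :=
  .seq (.op .add 46 33 40) <| .seq (.store 46 40) <| .seq (.op .add 46 34 40) <| .store 46 14

/-- Remove the last descent from the buffer, look the result up in the trie and record it as the
neighbour of the current row. If it is not in the table, clear register `39`. -/
def stepRow : Cmd :=
  .seq (.op .add 46 32 45) <| .seq (.op .sub 47 46 15) <| .seq (.load 48 46) <|
  .seq (.load 49 47) <| .seq (.store 46 49) <| .seq (.store 47 48) <|
  .seq (.op .add 22 32 14) <| .seq intern <| .seq (.op .add 46 33 40) <|
  .seq (.store 46 23) <| .seq (.op .add 46 34 40) <| .seq (.store 46 15) <|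
  .ite (.lt 23 1) .skip (.const 39 0)

/-- For the row number `i` (register `40`, address in register `42`), store the number of its
descents, the index of a row one step closer to the candidate, and the distance to that row. If
the closer neighbour is not in the table, clear register `39`. -/
def parentStep : Cmd :=
  .seq scanProg <| .seq (.op .add 46 35 40) <| .seq (.store 46 44) <|
  .seq (.ite (.eq 44 14) rootRow stepRow) <| .seq (.op .add 42 42 0) <| .op .add 40 40 15

/-- The loop around `parentStep`. -/
def parentProg : Cmd :=
  .seq (.const 40 0) <| .seq (.op .add 42 2 14) <| .loop (.lt 40 1) parentStep

/-- Cell number `i` of the array of pointers holds a row closer to `q` than row `i`, by the number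
in the array of distances; this number is `1` unless row `i` is `q`. -/
def IsStep {K : ℕ} (L F : ℕ) (q : Preference K) (l : List (Preference K)) (mem : ℕ → ℕ)
    (i : ℕ) (h : i < l.length) : Prop :=
  ∃ h' : mem (F + 6 * L + i) < l.length,
    invDist l[mem (F + 6 * L + i)] q + mem (F + 7 * L + i) = invDist l[i] q ∧
    (mem (F + 7 * L + i) = 0 → invDist l[i] q = 0) ∧ mem (F + 7 * L + i) ≤ 1

/-- Some row of `l` has a closer neighbour outside `l`. -/
def HasGap {K : ℕ} (q : Preference K) (l : List (Preference K)) : Prop :=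
  ∃ p ∈ l, ∃ p' ∉ l, invDist p' q < invDist p q

/-- The state after `k` rows have been treated. -/
structure ParentState {K : ℕ} (L F R u : ℕ) (q : Preference K) (l : List (Preference K))
    (s : RamState) (k : ℕ) (s' : RamState) : Prop where
  r40 : s'.reg 40 = k
  r42 : s'.reg 42 = R + k * K
  interner : ∃ ps, l <+: ps ∧ Interner L (u + k) ps s'
  des : ∀ (i : ℕ) (h : i < l.length), i < k →
    s'.mem (F + 8 * L + i) = descents (q.relTo l[i])
  flag : (s'.reg 39 = 1 ∧ ∀ (i : ℕ) (h : i < l.length), i < k → IsStep L F q l s'.mem i h) ∨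
    (s'.reg 39 = 0 ∧ HasGap q l)
  low : ∀ a < F, s'.mem a = s.mem a
  ranks : HoldsRanks s'.mem (F + 4 * L) q


/-- The trie serves as a membership test: when the rows of the table were entered first, they own
the numbers below `m`. A neighbour outside the table is entered as well, which uses room but leaves
the numbers of the rows alone. -/
theorem stepRow_spec {w K m L F R Q c u k i : ℕ} {s : RamState} {p : Preference K}
    {ps : List (Preference K)} (hs : CheckRegs K m L F R Q c s) (hw : F + 11 * L ≤ 2 ^ w)
    (hk : k < m) (hmL : m ≤ L) (h40 : s.reg 40 = k) (h45 : s.reg 45 = i + 1) (hi : i + 1 < K)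
    (hbuf : ∀ j < K, s.mem (F + 5 * L + j) = p.code j) (hI : Interner L u ps s)
    (hf : Fits K L (u + 1)) :
    Run w stepRow s fun s' t =>
      (s'.mem (F + 6 * L + k) = (insertEnd ps (p.swapAt i)).idxOf (p.swapAt i) ∧
      s'.mem (F + 7 * L + k) = 1 ∧
      s'.reg 39 = (if (insertEnd ps (p.swapAt i)).idxOf (p.swapAt i) < m then s.reg 39 else 0) ∧
      Interner L (u + 1) (insertEnd ps (p.swapAt i)) s' ∧
      (∀ a, a < F ∨ (F + 4 * L ≤ a ∧ a < F + 5 * L) ∨ F + 6 * L ≤ a → a ≠ F + 6 * L + k →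
        a ≠ F + 7 * L + k → s'.mem a = s.mem a) ∧
      t ≤ 40 * K + 15) ∧ ∀ r, r ∉ stepRow.writes → s'.reg r = s.reg r := by
  refine Run.frame ?_
  have hKL : K ≤ L := (Nat.le_mul_of_pos_left _ (Nat.succ_pos _)).trans hf
  have hb1 := hbuf i (by omega)
  have hb2 := hbuf (i + 1) hi
  have hw1 : 1 < 2 ^ w := by omega
  simp only [stepRow, run_seq, run_add, run_sub, run_load, run_store]
  refine ⟨by simp [hs.r32, h45]; omega, ⟨by simp [hs.r32, h45, hs.r15]; omega,
    by simp [hs.r32, h45]; omega⟩, by simp [hs.r32, hs.r14]; omega, ?_⟩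
  refine (intern_spec (q := p.swapAt i) (ps := ps) (u := u) (L := L) (by omega) (by simp [hs.r0])
    (by simp [hs.r14]) (by simp [hs.r15]) ?_ hf (by simp [hs.r16]; omega) ?_
    (by simp [hs.r32, hs.r14]; omega) (by simp [hs.r32, hs.r14, hs.r16]; omega)).mono ?_
  · refine hI.congr (hf.mono (by omega)) (by omega) (fun r h1 h2 => ?_) (fun a h1 h2 => ?_)
    · simp only [reg_setReg, reg_setMem]
      repeat rw [if_neg (by omega)]
    · simp only [hs.r16] at h1 h2
      simp [hs.r32, h45, hs.r15]
      rw [if_neg (by omega), if_neg (by omega)]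
  · intro j hj
    simp [hs.r32, hs.r14, h45, hs.r15, code_swapAt p hi hj, hb1, ← Nat.add_assoc]
    rw [← hb2]
    have hj' := hbuf j hj
    simp only [Nat.add_assoc] at *
    by_cases h1 : j = i
    · simp [h1]
    · by_cases h2 : j = i + 1
      · simp [h2]
      · rw [if_neg h1, if_neg h1, if_neg h2, if_neg (by omega), hj']
  · rintro s₂ t ⟨⟨g23, gI, gm, gt⟩, gf⟩
    have g1 := gf 1 (by decide)
    have g15 := gf 15 (by decide)
    have g33 := gf 33 (by decide)
    have g34 := gf 34 (by decide)
    have g39 := gf 39 (by decide)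
    have g40 := gf 40 (by decide)
    have g16 := gf 16 (by decide)
    simp [hs.r1, hs.r14, hs.r15, hs.r16, hs.r33, hs.r34, hs.r32, h40, h45] at g1 g15 g33 g34 g39 g40 g16 gm
    generalize hidx : (insertEnd ps (p.swapAt i)).idxOf (p.swapAt i) = idx at *
    have hI' : ∀ s₃ : RamState, (∀ r, 16 ≤ r → r ≤ 21 → s₃.reg r = s₂.reg r) →
        (∀ a, a < F + 6 * L → s₃.mem a = s₂.mem a) →
        Interner L (u + 1) (insertEnd ps (p.swapAt i)) s₃ := fun s₃ hr hm =>
      gI.congr hf (by omega) hr (fun a _ h => hm a (by omega))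
    have hmem : ∀ a, a < F ∨ (F + 4 * L ≤ a ∧ a < F + 5 * L) ∨ F + 6 * L ≤ a →
        a ≠ F + 6 * L + k → a ≠ F + 7 * L + k →
        (if a = F + 7 * L + k then 1 else if a = F + 6 * L + k then idx else s₂.mem a) =
          s.mem a := by
      intro a h1 h2 h3
      rw [if_neg h3, if_neg h2, gm a (by omega), if_neg (by omega), if_neg (by omega)]
    clear gf
    simp [g1, g15, g33, g34, g39, g40, g23]
    refine ⟨by omega, by omega, fun hlt => ?_, fun hge => ?_⟩
    · refine ⟨by omega, by simp [hlt], ?_, by simpa using hmem, by omega⟩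
      refine hI' _ (fun r h1 h2 => ?_) (fun a ha => ?_)
      · simp only [reg_setReg, reg_setMem]
        repeat rw [if_neg (by omega)]
      · simp
        rw [if_neg (by omega), if_neg (by omega)]
    · refine ⟨by omega, by omega, ?_, by simpa using hmem, by omega⟩
      refine hI' _ (fun r h1 h2 => ?_) (fun a ha => ?_)
      · simp only [reg_setReg, reg_setMem]
        repeat rw [if_neg (by omega)]
      · simp
        rw [if_neg (by omega), if_neg (by omega)]

theorem IsStep.congr {K L F i : ℕ} {q : Preference K} {l : List (Preference K)}
    {mem mem' : ℕ → ℕ} {h : i < l.length} (hs : IsStep L F q l mem i h)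
    (h6 : mem' (F + 6 * L + i) = mem (F + 6 * L + i))
    (h7 : mem' (F + 7 * L + i) = mem (F + 7 * L + i)) : IsStep L F q l mem' i h := by
  unfold IsStep at *
  simp only [h6, h7]
  exact hs

theorem parentStep_spec {w K m L F R Q c u k : ℕ} {s s' : RamState} {q : Preference K}
    {l : List (Preference K)} (hs : CheckRegs K m L F R Q c s') (hw : F + 11 * L ≤ 2 ^ w)
    (hK : 0 < K) (hm : l.length = m) (hmL : m ≤ L) (hf : Fits K L (u + m))
    (hrows : HoldsRows s.mem R l) (hR : R + m * K ≤ F) (hk : k < m)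
    (hP : ParentState L F R u q l s k s') :
    Run w parentStep s' fun s'' t =>
      ParentState L F R u q l s (k + 1) s'' ∧ t ≤ 52 * K + 30 := by
  obtain ⟨h40, h42, ⟨ps, hpre, hI⟩, hdes, hflag, hlow, hranks⟩ := hP
  have hKL : K ≤ L := (Nat.le_mul_of_pos_left _ (Nat.succ_pos _)).trans hf
  have hrow := row_le (K := K) hk
  have hkl : k < l.length := by omega
  have hcode : ∀ j < K, s'.mem (R + k * K + j) = (l[k]).code j := fun j hj => by
    rw [hlow _ (by omega), hrows k hkl j hj]
  simp only [parentStep, run_seq]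
  refine (scanProg_spec hs hKL hw h42 (by omega) hcode hranks).mono ?_
  rintro s₁ t₁ ⟨⟨⟨e41, e43, e44, e45, eb, em⟩, et⟩, ef⟩
  have hs₁ := hs.frame ef (by decide)
  have e40 := ef 40 (by decide)
  have e42 := ef 42 (by decide)
  have e39 := ef 39 (by decide)
  rw [h40] at e40
  rw [h42] at e42
  have hdesK : descentsBelow (q.relTo l[k]) K = descents (q.relTo l[k]) := rfl
  rw [hdesK] at e44
  set d := descents (q.relTo l[k]) with hd
  have hI₁ : Interner L (u + k) ps s₁ := by
    refine hI.congr (hf.mono (by omega)) hK (fun r h1 h2 => ef r ?_) (fun a h1 h2 => em a ?_)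
    · simp only [scanProg, scanStep, Cmd.writes, List.cons_append, List.nil_append,
        List.mem_cons, List.not_mem_nil, or_false]
      omega
    · rw [hs.r16] at h2
      omega
  simp only [run_add, run_store]
  refine ⟨by simp [hs₁.r35, e40]; omega, ?_⟩
  set s₂ := (s₁.setReg 46 (s₁.reg 35 + s₁.reg 40)).setMem
    ((s₁.setReg 46 (s₁.reg 35 + s₁.reg 40)).reg 46)
    ((s₁.setReg 46 (s₁.reg 35 + s₁.reg 40)).reg 44) with hs₂
  have m₂ : ∀ a, s₂.mem a = if a = F + 8 * L + k then d else s₁.mem a := by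
    simp [hs₂, hs₁.r35, e40, e44]
  have r₂ : ∀ r, r ≠ 46 → s₂.reg r = s₁.reg r := by
    intro r hr
    simp [hs₂, hr]
  have hcs₂ : CheckRegs K m L F R Q c s₂ :=
    hs₁.frame (W := [46]) (fun r hr => r₂ r (by simpa using hr)) (by decide)
  have hI₂ : Interner L (u + k) ps s₂ := by
    refine hI₁.congr (hf.mono (by omega)) hK (fun r h1 h2 => r₂ r (by omega)) (fun a h1 h2 => ?_)
    rw [hs₁.r16] at h2
    rw [m₂, if_neg (by omega)]
  rw [run_ite]
  simp only [holds_eq, r₂ 44 (by omega), hcs₂.r14]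
  constructor
  · intro h0
    -- Without descents the relative permutation is the identity. The candidate is the root of the
    -- tree and points to itself at distance `0`.
    have hroot : l[k] = q := by
      by_contra hne
      have := descents_pos (σ := q.relTo l[k]) fun h => hne (relTo_eq_one.1 h)
      omega
    simp [rootRow, hcs₂.r33, hcs₂.r34, hcs₂.r14, hcs₂.r15, hcs₂.r0, r₂, e40, e42]
    refine ⟨by omega, by omega, by omega, by omega, ?_, by omega⟩
    refine ⟨by simp, by simp [Nat.succ_mul, Nat.add_assoc], ⟨ps, hpre, ?_⟩, ?_, ?_, ?_, ?_⟩
    · have := hI₂.length_le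
      -- The root inserts nothing; the bound on the number of insertions is merely relaxed.
      have hI₃ : Interner L (u + (k + 1)) ps s₂ := by
        obtain ⟨edges, leaves, t1, t2, t3, t4, t5, t6, t7⟩ := hI₂.trie
        refine ⟨hI₂.nodup, by omega, hI₂.reg17, hI₂.reg19, hI₂.reg20, hI₂.reg21, edges, leaves,
          t1, t2, t3, t4, t5.trans (Nat.mul_le_mul_right K (by omega)), t6, t7⟩
      refine hI₃.congr (hf.mono (by omega)) hK (fun r h1 h2 => ?_) (fun a h1 h2 => ?_)
      · simp only [reg_setReg, reg_setMem]
        repeat rw [if_neg (by omega)]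
      · rw [hcs₂.r16] at h2
        simp
        rw [if_neg (by omega), if_neg (by omega)]
    · intro i hi hik
      simp [m₂]
      rw [if_neg (by omega), if_neg (by omega)]
      split_ifs with h
      · obtain rfl : i = k := by omega
        exact hd
      · rw [em _ (by omega), hdes i hi (by omega)]
    · rcases hflag with ⟨f39, hst⟩ | ⟨f39, hgap⟩
      · refine Or.inl ⟨by simp [r₂, e39, f39], fun i hi hik => ?_⟩
        by_cases hik' : i = k
        · subst hik'
          have hL0 : L ≠ 0 := by omega
          simp [IsStep, hL0, hroot, invDist_self, hkl]
        · refine (hst i hi (by omega)).congr ?_ ?_ <;> simp [m₂] <;>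
          · repeat rw [if_neg (by omega)]
            rw [em _ (by omega)]
      · exact Or.inr ⟨by simp [r₂, e39, f39], hgap⟩
    · intro a ha
      simp [m₂]
      rw [if_neg (by omega), if_neg (by omega), if_neg (by omega), em _ (by omega), hlow a ha]
    · intro j hj
      have := q.code_lt hj
      simp [m₂]
      rw [if_neg (by omega), if_neg (by omega), if_neg (by omega), em _ (by omega), hranks j hj]
  · intro h0
    obtain ⟨i, h45, hi, hdi⟩ : ∃ i, s₁.reg 45 = i + 1 ∧ i + 1 < K ∧
        IsDescent (q.relTo l[k]) i := by
      rcases e45 with h | h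
      · exact absurd h.1 h0
      · exact h.2
    refine (stepRow_spec (p := l[k]) (i := i) (u := u + k) hcs₂ hw hk hmL
      (by rw [r₂ 40 (by omega), e40]) (by rw [r₂ 45 (by omega), h45]) hi
      (fun j hj => by rw [m₂, if_neg (by omega), eb j hj]) hI₂ (hf.mono (by omega))).mono ?_
    rintro s₃ t₃ ⟨⟨g6, g7, g39, gI, gm, gt⟩, gf⟩
    have hcs₃ := hcs₂.frame gf (by decide)
    have g40 := gf 40 (by decide)
    have g42 := gf 42 (by decide)
    rw [r₂ 40 (by omega), e40] at g40
    rw [r₂ 42 (by omega), e42] at g42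
    rw [r₂ 39 (by omega), e39] at g39
    have hdist := invDist_swapAt hdi
    have hpre' : l <+: insertEnd ps (l[k].swapAt i) := hpre.trans (prefix_insertEnd _ _)
    simp [hcs₃.r0, hcs₃.r15, g40, g42]
    refine ⟨by omega, by omega, ?_, by omega⟩
    have gm' : ∀ a, a < F ∨ (F + 4 * L ≤ a ∧ a < F + 5 * L) ∨ F + 6 * L ≤ a →
        a ≠ F + 6 * L + k → a ≠ F + 7 * L + k → a ≠ F + 8 * L + k → s₃.mem a = s'.mem a := by
      intro a h1 h2 h3 h4
      rw [gm a h1 h2 h3, m₂, if_neg h4, em _ (by omega)]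
    refine ⟨by simp, by simp [Nat.succ_mul, Nat.add_assoc], ⟨_, hpre', ?_⟩, ?_, ?_, ?_, ?_⟩
    · refine gI.congr (hf.mono (by omega)) hK (fun r h1 h2 => ?_) (fun a h1 h2 => by simp)
      simp only [reg_setReg]
      repeat rw [if_neg (by omega)]
    · intro i' hi' hik
      simp only [mem_setReg]
      by_cases h : i' = k
      · subst h
        rw [gm _ (by omega) (by omega) (by omega), m₂, if_pos rfl]
      · rw [gm' _ (by omega) (by omega) (by omega) (by omega), hdes i' hi' (by omega)]
    · rcases hflag with ⟨f39, hst⟩ | ⟨f39, hgap⟩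
      · by_cases hmem : l[k].swapAt i ∈ l
        · have hidx := idxOf_eq_of_prefix hpre' hmem
          have hlt := List.idxOf_lt_length_of_mem hmem
          refine Or.inl ⟨by simp [g39, hidx, f39]; exact hm ▸ hlt, fun i' hi' hik => ?_⟩
          by_cases h : i' = k
          · subst h
            simp only [IsStep, mem_setReg, g6, g7, hidx]
            exact ⟨hlt, by rw [List.getElem_idxOf, hdist], by simp⟩
          · refine (hst i' hi' (by omega)).congr ?_ ?_ <;> simp only [mem_setReg] <;>
            exact gm' _ (by omega) (by omega) (by omega) (by omega)
        · refine Or.inr ⟨?_, l[k], List.getElem_mem _, _, hmem, by omega⟩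
          -- Since `l` is a prefix of the trie's list, a number below `m` would place the neighbour
          -- in `l`.
          have : ¬ (insertEnd ps (l[k].swapAt i)).idxOf (l[k].swapAt i) < m := by
            intro hlt
            refine hmem ?_
            have h1 : (insertEnd ps (l[k].swapAt i))[(insertEnd ps (l[k].swapAt i)).idxOf
                (l[k].swapAt i)]'(List.idxOf_lt_length_of_mem
                  (mem_insertEnd.2 (Or.inr rfl))) = l[k].swapAt i := List.getElem_idxOf _
            rw [← hpre'.getElem (by omega)] at h1
            exact h1 ▸ List.getElem_mem _
          simp [g39, this]
      · refine Or.inr ⟨?_, hgap⟩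
        simp [g39, f39]
    · intro a ha
      simp only [mem_setReg]
      rw [gm' a (by omega) (by omega) (by omega) (by omega), hlow a ha]
    · intro j hj
      have := q.code_lt hj
      simp only [mem_setReg]
      rw [gm' _ (by omega) (by omega) (by omega) (by omega), hranks j hj]

theorem parentProg_spec {w K m L F R Q c u : ℕ} {s : RamState} {q : Preference K}
    {l ps : List (Preference K)} (hs : CheckRegs K m L F R Q c s) (hw : F + 11 * L ≤ 2 ^ w)
    (hK : 0 < K) (hm : l.length = m) (hmL : m ≤ L) (hf : Fits K L (u + m))
    (hrows : HoldsRows s.mem R l) (hR : R + m * K ≤ F) (h39 : s.reg 39 = 1)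
    (hpre : l <+: ps) (hI : Interner L u ps s) (hranks : HoldsRanks s.mem (F + 4 * L) q) :
    Run w parentProg s fun s' t =>
      (ParentState L F R u q l s m s' ∧ t ≤ m * (52 * K + 31) + 3) ∧
      ∀ r, r ∉ parentProg.writes → s'.reg r = s.reg r := by
  have hKL : K ≤ L := (Nat.le_mul_of_pos_left _ (Nat.succ_pos _)).trans hf
  refine Run.frame ?_
  simp only [parentProg, run_seq, run_const, run_add]
  refine ⟨by positivity, by simp [hs.r2, hs.r14]; omega, ?_⟩
  refine (Run.loop (N := m) (B := 52 * K + 30) (I := ParentState L F R u q l s) ?_ ?_ ?_).mono ?_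
  · refine ⟨by simp, by simp [hs.r2, hs.r14], ⟨ps, hpre, ?_⟩, by simp, Or.inl ⟨by simp [h39],
      by simp⟩, by simp, hranks⟩
    refine hI.congr (hf.mono (by omega)) hK (fun r h1 h2 => ?_) (fun a h1 h2 => by simp)
    simp only [reg_setReg]
    repeat rw [if_neg (by omega)]
  · intro k hk s' hP hfr
    have hs' : CheckRegs K m L F R Q c s' := by
      refine (CheckRegs.frame ?_ hfr (by decide))
      exact hs.frame (W := [40, 42]) (fun r hr => by simp_all) (by decide)
    exact ⟨by simp [hP.r40, hs'.r1, hk], parentStep_spec hs' hw hK hm hmL hf hrows hR hk hP⟩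
  · intro s' hP hfr
    have f1 := hfr 1 (by decide)
    simp [hs.r1] at f1
    simp [f1, hP.r40]
  · rintro s' t ⟨⟨hP, -⟩, ht⟩
    refine ⟨hP, ?_⟩
    rw [show 52 * K + 30 + 1 = 52 * K + 31 by ring] at ht
    omega

end

noncomputable section

open scoped Classical
open Preference

/-! ### The checking program: distances by pointer jumping -/

/-- Double the lengths of all jumps once. -/
def jumpStep : Cmd :=
  .seq (.op .add 43 33 42) <| .seq (.load 44 43) <| .seq (.op .add 45 34 42) <|
  .seq (.load 46 45) <| .seq (.op .add 47 34 44) <| .seq (.load 47 47) <|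
  .seq (.op .add 46 46 47) <| .seq (.store 45 46) <| .seq (.op .add 47 33 44) <|
  .seq (.load 47 47) <| .seq (.store 43 47) <| .op .add 42 42 15

/-- The loop around `jumpStep`. -/
def jumpRound : Cmd := .seq (.const 42 0) <| .loop (.lt 42 1) jumpStep

/-- Compute the distances of all rows. -/
def jumpProg : Cmd :=
  .seq (.op .add 41 0 0) <| .seq (.const 40 0) <| .loop (.lt 40 41) <|
    .seq jumpRound <| .op .add 40 40 15

/-- The distances of the preferences in `l`. -/
def distAt {K : ℕ} (q : Preference K) (l : List (Preference K)) (i : ℕ) : ℕ :=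
  if h : i < l.length then invDist l[i] q else 0

theorem distAt_eq {K : ℕ} (q : Preference K) {l : List (Preference K)} {i : ℕ}
    (h : i < l.length) : distAt q l i = invDist l[i] q := dif_pos h

theorem distAt_le {K : ℕ} (q : Preference K) (l : List (Preference K)) (i : ℕ) :
    distAt q l i ≤ K * K := by
  unfold distAt
  split_ifs
  · exact invDist_le _ _
  · exact Nat.zero_le _

/-- Row `i` of a table with `m` rows and the distances `δ` points to a row that is closer by the
number in the array of distances. This number is at least `b` unless that row has distance `0`. -/
def IsJump (L F m : ℕ) (δ : ℕ → ℕ) (mem : ℕ → ℕ) (b i : ℕ) : Prop :=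
  mem (F + 6 * L + i) < m ∧ δ (mem (F + 6 * L + i)) + mem (F + 7 * L + i) = δ i ∧
    min b (δ i) ≤ mem (F + 7 * L + i)

theorem IsStep.isJump {K L F i : ℕ} {q : Preference K} {l : List (Preference K)}
    {mem : ℕ → ℕ} {h : i < l.length} (hs : IsStep L F q l mem i h) :
    IsJump L F l.length (distAt q l) mem 1 i := by
  obtain ⟨h', h1, h2, -⟩ := hs
  rw [← distAt_eq, ← distAt_eq] at h1
  rw [← distAt_eq] at h2
  exact ⟨h', h1, by omega⟩

/-- Following the pointer twice adds the two lengths, so the sum of the length and the remaining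
distance is invariant while the guaranteed length doubles. At distance `0` the length is `0` and
jumping is harmless. -/
theorem jumpRound_spec {w K m L F R Q c b : ℕ} {s : RamState} {δ : ℕ → ℕ}
    (hs : CheckRegs K m L F R Q c s) (hw : F + 11 * L ≤ 2 ^ w)
    (hδ : ∀ i, δ i < L) (hmL : m ≤ L) (hJ : ∀ i < m, IsJump L F m δ s.mem b i) :
    Run w jumpRound s fun s' t =>
      ((∀ i < m, IsJump L F m δ s'.mem (2 * b) i) ∧
      (∀ a, a < F + 6 * L ∨ F + 8 * L ≤ a → s'.mem a = s.mem a) ∧ t ≤ m * 13 + 2) ∧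
      ∀ r, r ∉ jumpRound.writes → s'.reg r = s.reg r := by
  refine Run.frame ?_
  simp only [jumpRound, run_seq, run_const]
  refine ⟨by positivity, ?_⟩
  refine (Run.loop (N := m) (B := 12) (I := fun k s' => s'.reg 42 = k ∧
    (∀ i < m, IsJump L F m δ s'.mem (if i < k then 2 * b else b) i) ∧
    ∀ a, a < F + 6 * L ∨ F + 8 * L ≤ a → s'.mem a = s.mem a) ?_ ?_ ?_).mono ?_
  · exact ⟨by simp, by simpa using hJ, by simp⟩
  · rintro k hk s' ⟨h42, hI, hmem⟩ hf
    have hs' : CheckRegs K m L F R Q c s' := by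
      refine (CheckRegs.frame ?_ hf (by decide))
      exact hs.frame (W := [42]) (fun r hr => by simp_all) (by decide)
    obtain ⟨hP, hd, hb⟩ := hI k hk
    rw [if_neg (by omega)] at hb
    obtain ⟨hP', hd', hb'⟩ := hI _ hP
    generalize hPdef : s'.mem (F + 6 * L + k) = P at *
    generalize hDdef : s'.mem (F + 7 * L + k) = D at *
    generalize hPdef' : s'.mem (F + 6 * L + P) = P' at *
    generalize hDdef' : s'.mem (F + 7 * L + P) = D' at *
    -- The round works in place, so the target may or may not have been updated already. Either way
    -- its length satisfies the old bound, which is enough.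
    have hb'' : min b (δ P) ≤ D' := by
      refine le_trans ?_ hb'
      split_ifs <;> omega
    have hle := hδ k
    have hne : F + 6 * L + P ≠ F + 7 * L + k := by omega
    simp [jumpStep, hs'.r1, hs'.r33, hs'.r34, hs'.r15, h42, hPdef, hDdef, hDdef', hPdef', hne]
    refine ⟨hk, by omega, by omega, by omega, by omega, by omega, by omega, fun i hi => ?_,
      fun a ha => ?_⟩
    · by_cases hik : i = k
      · subst hik
        have hne' : F + 7 * L + i ≠ F + 6 * L + i := by omega
        simp only [IsJump, mem_setReg, mem_setMem, if_true, if_neg hne', le_refl]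
        exact ⟨hP', by omega, by omega⟩
      · have h := hI i hi
        have hlt : (i ≤ k) = (i < k) := propext (by omega)
        have h6 : F + 6 * L + i ≠ F + 7 * L + k := by omega
        have h7 : F + 7 * L + i ≠ F + 6 * L + k := by omega
        have h6' : F + 6 * L + i ≠ F + 6 * L + k := by omega
        have h7' : F + 7 * L + i ≠ F + 7 * L + k := by omega
        simpa only [IsJump, mem_setReg, mem_setMem, hlt, if_neg h6, if_neg h7, if_neg h6',
          if_neg h7'] using h
    · rw [if_neg (by omega), if_neg (by omega), hmem a ha]
  · rintro s' ⟨h42, -⟩ hf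
    have f1 := hf 1 (by decide)
    simp [hs.r1] at f1
    simp [f1, h42]
  · rintro s' t ⟨⟨⟨-, hI, hmem⟩, -⟩, ht⟩
    refine ⟨fun i hi => ?_, hmem, by omega⟩
    have := hI i hi
    rwa [if_pos (by omega)] at this

/-- A round costs `O(m)`, so `2 * K` rounds fit into `O(m K)`. Far fewer would do, but this number
requires no logarithm. -/
theorem jumpProg_spec {w K m L F R Q c : ℕ} {s : RamState} {δ : ℕ → ℕ}
    (hs : CheckRegs K m L F R Q c s) (hw : F + 11 * L ≤ 2 ^ w)
    (hδ : ∀ i, δ i ≤ K * K) (hKL : K * K < L) (hKL' : 2 * K < L) (hmL : m ≤ L)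
    (hJ : ∀ i < m, IsJump L F m δ s.mem 1 i) :
    Run w jumpProg s fun s' t =>
      ((∀ i < m, s'.mem (F + 7 * L + i) = δ i) ∧
      (∀ a, a < F + 6 * L ∨ F + 8 * L ≤ a → s'.mem a = s.mem a) ∧
      t ≤ 2 * K * (m * 13 + 4) + 3) ∧
      ∀ r, r ∉ jumpProg.writes → s'.reg r = s.reg r := by
  refine Run.frame ?_
  simp only [jumpProg, run_seq, run_const, run_add]
  refine ⟨by simp [hs.r0]; omega, by positivity, ?_⟩
  refine (Run.loop (N := 2 * K) (B := m * 13 + 3) (I := fun k s' => s'.reg 40 = k ∧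
    (∀ i < m, IsJump L F m δ s'.mem (2 ^ k) i) ∧
    ∀ a, a < F + 6 * L ∨ F + 8 * L ≤ a → s'.mem a = s.mem a) ?_ ?_ ?_).mono ?_
  · exact ⟨by simp, by simpa using hJ, by simp⟩
  · rintro k hk s' ⟨h40, hI, hmem⟩ hf
    have hs' : CheckRegs K m L F R Q c s' := by
      refine (CheckRegs.frame ?_ hf (by decide))
      exact hs.frame (W := [40, 41]) (fun r hr => by simp_all) (by decide)
    have f41 := hf 41 (by decide)
    simp [hs.r0] at f41
    refine ⟨by simp [h40, f41]; omega, ?_⟩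
    rw [run_seq]
    refine (jumpRound_spec hs' hw (fun i => (hδ i).trans_lt hKL) hmL hI).mono ?_
    rintro s₂ t ⟨⟨gJ, gm, gt⟩, gf⟩
    have hs₂ := hs'.frame gf (by decide)
    have g40 := gf 40 (by decide)
    simp [hs₂.r15, g40, h40]
    refine ⟨by omega, ⟨fun i hi => ?_, fun a ha => ?_⟩, by omega⟩
    · rw [pow_succ, mul_comm]
      exact gJ i hi
    · rw [gm a ha, hmem a ha]
  · rintro s' ⟨h40, -⟩ hf
    have f41 := hf 41 (by decide)
    simp [hs.r0] at f41
    simp [f41, h40]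
    omega
  · rintro s' t ⟨⟨⟨-, hI, hmem⟩, -⟩, ht⟩
    refine ⟨fun i hi => ?_, hmem, by
      rw [show m * 13 + 3 + 1 = m * 13 + 4 by ring] at ht
      omega⟩
    obtain ⟨-, h1, h2⟩ := hI i hi
    -- Distances are at most `K * K`, and `K < 2 ^ K`. So after `2 * K` doublings the guaranteed
    -- length exhausts the distance.
    have h3 : δ i ≤ 2 ^ (2 * K) := by
      refine (hδ i).trans ?_
      rw [two_mul, pow_add]
      exact Nat.mul_le_mul Nat.lt_two_pow_self.le Nat.lt_two_pow_self.le
    omega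

/-! ### The checking program: frequencies against distances -/

/-- `M` is the maximum of `d` over the indices in `S`, and `0` if there are none. -/
def IsTopValue (d : ℕ → ℕ) (S : ℕ → Prop) (M : ℕ) : Prop :=
  (∀ i, S i → d i ≤ M) ∧ (M = 0 ∨ ∃ i, S i ∧ d i = M)

/-- Among the first `k` indices, a higher value of `f` implies a value of `d` that is not
higher. -/
def IsOpposed (f d : ℕ → ℕ) (k : ℕ) : Prop := ∀ i < k, ∀ j < k, f i < f j → d j ≤ d i

theorem isTopValue_succ {d : ℕ → ℕ} {k M : ℕ} (h : IsTopValue d (· < k) M) :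
    IsTopValue d (· < k + 1) (if M < d k then d k else M) := by
  obtain ⟨h1, h2⟩ := h
  refine ⟨fun i hi => ?_, ?_⟩
  · have hi : i < k + 1 := hi
    rcases Nat.lt_succ_iff_lt_or_eq.1 hi with h | rfl
    · have := h1 i h
      split_ifs <;> omega
    · split_ifs <;> omega
  · split_ifs with h
    · exact Or.inr ⟨k, Nat.lt_succ_self k, rfl⟩
    · rcases h2 with h2 | ⟨i, hi, h2⟩
      · exact Or.inl h2
      · exact Or.inr ⟨i, Nat.lt_succ_of_lt hi, h2⟩

/-- Since `f` descends, the strictly more frequent rows stay the same as long as `f` is constant,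
and become all earlier rows when it drops. So the maximum over them is either kept or replaced by
the overall maximum. -/
theorem isTopValue_higher {f d : ℕ → ℕ} {k M N : ℕ} (hf : ∀ i ≤ k, f k ≤ f i)
    (hf' : ∀ i < k, f (k - 1) ≤ f i)
    (hM : IsTopValue d (fun i => i < k ∧ f (k - 1) < f i) M) (hN : IsTopValue d (· < k) N) :
    IsTopValue d (fun i => i < k + 1 ∧ f k < f i) (if f k = f (k - 1) then M else N) := by
  split_ifs with h
  · have : (fun i => i < k + 1 ∧ f k < f i) = fun i => i < k ∧ f (k - 1) < f i := by
      funext i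
      refine propext ⟨fun ⟨h1, h2⟩ => ?_, fun ⟨h1, h2⟩ => ⟨by omega, by omega⟩⟩
      have : i ≠ k := by
        rintro rfl
        omega
      exact ⟨by omega, by omega⟩
    rw [this]
    exact hM
  · have : (fun i => i < k + 1 ∧ f k < f i) = (· < k) := by
      funext i
      refine propext ⟨fun ⟨h1, h2⟩ => ?_, fun h1 => ?_⟩
      · have : i ≠ k := by
          rintro rfl
          omega
        omega
      · have h1 : i < k := h1
        have h2 := hf (k - 1) (by omega)
        have h3 := hf' i h1
        exact ⟨by omega, by omega⟩
    rw [this]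
    exact hN

/-- Row `k` has the least frequency so far, so the only new comparisons are with strictly more
frequent rows, and their maximal distance `M` represents them all. This spares the sorting by
distance. -/
theorem isOpposed_succ {f d : ℕ → ℕ} {k M : ℕ} (hf : ∀ i ≤ k, f k ≤ f i)
    (hM : IsTopValue d (fun i => i < k + 1 ∧ f k < f i) M) :
    IsOpposed f d (k + 1) ↔ IsOpposed f d k ∧ ¬ d k < M := by
  obtain ⟨h1, h2⟩ := hM
  constructor
  · intro h
    refine ⟨fun i hi j hj => h i (by omega) j (by omega), fun hlt => ?_⟩
    rcases h2 with h2 | ⟨i, ⟨hi, hfi⟩, h2⟩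
    · omega
    · have := h k (by omega) i hi hfi
      omega
  · rintro ⟨h, hd⟩ i hi j hj hij
    rcases Nat.lt_succ_iff_lt_or_eq.1 hj with hj' | rfl
    · rcases Nat.lt_succ_iff_lt_or_eq.1 hi with hi' | rfl
      · exact h i hi' j hj' hij
      · have := h1 j ⟨hj, hij⟩
        omega
    · have := hf i (by omega)
      omega

/-- One step of `freqProg`. -/
def freqStep : Cmd :=
  .seq (.op .add 44 3 40) <| .seq (.load 44 44) <|
  .seq (.ite (.eq 44 43) .skip (.op .add 41 50 14)) <| .seq (.op .add 43 44 14) <|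
  .seq (.op .add 45 34 40) <| .seq (.load 45 45) <|
  .seq (.ite (.lt 45 41) (.const 39 0) .skip) <|
  .seq (.ite (.lt 50 45) (.op .add 50 45 14) .skip) <| .op .add 40 40 15

/-- Compare frequencies and distances, and put the maximal distance into register `50`. -/
def freqProg : Cmd :=
  .seq (.const 40 0) <| .seq (.const 41 0) <| .seq (.const 50 0) <| .seq (.load 43 3) <|
  .loop (.lt 40 1) freqStep

theorem freqProg_spec {w K m L F R Q c : ℕ} {s : RamState} {f d : ℕ → ℕ}
    (hs : CheckRegs K m L F R Q c s) (hw : F + 11 * L ≤ 2 ^ w) (hmL : m ≤ L)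
    (hQ : Q + m ≤ F) (hf : ∀ i < m, s.mem (Q + i) = f i)
    (hfw : ∀ i < m, f i < 2 ^ w) (hd : ∀ i < m, s.mem (F + 7 * L + i) = d i)
    (hdw : ∀ i < m, d i < 2 ^ w)
    (hanti : ∀ i j, i ≤ j → j < m → f j ≤ f i) (hm : 0 < m) (h39 : s.reg 39 = 1) :
    Run w freqProg s fun s' t =>
      (s'.reg 39 = (if IsOpposed f d m then 1 else 0) ∧ IsTopValue d (· < m) (s'.reg 50) ∧
      s'.mem = s.mem ∧ t ≤ m * 16 + 5) ∧
      ∀ r, r ∉ freqProg.writes → s'.reg r = s.reg r := by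
  refine Run.frame ?_
  simp only [freqProg, run_seq, run_const, run_load]
  refine ⟨by positivity, by positivity, by positivity, ?_⟩
  refine (Run.loop (N := m) (B := 15) (I := fun k s' => s'.reg 40 = k ∧
    s'.reg 43 = f (k - 1) ∧ IsTopValue d (fun i => i < k ∧ f (k - 1) < f i) (s'.reg 41) ∧
    IsTopValue d (· < k) (s'.reg 50) ∧ s'.reg 39 = (if IsOpposed f d k then 1 else 0) ∧
    s'.mem = s.mem) ?_ ?_ ?_).mono ?_
  -- At `k = 0` the truncated index `k - 1` is `0`, matching the preloaded first frequency: the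
  -- first row is not treated as a drop.
  · have := hf 0 hm
    have h0 : IsOpposed f d 0 := fun i hi => absurd hi (Nat.not_lt_zero i)
    simp [IsTopValue, hs.r3, ← this, h39, h0]
  · rintro k hk s' ⟨h40, h43, hM, hN, hflag, hmem⟩ hfr
    have hs' : CheckRegs K m L F R Q c s' := by
      refine (CheckRegs.frame ?_ hfr (by decide))
      exact hs.frame (W := [40, 41, 43, 50]) (fun r hr => by simp_all) (by decide)
    have hfk := hf k hk
    have hdk := hd k hk
    have hwk := hfw k hk
    have hwk' := hdw k hk
    have hM' := isTopValue_higher (fun i hi => hanti i k hi hk)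
      (fun i hi => hanti i (k - 1) (by omega) (by omega)) hM hN
    have hN' := isTopValue_succ hN
    have hop := isOpposed_succ (fun i hi => hanti i k hi hk) hM'
    have h50 : s'.reg 50 < 2 ^ w := by
      rcases hN.2 with h | ⟨i, hi, h⟩
      · omega
      · have := hdw i (by have : i < k := hi; omega)
        omega
    refine ⟨by simp [h40, hs'.r1, hk], ?_⟩
    refine Run.mono (Q := fun s₂ t => s₂.reg 40 = k + 1 ∧ s₂.reg 43 = f k ∧
        s₂.reg 41 = (if f k = f (k - 1) then s'.reg 41 else s'.reg 50) ∧
        s₂.reg 50 = (if s'.reg 50 < d k then d k else s'.reg 50) ∧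
        s₂.reg 39 = (if d k < (if f k = f (k - 1) then s'.reg 41 else s'.reg 50) then 0 else
          s'.reg 39) ∧ s₂.mem = s'.mem ∧ t ≤ 15) ?_ ?_
    · simp [freqStep, hs'.r3, hs'.r34, hs'.r14, hs'.r15, h40, h43, hmem, hfk, hdk]
      refine ⟨by omega, fun h1 => ?_, fun h1 => ?_⟩
      · simp +contextual [h1]
        omega
      · simp +contextual [h1]
        omega
    · rintro s₂ t ⟨e40, e43, e41, e50, e39, em, et⟩
      refine ⟨⟨e40, e43, by rw [e41]; exact hM', by rw [e50]; exact hN', ?_, em.trans hmem⟩, et⟩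
      rw [e39, hflag]
      by_cases h1 : IsOpposed f d k <;>
      by_cases h2 : d k < (if f k = f (k - 1) then s'.reg 41 else s'.reg 50) <;>
      simp [hop, h1, h2]
  · rintro s' ⟨h40, -⟩ hfr
    have f1 := hfr 1 (by decide)
    simp [hs.r1] at f1
    simp [f1, h40]
  · rintro s' t ⟨⟨⟨-, -, -, hN, hflag, hmem⟩, -⟩, ht⟩
    exact ⟨hflag, hN, hmem, by omega⟩

end

noncomputable section

open scoped Classical
open Preference

/-! ### The checking program: full layers -/

/-- Clear the two arrays of counters. -/
def clearProg : Cmd :=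
  .seq (.const 40 0) <| .loop (.lt 40 1) <|
    .seq (.op .add 41 36 40) <| .seq (.store 41 14) <| .seq (.op .add 41 37 40) <|
    .seq (.store 41 14) <| .op .add 40 40 15

theorem clearProg_spec {w K m L F R Q c : ℕ} {s : RamState}
    (hs : CheckRegs K m L F R Q c s) (hw : F + 11 * L ≤ 2 ^ w) (hmL : m ≤ L) :
    Run w clearProg s fun s' t =>
      ((∀ e < m, s'.mem (F + 9 * L + e) = 0 ∧ s'.mem (F + 10 * L + e) = 0) ∧
      (∀ a, a < F + 9 * L → s'.mem a = s.mem a) ∧ t ≤ m * 6 + 2) ∧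
      ∀ r, r ∉ clearProg.writes → s'.reg r = s.reg r := by
  refine Run.frame ?_
  simp only [clearProg, run_seq, run_const]
  refine ⟨by positivity, ?_⟩
  refine (Run.loop (N := m) (B := 5) (I := fun k s' => s'.reg 40 = k ∧
    (∀ e < k, s'.mem (F + 9 * L + e) = 0 ∧ s'.mem (F + 10 * L + e) = 0) ∧
    ∀ a, a < F + 9 * L → s'.mem a = s.mem a) ?_ ?_ ?_).mono ?_
  · simp
  · rintro k hk s' ⟨h40, hz, hm⟩ hf
    have hs' : CheckRegs K m L F R Q c s' := by
      refine (CheckRegs.frame ?_ hf (by decide))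
      exact hs.frame (W := [40]) (fun r hr => by simp_all) (by decide)
    simp [hs'.r1, hs'.r36, hs'.r37, hs'.r14, hs'.r15, h40]
    refine ⟨hk, by omega, by omega, by omega, fun e he => ?_, fun a ha => ?_⟩
    · rcases Nat.lt_or_ge e k with h | h
      · have := hz e h
        simp [this.1, this.2]
      · obtain rfl : e = k := by omega
        simp
    · rw [if_neg (by omega), if_neg (by omega), hm a ha]
  · rintro s' ⟨h40, -, -⟩ hf
    have f1 := hf 1 (by decide)
    simp [hs.r1] at f1
    simp [f1, h40]
  · rintro s' t ⟨⟨⟨-, hz, hm⟩, -⟩, ht⟩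
    exact ⟨hz, hm, by omega⟩

/-- Add the ascents and the descents of every row to the counters of its layer. -/
def countProg : Cmd :=
  .seq (.op .sub 46 0 15) <| .seq (.const 40 0) <| .loop (.lt 40 1) <|
    .seq (.op .add 41 34 40) <| .seq (.load 41 41) <| .seq (.op .add 42 35 40) <|
    .seq (.load 42 42) <| .seq (.op .sub 43 46 42) <|
    .seq (.op .add 44 36 41) <| .seq (.load 45 44) <| .seq (.op .add 45 45 43) <|
    .seq (.store 44 45) <|
    .seq (.op .add 44 37 41) <| .seq (.load 45 44) <| .seq (.op .add 45 45 42) <|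
    .seq (.store 44 45) <| .op .add 40 40 15

theorem sum_ite_le {k B : ℕ} {P : ℕ → Prop} [DecidablePred P] {x : ℕ → ℕ} (hx : ∀ i < k, x i ≤ B) :
    ∑ i ∈ Finset.range k, (if P i then x i else 0) ≤ k * B := by
  refine (Finset.sum_le_card_nsmul _ _ B fun i hi => ?_).trans (by simp)
  have := hx i (Finset.mem_range.1 hi)
  split_ifs <;> omega

theorem countProg_spec {w K m L F R Q c : ℕ} {s : RamState} {d x : ℕ → ℕ}
    (hs : CheckRegs K m L F R Q c s) (hw : F + 11 * L ≤ 2 ^ w) (hmL : m ≤ L) (hK : 0 < K)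
    (hKL : K ≤ L) (hmK : m * K < L) (hd : ∀ i < m, s.mem (F + 7 * L + i) = d i) (hdm : ∀ i < m, d i < m)
    (hx : ∀ i < m, s.mem (F + 8 * L + i) = x i) (hxK : ∀ i < m, x i ≤ K - 1)
    (hz : ∀ e < m, s.mem (F + 9 * L + e) = 0 ∧ s.mem (F + 10 * L + e) = 0) :
    Run w countProg s fun s' t =>
      ((∀ e < m,
        s'.mem (F + 9 * L + e) = ∑ i ∈ Finset.range m, (if d i = e then K - 1 - x i else 0) ∧
        s'.mem (F + 10 * L + e) = ∑ i ∈ Finset.range m, (if d i = e then x i else 0)) ∧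
      (∀ a, a < F + 9 * L → s'.mem a = s.mem a) ∧ t ≤ m * 15 + 3) ∧
      ∀ r, r ∉ countProg.writes → s'.reg r = s.reg r := by
  refine Run.frame ?_
  simp only [countProg, run_seq, run_const, run_sub]
  refine ⟨⟨by simp [hs.r0, hs.r15]; omega, by simp [hs.r0]; omega⟩, by positivity, ?_⟩
  refine (Run.loop (N := m) (B := 14) (I := fun k s' => s'.reg 40 = k ∧
    (∀ e < m,
        s'.mem (F + 9 * L + e) = ∑ i ∈ Finset.range k, (if d i = e then K - 1 - x i else 0) ∧
        s'.mem (F + 10 * L + e) = ∑ i ∈ Finset.range k, (if d i = e then x i else 0)) ∧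
    ∀ a, a < F + 9 * L → s'.mem a = s.mem a) ?_ ?_ ?_).mono ?_
  · simpa using hz
  · rintro k hk s' ⟨h40, hz, hm⟩ hf
    have hs' : CheckRegs K m L F R Q c s' := by
      refine (CheckRegs.frame ?_ hf (by decide))
      exact hs.frame (W := [40, 46]) (fun r hr => by simp_all) (by decide)
    have f46 := hf 46 (by decide)
    simp [hs.r0, hs.r15] at f46
    have hdk : s'.mem (F + 7 * L + k) = d k := by rw [hm _ (by omega), hd k hk]
    have hxk : s'.mem (F + 8 * L + k) = x k := by rw [hm _ (by omega), hx k hk]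
    have hdkm := hdm k hk
    have hxkK := hxK k hk
    obtain ⟨hA, hB⟩ := hz _ hdkm
    have hrow := row_le (K := K) hk
    -- Each row contributes at most `K`, so the counters stay below `m * K < L` and cannot overflow.
    have hA' : s'.mem (F + 9 * L + d k) ≤ k * K := by
      rw [hA]
      refine sum_ite_le (P := fun i => d i = d k) (x := fun i => K - 1 - x i) fun i hi => ?_
      exact (Nat.sub_le _ _).trans (Nat.sub_le _ _)
    have hB' : s'.mem (F + 10 * L + d k) ≤ k * K := by
      rw [hB]
      refine sum_ite_le (P := fun i => d i = d k) (x := x) fun i hi => ?_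
      exact (hxK i (by omega)).trans (Nat.sub_le _ _)
    have hL0 : L ≠ 0 := by omega
    simp [hs'.r1, hs'.r34, hs'.r35, hs'.r36, hs'.r37, hs'.r15, h40, hdk, hxk, f46, hL0]
    refine ⟨hk, by omega, by omega, ⟨by omega, by omega⟩, by omega, by omega, by omega, by omega,
      by omega, fun e he => ?_, fun a ha => ?_⟩
    · rw [Finset.sum_range_succ, Finset.sum_range_succ]
      obtain ⟨hA₁, hB₁⟩ := hz e he
      by_cases h : d k = e
      · subst h
        simp [hL0, hA₁, hB₁]
      · have h' : ¬ e = d k := fun h' => h h'.symm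
        rw [← hA₁, ← hB₁, if_neg h, if_neg h, if_neg (by omega), if_neg (by omega),
          if_neg (by omega), if_neg (by omega)]
        exact ⟨rfl, rfl⟩
    · rw [if_neg (by omega), if_neg (by omega), hm a ha]
  · rintro s' ⟨h40, -, -⟩ hf
    have f1 := hf 1 (by decide)
    simp [hs.r1] at f1
    simp [f1, h40]
  · rintro s' t ⟨⟨⟨-, hz, hm⟩, -⟩, ht⟩
    exact ⟨hz, hm, by omega⟩

/-- Compare the ascents of every layer with the descents of the next one, up to the maximal
distance in register `50`. -/
def layerProg : Cmd :=
  .seq (.const 40 1) <| .loop (.lt 40 50) <|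
    .seq (.op .sub 41 40 15) <| .seq (.op .add 41 36 41) <| .seq (.load 41 41) <|
    .seq (.op .add 43 37 40) <| .seq (.load 43 43) <|
    .seq (.ite (.eq 41 43) .skip (.const 39 0)) <| .op .add 40 40 15

theorem layerProg_spec {w K m L F R Q c D : ℕ} {s : RamState} {A B : ℕ → ℕ}
    (hs : CheckRegs K m L F R Q c s) (hw : F + 11 * L ≤ 2 ^ w) (hmL : m ≤ L)
    (hA : ∀ e < m, s.mem (F + 9 * L + e) = A e) (hB : ∀ e < m, s.mem (F + 10 * L + e) = B e)
    (h50 : s.reg 50 = D) (hD : D < m) :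
    Run w layerProg s fun s' t =>
      (s'.reg 39 = (if ∀ e, e + 1 < D → A e = B (e + 1) then s.reg 39 else 0) ∧
      s'.mem = s.mem ∧ t ≤ m * 10 + 2) ∧
      ∀ r, r ∉ layerProg.writes → s'.reg r = s.reg r := by
  refine Run.frame ?_
  simp only [layerProg, run_seq, run_const]
  refine ⟨by omega, ?_⟩
  -- The outermost layer `D` may be incomplete, so only pairs `e`, `e + 1` with `e + 1 < D` are
  -- compared. For `D = 0` the truncated count is `0`.
  refine (Run.loop (N := D - 1) (B := 9) (I := fun k s' => s'.reg 40 = k + 1 ∧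
    s'.reg 39 = (if ∀ e < k, A e = B (e + 1) then s.reg 39 else 0) ∧
    s'.mem = s.mem) ?_ ?_ ?_).mono ?_
  · simp
  · rintro k hk s' ⟨h40, h39, hm⟩ hf
    have hs' : CheckRegs K m L F R Q c s' := by
      refine (CheckRegs.frame ?_ hf (by decide))
      exact hs.frame (W := [40]) (fun r hr => by simp_all) (by decide)
    have f50 := hf 50 (by decide)
    simp [h50] at f50
    have hAk := hA k (by omega)
    have hBk := hB (k + 1) (by omega)
    have hiff : (∀ e < k + 1, A e = B (e + 1)) ↔ (∀ e < k, A e = B (e + 1)) ∧ A k = B (k + 1) :=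
      Nat.forall_lt_succ_right
    refine ⟨by simp [h40, f50]; omega, ?_⟩
    refine Run.mono (Q := fun s₂ t => s₂.reg 40 = k + 2 ∧
      s₂.reg 39 = (if A k = B (k + 1) then s'.reg 39 else 0) ∧ s₂.mem = s'.mem ∧ t ≤ 9) ?_ ?_
    · simp [hs'.r36, hs'.r37, hs'.r15, h40, hm, hAk, hBk]
      refine ⟨by omega, by omega, by omega, fun h => ?_, fun h => ?_⟩ <;> simp [h] <;> omega
    · rintro s₂ t ⟨e40, e39, em, et⟩
      refine ⟨⟨e40, ?_, em.trans hm⟩, et⟩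
      rw [e39, h39]
      by_cases h1 : ∀ e < k, A e = B (e + 1) <;> by_cases h2 : A k = B (k + 1)
      · rw [if_pos h2, if_pos h1, if_pos (hiff.2 ⟨h1, h2⟩)]
      · rw [if_neg h2, if_neg fun h => h2 (hiff.1 h).2]
      · rw [if_pos h2, if_neg h1, if_neg fun h => h1 (hiff.1 h).1]
      · rw [if_neg h2, if_neg fun h => h2 (hiff.1 h).2]
  · rintro s' ⟨h40, -, -⟩ hf
    have f50 := hf 50 (by decide)
    simp [h50] at f50
    simp [f50, h40]
    omega
  · rintro s' t ⟨⟨⟨-, h39, hm⟩, -⟩, ht⟩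
    refine ⟨?_, hm, by omega⟩
    rw [h39]
    have : (∀ e < D - 1, A e = B (e + 1)) ↔ ∀ e, e + 1 < D → A e = B (e + 1) :=
      ⟨fun h e he => h e (by omega), fun h e he => h e (by omega)⟩
    simp only [this]

end

noncomputable section

open scoped Classical
open Preference

/-! ### The checking program -/

/-- The frequencies of the preferences in `l`. -/
def freqAt {K n : ℕ} (π : Profile K n) (l : List (Preference K)) (i : ℕ) : ℕ :=
  if h : i < l.length then freq π l[i] else 0

theorem freqAt_eq {K n : ℕ} (π : Profile K n) {l : List (Preference K)} {i : ℕ}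
    (h : i < l.length) : freqAt π l i = freq π l[i] := dif_pos h

theorem sum_toFinset_eq {α : Type*} {l : List α} (hl : l.Nodup) {g : α → ℕ}
    {x : ℕ → ℕ} (hx : ∀ (i : ℕ) (h : i < l.length), x i = g l[i]) :
    ∑ p ∈ l.toFinset, g p = ∑ i ∈ Finset.range l.length, x i := by
  rw [List.sum_toFinset g hl, Finset.sum_range, ← Fin.sum_univ_fun_getElem]
  exact Finset.sum_congr rfl fun i _ => (hx i i.2).symm

/-- The form of Flexible Consensus that the program decides: every quantity is indexed by the rows
of the table, and the double count of `layers_full_iff` stands in for the sizes of full layers. -/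
theorem flexibleConsensusAround_iff_layers {K n : ℕ} {π : Profile K n} {l : List (Preference K)}
    {q : Preference K} {D : ℕ} {x : ℕ → ℕ} (hl : IsListing π l) (hq : q ∈ l)
    (hx : ∀ (i : ℕ) (h : i < l.length), x i = descents (q.relTo l[i]))
    (hD : IsTopValue (distAt q l) (· < l.length) D) :
    FlexibleConsensusAround π q ↔ IsOpposed (freqAt π l) (distAt q l) l.length ∧
      ∀ e, e + 1 < D →
        ∑ i ∈ Finset.range l.length, (if distAt q l i = e then K - 1 - x i else 0) =
        ∑ i ∈ Finset.range l.length, (if distAt q l i = e + 1 then x i else 0) := by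
  rw [flexibleConsensusAround_iff hl]
  refine and_congr ?_ ?_
  · constructor
    · intro h i hi j hj hij
      rw [freqAt_eq π hi, freqAt_eq π hj] at hij
      rw [distAt_eq q hi, distAt_eq q hj]
      exact h _ (List.getElem_mem hi) _ (List.getElem_mem hj) hij
    · intro h p hp p' hp' hlt
      obtain ⟨i, hi, rfl⟩ := List.getElem_of_mem hp
      obtain ⟨j, hj, rfl⟩ := List.getElem_of_mem hp'
      have := h i hi j hj (by rwa [freqAt_eq π hi, freqAt_eq π hj])
      rwa [distAt_eq q hi, distAt_eq q hj] at this
  · have h1 : (∀ p ∈ l, ∀ q', invDist q' q < invDist p q → q' ∈ l) ↔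
        ∀ q', invDist q' q < D → q' ∈ l.toFinset := by
      simp only [List.mem_toFinset]
      constructor
      · intro h q' hlt
        rcases hD.2 with h0 | ⟨i, hi, h0⟩
        · omega
        · have hi : i < l.length := hi
          rw [distAt_eq q hi] at h0
          exact h _ (List.getElem_mem hi) q' (by omega)
      · intro h p hp q' hlt
        obtain ⟨i, hi, rfl⟩ := List.getElem_of_mem hp
        have := hD.1 i hi
        rw [distAt_eq q hi] at this
        exact h q' (by omega)
    rw [h1, layers_full_iff (List.mem_toFinset.2 hq)]
    refine forall₂_congr fun e _ => ?_
    rw [Finset.sum_filter, Finset.sum_filter]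
    rw [sum_toFinset_eq hl.1 (x := fun i => if distAt q l i = e then K - 1 - x i else 0),
      sum_toFinset_eq hl.1 (x := fun i => if distAt q l i = e + 1 then x i else 0)]
    · intro i hi
      rw [distAt_eq q hi, hx i hi]
    · intro i hi
      rw [distAt_eq q hi, hx i hi]

/-- The second half of the checking program: compute the distances and the verdict. -/
def distProg : Cmd :=
  .seq jumpProg <| .seq freqProg <| .seq clearProg <| .seq countProg <| .seq layerProg <|
  .op .add 13 39 14

theorem distProg_spec {w K n m L F R Q c : ℕ} {s : RamState} {π : Profile K n}
    {l : List (Preference K)} {q : Preference K} (hl : IsFreqOrder π l) (hq : q ∈ l)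
    (hs : CheckRegs K m L F R Q c s) (hw : F + 11 * L ≤ 2 ^ w) (hm : l.length = m)
    (hK : 0 < K) (hKL : K * K < L) (hKL' : 2 * K < L) (hmK : m * K < L) (hmL : m ≤ L)
    (hQ : Q + m ≤ F) (hf : ∀ (i : ℕ) (h : i < l.length), s.mem (Q + i) = freq π l[i])
    (hfw : ∀ a < F, s.mem a < 2 ^ w) (h39 : s.reg 39 = 1)
    (hstep : ∀ (i : ℕ) (h : i < l.length), IsStep L F q l s.mem i h)
    (hdes : ∀ (i : ℕ) (h : i < l.length), s.mem (F + 8 * L + i) = descents (q.relTo l[i])) :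
    Run w distProg s fun s' t =>
      s'.reg 13 = (if FlexibleConsensusAround π q then 1 else 0) ∧
      (∀ a < F, s'.mem a = s.mem a) ∧ t ≤ 26 * (m * K) + 8 * K + 47 * m + 16 := by
  subst hm
  have hpos : 0 < l.length := List.length_pos_of_mem hq
  have hfreq : ∀ i < l.length, s.mem (Q + i) = freqAt π l i := fun i hi => by
    rw [hf i hi, freqAt_eq π hi]
  have hdw : ∀ i, distAt q l i < L := fun i => (distAt_le q l i).trans_lt hKL
  -- Every row other than the candidate has a listed neighbour one step closer, so distances are
  -- valid indices into counter arrays of `m` cells.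
  have hlt : ∀ i < l.length, distAt q l i < l.length := by
    intro i hi
    rw [distAt_eq q hi, ← List.toFinset_card_of_nodup hl.1.1]
    refine invDist_lt_card (fun p hp hne => ?_) (List.mem_toFinset.2 (List.getElem_mem hi))
    obtain ⟨j, hj, rfl⟩ := List.getElem_of_mem (List.mem_toFinset.1 hp)
    obtain ⟨h1, h2, h3, h4⟩ := hstep j hj
    refine ⟨_, List.mem_toFinset.2 (List.getElem_mem h1), ?_⟩
    have h5 : s.mem (F + 7 * L + j) ≠ 0 := fun h0 => hne (invDist_eq_zero.1 (h3 h0))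
    rw [← h2]
    omega
  have hanti : ∀ i j, i ≤ j → j < l.length → freqAt π l j ≤ freqAt π l i := by
    intro i j hij hj
    rcases hij.eq_or_lt with rfl | hij
    · exact le_rfl
    · rw [freqAt_eq π hj, freqAt_eq π (hij.trans hj)]
      exact List.pairwise_iff_getElem.1 hl.2 i j _ hj hij
  simp only [distProg, run_seq]
  refine (jumpProg_spec hs hw (distAt_le q l) hKL hKL' hmL fun i hi =>
    (hstep i hi).isJump).mono ?_
  rintro s₁ t₁ ⟨⟨d₁, m₁, ht₁⟩, f₁⟩
  have hs₁ := hs.frame f₁ (by decide)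
  refine (freqProg_spec (f := freqAt π l) (d := distAt q l) hs₁ hw hmL hQ
    (fun i hi => by rw [m₁ _ (by omega), hfreq i hi])
    (fun i hi => by rw [← hfreq i hi]; exact hfw _ (by omega)) d₁
    (fun i _ => (hdw i).trans_le (by omega)) hanti hpos
    (by rw [f₁ 39 (by decide), h39])).mono ?_
  rintro s₂ t₂ ⟨⟨v₂, d₂, m₂, ht₂⟩, f₂⟩
  have hs₂ := hs₁.frame f₂ (by decide)
  generalize hD : s₂.reg 50 = D at d₂
  refine (clearProg_spec hs₂ hw hmL).mono ?_
  rintro s₃ t₃ ⟨⟨z₃, m₃, ht₃⟩, f₃⟩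
  have hs₃ := hs₂.frame f₃ (by decide)
  have hx : ∀ (i : ℕ) (h : i < l.length), s.mem (F + 8 * L + i) = descents (q.relTo l[i]) := hdes
  refine (countProg_spec (d := distAt q l) (x := fun i => s.mem (F + 8 * L + i)) hs₃ hw hmL hK
    (by omega) hmK (fun i hi => by rw [m₃ _ (by omega), m₂, d₁ i hi]) hlt
    (fun i hi => by rw [m₃ _ (by omega), m₂, m₁ _ (by omega)])
    (fun i hi => by rw [hx i hi]; exact descents_le _) z₃).mono ?_
  rintro s₄ t₄ ⟨⟨c₄, m₄, ht₄⟩, f₄⟩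
  have hs₄ := hs₃.frame f₄ (by decide)
  have hDlt : D < l.length := by
    rcases d₂.2 with h | ⟨i, hi, h⟩
    · omega
    · exact h ▸ hlt i hi
  refine (layerProg_spec hs₄ hw hmL (fun e he => (c₄ e he).1) (fun e he => (c₄ e he).2)
    (by rw [f₄ 50 (by decide), f₃ 50 (by decide), hD]) hDlt).mono ?_
  rintro s₅ t₅ ⟨⟨v₅, m₅, ht₅⟩, f₅⟩
  have hs₅ := hs₄.frame f₅ (by decide)
  have e39 : s₄.reg 39 = if IsOpposed (freqAt π l) (distAt q l) l.length then 1 else 0 := by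
    rw [f₄ 39 (by decide), f₃ 39 (by decide), v₂]
  have hv : s₅.reg 39 = if FlexibleConsensusAround π q then 1 else 0 := by
    rw [v₅, e39]
    simp only [flexibleConsensusAround_iff_layers hl.1 hq hx d₂, ite_and]
    split_ifs <;> rfl
  have hv1 : s₅.reg 39 < 2 ^ w := by
    rw [hv]
    split_ifs <;> omega
  simp [hs₅.r14]
  refine ⟨hv1, hv, fun a ha => ?_, ?_⟩
  · rw [m₅, m₄ a (by omega), m₃ a (by omega), m₂, m₁ a (by omega)]
  · have e1 : 2 * K * (l.length * 13 + 4) = 26 * (l.length * K) + 8 * K := by ring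
    omega

/-- The checking program. -/
def checkProg : Cmd :=
  .seq checkSetup <| .seq rankProg <| .seq internRows <| .seq (.op .add 22 5 14) <| .seq intern <|
  .ite (.lt 23 1) (.seq parentProg (.ite (.eq 39 15) distProg (.const 13 0))) (.const 13 0)

theorem HoldsTable.holdsRows {K n : ℕ} {π : Profile K n} {l : List (Preference K)} {s : RamState}
    (h : HoldsTable π l s) : HoldsRows s.mem (s.reg 2) l :=
  fun i hi => holdsPref_iff.1 (h.prefs i hi)

theorem HasGap.not_flexibleConsensusAround {K n : ℕ} {π : Profile K n} {l : List (Preference K)}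
    {q : Preference K} (hl : IsListing π l) (h : HasGap q l) : ¬ FlexibleConsensusAround π q := by
  obtain ⟨p, hp, p', hp', hlt⟩ := h
  exact fun hf => hp' (((flexibleConsensusAround_iff hl).1 hf).2 p hp p' hlt)

/-- There are three ways to the verdict. A candidate outside the table fails because a centre must
occur in the profile; a missing closer neighbour violates closure; otherwise all distances are
available and `distProg` decides. The space is `11` blocks of `4 (m K)²` cells, which gives the
`44`. -/
theorem checkProg_spec {w K n : ℕ} {s : RamState} {π : Profile K n} {l : List (Preference K)}
    {q : Preference K} (hK : 3 ≤ K) (hn : 0 < n) (hl : IsFreqOrder π l)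
    (hword : ∀ a, s.mem a < 2 ^ w) (ht : HoldsTable π l s) (hq : HoldsPref s.mem (s.reg 5) q)
    (h5 : s.reg 5 + K ≤ s.reg 4)
    (hw : s.reg 4 + 44 * ((l.length * K) * (l.length * K)) ≤ 2 ^ w) :
    Run w checkProg s fun s' t =>
      (s'.reg 13 = (if FlexibleConsensusAround π q then 1 else 0) ∧
      (∀ a < s.reg 4, s'.mem a = s.mem a) ∧ t ≤ 300 * (l.length * K)) ∧
      ∀ r, r ∉ checkProg.writes → s'.reg r = s.reg r := by
  refine Run.frame ?_
  obtain ⟨m, hm⟩ : ∃ m, l.length = m := ⟨_, rfl⟩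
  obtain ⟨L, hL⟩ : ∃ L, L = (m * K) * (m * K) * 4 := ⟨_, rfl⟩
  have hmpos : 0 < m := hm ▸ hl.1.length_pos hn
  have hmX : m ≤ m * K := Nat.le_mul_of_pos_right _ (by omega)
  have hKX : K ≤ m * K := Nat.le_mul_of_pos_left _ hmpos
  have hXX : 3 * (m * K) ≤ (m * K) * (m * K) := Nat.mul_le_mul_right _ (by omega)
  have hKK : K * K ≤ (m * K) * (m * K) := Nat.mul_le_mul hKX hKX
  have hrows := ht.holdsRows
  have hple := ht.prefs_le
  have hfle := ht.freqs_le
  have hwF : s.reg 4 + 11 * L ≤ 2 ^ w := by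
    rw [hm] at hw
    omega
  -- The insertions are the `m` rows, the candidate, and at most one neighbour for each row.
  have hfit : Fits K L (m + 1 + m) := by
    have h1 : ((m + 1 + m) * K + 1) ≤ 4 * (m * K) := by
      rw [Nat.add_mul, Nat.add_mul]
      omega
    refine (Nat.mul_le_mul_right K h1).trans ?_
    rw [hL, Nat.mul_assoc, Nat.mul_comm _ 4]
    exact Nat.mul_le_mul_left 4 (Nat.mul_le_mul_left _ hKX)
  rw [hm] at hple hfle
  have hqc := holdsPref_iff.1 hq
  simp only [checkProg, run_seq]
  refine (checkSetup_spec hL (by omega) ht.alternatives (ht.rows.trans hm) rfl rfl rfl rfl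
    hwF).mono ?_
  rintro s₁ t₁ ⟨⟨hs₁, i₁, v₁, m₁, ht₁⟩, f₁⟩
  refine (rankProg_spec hs₁ (by omega) hwF (fun j hj => by rw [m₁, hqc j hj]) h5).mono ?_
  rintro s₂ t₂ ⟨⟨r₂, m₂, ht₂⟩, f₂⟩
  have hs₂ := hs₁.frame f₂ (by decide)
  have i₂ : Interner (K := K) L 0 [] s₂ := by
    refine i₁.congr (hfit.mono (by omega)) (by omega) (fun r h1 h2 => f₂ r ?_) fun a h1 h2 =>
      m₂ a (by rw [hs₁.r16] at h2; omega)
    simp only [rankProg, Cmd.writes, List.cons_append, List.nil_append, List.mem_cons,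
      List.not_mem_nil, or_false]
    omega
  have low₂ : ∀ a < s.reg 4, s₂.mem a = s.mem a := fun a ha => by rw [m₂ a (by omega), m₁]
  refine (internRows_spec hs₂ (by omega) hm hl.1.1 i₂ (hfit.mono (by omega)) (by omega) hwF
    (fun i hi j hj => ?_) hple).mono ?_
  · have := row_le (K := K) (hm ▸ hi)
    rw [low₂ _ (by omega), hrows i hi j hj]
  rintro s₃ t₃ ⟨⟨i₃, m₃, ht₃⟩, f₃⟩
  have hs₃ := hs₂.frame f₃ (by decide)
  rw [run_add]
  refine ⟨by rw [hs₃.r5, hs₃.r14]; omega, ?_⟩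
  have hs₃' : CheckRegs K m L (s.reg 4) (s.reg 2) (s.reg 3) (s.reg 5)
      (s₃.setReg 22 (s₃.reg 5 + s₃.reg 14)) :=
    hs₃.frame (W := [22]) (fun r hr => by simp_all) (by decide)
  have i₃' : Interner L m l (s₃.setReg 22 (s₃.reg 5 + s₃.reg 14)) := by
    refine i₃.congr (hfit.mono (by omega)) (by omega) (fun r h1 h2 => ?_) fun a _ _ => by simp
    rw [reg_setReg, if_neg (by omega)]
  refine (intern_spec (q := q) (by omega) hs₃'.r0 hs₃'.r14 hs₃'.r15 i₃' (hfit.mono (by omega))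
    (by rw [hs₃'.r16]; omega) (fun j hj => ?_) ?_ ?_).mono ?_
  · simp only [reg_setReg, mem_setReg, if_true, hs₃.r5, hs₃.r14, Nat.add_zero]
    rw [m₃ _ (by omega), low₂ _ (by omega), hqc j hj]
  · simp only [reg_setReg, if_true, hs₃.r5, hs₃.r14]
    omega
  · rw [hs₃'.r16]
    simp only [reg_setReg, if_true, hs₃.r5, hs₃.r14]
    omega
  rintro s₄ t₄ ⟨⟨v₄, i₄, m₄, ht₄⟩, f₄⟩
  have hs₄ := hs₃'.frame f₄ (by decide)
  have low₄ : ∀ a < s.reg 4, s₄.mem a = s.mem a := fun a ha => by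
    rw [m₄ a (by rw [hs₃'.r16]; omega), mem_setReg, m₃ a (by omega), low₂ a ha]
  have r₄ : HoldsRanks s₄.mem (s.reg 4 + 4 * L) q := fun j hj => by
    have := q.code_lt hj
    rw [m₄ _ (by rw [hs₃'.r16]; omega), mem_setReg, m₃ _ (by omega), r₂ j hj]
  have v39 : s₄.reg 39 = 1 := by
    rw [f₄ 39 (by decide), reg_setReg, if_neg (by omega), f₃ 39 (by decide), f₂ 39 (by decide),
      v₁]
  have hpre := prefix_insertEnd l q
  have e1 : m * (40 * K + 3) = 40 * (m * K) + 3 * m := by ring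
  have e2 : m * (52 * K + 31) = 52 * (m * K) + 31 * m := by ring
  have hw0 : 0 < 2 ^ w := by positivity
  rw [run_ite]
  simp only [holds_lt, hs₄.r1, v₄]
  constructor
  · intro hlt
    have hql : q ∈ l := by
      have h1 : (insertEnd l q)[(insertEnd l q).idxOf q]'(List.idxOf_lt_length_of_mem
          (mem_insertEnd.2 (Or.inr rfl))) = q := List.getElem_idxOf _
      rw [← hpre.getElem (by omega)] at h1
      exact h1 ▸ List.getElem_mem _
    rw [run_seq]
    refine (parentProg_spec hs₄ hwF (by omega) hm (by omega) hfit (fun i hi j hj => ?_) hple v39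
      hpre i₄ r₄).mono ?_
    · have := row_le (K := K) (hm ▸ hi)
      rw [low₄ _ (by omega), hrows i hi j hj]
    rintro s₅ t₅ ⟨⟨hP, ht₅⟩, f₅⟩
    have hs₅ := hs₄.frame f₅ (by decide)
    have low₅ : ∀ a < s.reg 4, s₅.mem a = s.mem a := fun a ha => by rw [hP.low a ha, low₄ a ha]
    rw [run_ite]
    simp only [holds_eq, hs₅.r15]
    rcases hP.flag with ⟨h39, hst⟩ | ⟨h39, hgap⟩
    · refine ⟨fun _ => ?_, fun h => absurd h39 h⟩
      refine (distProg_spec (q := q) hl hql hs₅ hwF hm (by omega) (by omega) (by omega) (by omega)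
        (by omega) hfle (fun i hi => ?_) (fun a ha => ?_) h39 (fun i hi => hst i hi (by omega))
        (fun i hi => hP.des i hi (by omega))).mono ?_
      · rw [low₅ _ (by omega), ht.freqs i hi]
      · rw [low₅ a ha]
        exact hword a
      · rintro s₆ t₆ ⟨v₆, m₆, ht₆⟩
        refine ⟨v₆, fun a ha => by rw [m₆ a ha, low₅ a ha], ?_⟩
        rw [hm]
        omega
    · refine ⟨fun h => by omega, fun _ => ?_⟩
      rw [run_const]
      refine ⟨hw0, by simp [hgap.not_flexibleConsensusAround hl.1], fun a ha => low₅ a ha, ?_⟩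
      rw [hm]
      omega
  · intro hge
    have hnot : ¬ FlexibleConsensusAround π q := by
      intro hf
      have hql := hf.mem hn hl.1
      have h1 := idxOf_eq_of_prefix hpre hql
      have h2 := List.idxOf_lt_length_of_mem hql
      exact hge (by rw [h1]; exact hm ▸ h2)
    rw [run_const]
    refine ⟨hw0, by simp [hnot], fun a ha => low₄ a ha, ?_⟩
    rw [hm]
    omega

end

noncomputable section

open scoped Classical
open Preference

/-! ### The tabulation -/

/-- The frequencies in the list `v` of the preferences in `l`. -/
def HoldsCounts {K : ℕ} (mem : ℕ → ℕ) (Q : ℕ) (v l : List (Preference K)) : Prop :=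
  ∀ p ∈ l, mem (Q + l.idxOf p) = v.count p

/-- Copy the `K` cells from the address in register `22` on to the address in register `33`. -/
def copyRow : Cmd :=
  .seq (.const 43 0) <| .loop (.lt 43 0) <|
    .seq (.op .add 44 22 43) <| .seq (.load 44 44) <| .seq (.store 33 44) <|
    .seq (.op .add 33 33 15) <| .op .add 43 43 15

theorem copyRow_spec {w K a b : ℕ} {s : RamState} (h0 : s.reg 0 = K) (h15 : s.reg 15 = 1)
    (h22 : s.reg 22 = a) (h33 : s.reg 33 = b) (hab : a + K ≤ b) (hb : b + K < 2 ^ w) :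
    Run w copyRow s fun s' t =>
      (s'.reg 33 = b + K ∧ (∀ j < K, s'.mem (b + j) = s.mem (a + j)) ∧
      (∀ x, x < b ∨ b + K ≤ x → s'.mem x = s.mem x) ∧ t ≤ 6 * K + 2) ∧
      ∀ r, r ∉ copyRow.writes → s'.reg r = s.reg r := by
  refine Run.frame ?_
  simp only [copyRow, run_seq, run_const]
  refine ⟨by positivity, ?_⟩
  refine (Run.loop (N := K) (B := 5) (I := fun k s' => s'.reg 43 = k ∧ s'.reg 33 = b + k ∧
    (∀ j < k, s'.mem (b + j) = s.mem (a + j)) ∧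
    ∀ x, x < b ∨ b + K ≤ x → s'.mem x = s.mem x) ?_ ?_ ?_).mono ?_
  · simp [h33]
  · rintro k hk s' ⟨h43, g33, hr, hm⟩ hf
    have f0 := hf 0 (by decide)
    have f15 := hf 15 (by decide)
    have f22 := hf 22 (by decide)
    simp [h0, h15, h22] at f0 f15 f22
    have e : s'.mem (a + k) = s.mem (a + k) := hm _ (by omega)
    simp [f0, f15, f22, h43, g33, e]
    refine ⟨hk, by omega, by omega, by omega, by omega, fun j hj => ?_, fun x hx => ?_⟩
    · split_ifs with h
      · rw [h]
      · exact hr j (by omega)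
    · rw [if_neg (by omega), hm x hx]
  · rintro s' ⟨h43, -⟩ hf
    have f0 := hf 0 (by decide)
    simp [h0] at f0
    simp [f0, h43]
  · rintro s' t ⟨⟨⟨-, g33, hr, hm⟩, -⟩, ht⟩
    exact ⟨g33, hr, hm, by omega⟩

/-- Count the preference at the address in register `22`, whose number is in register `23`; the
number of preferences met before is in register `41`. -/
def recordProg : Cmd :=
  .seq (.op .add 42 32 23) <|
  .ite (.lt 23 41)
    (.seq (.load 43 42) <| .seq (.op .add 43 43 15) <| .store 42 43)
    (.seq (.store 42 15) copyRow)

/-- Register `41` keeps the number of preferences known before the lookup, so comparing with it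
tells a repetition, which increments a counter, from a first occurrence, which copies the row and
starts its counter at `1`. -/
theorem recordProg_spec {w K R Q a N : ℕ} {s : RamState} {v l : List (Preference K)}
    {q : Preference K} (h0 : s.reg 0 = K) (h15 : s.reg 15 = 1)
    (h22 : s.reg 22 = a) (h23 : s.reg 23 = (insertEnd l q).idxOf q) (h32 : s.reg 32 = Q)
    (h33 : s.reg 33 = R + l.length * K) (h41 : s.reg 41 = l.length)
    (hl : ∀ p, p ∈ l ↔ p ∈ v) (hN : l.length < N) (ha : a + K ≤ R) (hRQ : R + N * K ≤ Q)
    (hQw : Q + N ≤ 2 ^ w) (hv : v.length + 1 < 2 ^ w)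
    (hq : ∀ j < K, s.mem (a + j) = q.code j) (hr : HoldsRows s.mem R l)
    (hc : HoldsCounts s.mem Q v l) :
    Run w recordProg s fun s' t =>
      (s'.reg 33 = R + (insertEnd l q).length * K ∧ HoldsRows s'.mem R (insertEnd l q) ∧
      HoldsCounts s'.mem Q (v ++ [q]) (insertEnd l q) ∧ (∀ x < R, s'.mem x = s.mem x) ∧
      t ≤ 6 * K + 7) ∧ ∀ r, r ∉ recordProg.writes → s'.reg r = s.reg r := by
  refine Run.frame ?_
  have hrowN := row_le (K := K) hN
  simp only [recordProg, run_seq, run_add, run_ite, holds_lt]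
  by_cases hql : q ∈ l
  · have he : insertEnd l q = l := if_pos hql
    rw [he] at h23 ⊢
    have hlt := List.idxOf_lt_length_of_mem hql
    have hcq := hc q hql
    have hle := List.count_le_length (a := q) (l := v)
    simp [h15, h23, h32, h33, h41, hlt, hcq]
    refine ⟨by omega, by omega, fun i hi j hj => ?_, fun p hp => ?_, fun x hx h => ?_⟩
    · have := row_le (K := K) hi
      simp only [mem_setMem, mem_setReg]
      rw [if_neg (by omega), hr i hi j hj]
    · simp only [mem_setMem, mem_setReg]
      by_cases hpq : p = q
      · subst hpq
        simp
      · have h1 : l.idxOf p ≠ l.idxOf q := fun h => hpq ((List.idxOf_inj hp).1 h)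
        rw [if_neg (by omega), hc p hp, List.count_append, List.count_singleton,
          if_neg (by simpa using Ne.symm hpq), Nat.add_zero]
    · exact absurd hx (by omega)
  · have he : insertEnd l q = l ++ [q] := if_neg hql
    have hidx : (l ++ [q]).idxOf q = l.length := by
      rw [List.idxOf_append_of_notMem hql]
      simp
    have hvq : v.count q = 0 := List.count_eq_zero.2 fun h => hql ((hl q).2 h)
    rw [he, hidx] at h23
    rw [he]
    simp only [reg_setReg, h23, h32, h41]
    simp only [if_neg (show (23 : ℕ) ≠ 42 by decide), if_neg (show (41 : ℕ) ≠ 42 by decide)]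
    refine ⟨by omega, fun h => absurd h (lt_irrefl _), fun _ => ?_⟩
    rw [run_store]
    refine (copyRow_spec (K := K) (a := a) (b := R + l.length * K) (by simp [h0]) (by simp [h15])
      (by simp [h22]) (by simp [h33]) (by omega) (by omega)).mono ?_
    rintro s' t ⟨⟨g33, g1, g2, gt⟩, -⟩
    simp [h15] at g1 g2
    refine ⟨by rw [g33]; simp; ring, fun i hi j hj => ?_, fun p hp => ?_, fun x hx => ?_,
      by omega⟩
    · rcases Nat.lt_succ_iff_lt_or_eq.1 (show i < l.length + 1 by simpa using hi) with h | h
      · have := row_le (K := K) h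
        rw [g2 _ (by omega), if_neg (by omega), hr i h j hj, List.getElem_append_left h]
      · subst h
        rw [g1 j hj, if_neg (by omega), hq j hj]
        simp
    · by_cases hpl : p ∈ l
      · have hlt := List.idxOf_lt_length_of_mem hpl
        have hpq : q ≠ p := fun h => hql (h ▸ hpl)
        rw [List.idxOf_append_of_mem hpl, g2 _ (by omega), if_neg (by omega), hc p hpl,
          List.count_append, List.count_singleton, if_neg (by simpa using hpq), Nat.add_zero]
      · obtain rfl : p = q := by simpa [hpl] using hp
        rw [hidx, g2 _ (by omega), if_pos rfl]
        simp [hvq]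
    · rw [g2 x (by omega), if_neg (by omega)]

/-- The distinct elements of a list. -/
def distinct {α : Type*} (v : List α) : List α := v.foldl insertEnd []

theorem distinct_append {α : Type*} (v : List α) (x : α) :
    distinct (v ++ [x]) = insertEnd (distinct v) x := by
  simp [distinct]

theorem mem_distinct {α : Type*} {v : List α} {x : α} : x ∈ distinct v ↔ x ∈ v := by
  induction v using List.reverseRecOn with
  | nil => simp [distinct]
  | append_singleton v y ih => simp [distinct_append, mem_insertEnd, ih]

theorem nodup_distinct {α : Type*} (v : List α) : (distinct v).Nodup := by
  induction v using List.reverseRecOn with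
  | nil => simp [distinct]
  | append_singleton v y ih => exact distinct_append v y ▸ nodup_insertEnd ih

theorem length_distinct_le {α : Type*} (v : List α) : (distinct v).length ≤ v.length := by
  induction v using List.reverseRecOn with
  | nil => simp [distinct]
  | append_singleton v y ih =>
    rw [distinct_append]
    simpa using (length_insertEnd_le _ _).trans (Nat.succ_le_succ ih)

theorem isListing_distinct {K n : ℕ} (π : Profile K n) :
    IsListing π (distinct (List.ofFn π)) :=
  ⟨nodup_distinct _, fun p => by simp [mem_distinct]⟩

theorem freq_eq_count {K n : ℕ} (π : Profile K n) (p : Preference K) :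
    freq π p = (List.ofFn π).count p := by
  rw [List.ofFn_eq_map, ← Multiset.coe_count, ← Multiset.map_coe, Multiset.count_map, freq,
    Finset.card_def, Finset.filter_val]
  simp only [eq_comm]
  rfl

/-- Set up the constants and the addresses of the arrays. -/
def tabulateSetup : Cmd :=
  .seq (.const 14 0) <| .seq (.const 15 1) <|
  .seq (.op .mul 16 1 0) <| .seq (.op .mul 38 16 16) <| .seq (.const 24 4) <|
  .seq (.op .mul 38 38 24) <|
  .seq (.op .add 17 16 38) <| .seq (.op .add 19 17 38) <|
  .seq (.op .add 20 19 38) <| .seq (.op .add 31 20 38) <| .seq (.op .add 32 31 38) <|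
  .seq (.op .add 4 32 38) <| .seq (.op .add 33 31 14) <|
  .seq (.const 18 0) <| .seq (.const 21 0) <| .seq (.const 22 0) <| .const 40 0

/-- Go through the voters and count their preferences. -/
def countVotes : Cmd :=
  .loop (.lt 40 1) <|
    .seq (.op .add 41 21 14) <| .seq intern <| .seq recordProg <|
    .seq (.op .add 22 22 0) <| .op .add 40 40 15

/-- The tabulation program. -/
def tabulate : Cmd :=
  .seq tabulateSetup <| .seq countVotes <|
  .seq (.op .add 1 21 14) <| .seq (.op .add 2 31 14) <| .op .add 3 32 14

theorem countVotes_spec {w K n L : ℕ} {s : RamState} {π : Profile K n} (hK : 0 < K)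
    (h0 : s.reg 0 = K) (h1 : s.reg 1 = n) (h14 : s.reg 14 = 0) (h15 : s.reg 15 = 1)
    (h16 : s.reg 16 = n * K) (h31 : s.reg 31 = n * K + 4 * L) (h32 : s.reg 32 = n * K + 5 * L)
    (h33 : s.reg 33 = n * K + 4 * L) (h22 : s.reg 22 = 0) (h40 : s.reg 40 = 0)
    (hi : Interner (K := K) L 0 [] s) (hfit : Fits K L n) (hL : n * K ≤ L)
    (hw : n * K + 6 * L < 2 ^ w)
    (hπ : ∀ (i : ℕ) (h : i < n), ∀ j < K, s.mem (i * K + j) = (π ⟨i, h⟩).code j) :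
    Run w countVotes s fun s' t =>
      (s'.reg 21 = (distinct (List.ofFn π)).length ∧
      HoldsRows s'.mem (n * K + 4 * L) (distinct (List.ofFn π)) ∧
      HoldsCounts s'.mem (n * K + 5 * L) (List.ofFn π) (distinct (List.ofFn π)) ∧
      t ≤ n * (46 * K + 12) + 1) ∧ ∀ r, r ∉ countVotes.writes → s'.reg r = s.reg r := by
  refine Run.frame ?_
  obtain ⟨v, hv⟩ : ∃ v, v = List.ofFn π := ⟨_, rfl⟩
  have hvlen : v.length = n := by simp [hv]
  rw [← hv]
  have hnX : n ≤ n * K := Nat.le_mul_of_pos_right _ hK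
  refine (Run.loop (N := n) (B := 46 * K + 11) (I := fun k s' => s'.reg 40 = k ∧
    s'.reg 22 = k * K ∧ s'.reg 16 = n * K ∧ Interner L k (distinct (v.take k)) s' ∧
    s'.reg 33 = n * K + 4 * L + (distinct (v.take k)).length * K ∧
    HoldsRows s'.mem (n * K + 4 * L) (distinct (v.take k)) ∧
    HoldsCounts s'.mem (n * K + 5 * L) (v.take k) (distinct (v.take k)) ∧
    ∀ a < n * K, s'.mem a = s.mem a) ?_ ?_ ?_).mono ?_
  · refine ⟨h40, by simp [h22], h16, by simpa [distinct] using hi, by simp [distinct, h33],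
      fun i hi => ?_, fun p hp => ?_, fun _ _ => rfl⟩
    · simp [distinct] at hi
    · simp [distinct] at hp
  · rintro k hk s' ⟨g40, g22, g16, gI, g33, gR, gC, gm⟩ hf
    have f0 := (hf 0 (by decide)).trans h0
    have f1 := (hf 1 (by decide)).trans h1
    have f14 := (hf 14 (by decide)).trans h14
    have f15 := (hf 15 (by decide)).trans h15
    have f32 := (hf 32 (by decide)).trans h32
    have hrow := row_le (K := K) hk
    have htake : v.take (k + 1) = v.take k ++ [π ⟨k, hk⟩] := by
      rw [← List.take_concat_get' v k (by omega)]
      simp [hv]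
    have hcnt : (distinct (v.take k)).length ≤ k :=
      (length_distinct_le _).trans (by simp)
    have g21 := gI.reg21
    refine ⟨by simp [g40, f1, hk], ?_⟩
    simp only [run_seq, run_add]
    refine ⟨by omega, ?_⟩
    refine (intern_spec (q := π ⟨k, hk⟩) (L := L) (u := k) (ps := distinct (v.take k)) hK
      (by simp [f0]) (by simp [f14]) (by simp [f15])
      (gI.congr (hfit.mono hk.le) hK (fun r _ _ => ?_) fun a _ _ => by simp) (hfit.mono hk)
      (by simp [g16]; omega) (fun j hj => ?_) (by simp [g22]; omega)
      (by simp [g22, g16]; omega)).mono ?_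
    · rw [reg_setReg, if_neg (by omega)]
    · simp only [reg_setReg, mem_setReg]
      rw [if_neg (by decide), g22, gm _ (by omega), hπ k hk j hj]
    rintro s₁ t₁ ⟨⟨v₁, i₁, m₁, ht₁⟩, e₁⟩
    simp only [reg_setReg, mem_setReg, if_neg (show (16 : ℕ) ≠ 41 by decide), g16] at m₁
    have e0 := e₁ 0 (by decide)
    have e14 := e₁ 14 (by decide)
    have e15 := e₁ 15 (by decide)
    have e16 := e₁ 16 (by decide)
    have e22 := e₁ 22 (by decide)
    have e32 := e₁ 32 (by decide)
    have e33 := e₁ 33 (by decide)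
    have e40 := e₁ 40 (by decide)
    have e41 := e₁ 41 (by decide)
    simp [f0, f14, f15, f32, g16, g22, g33, g40, g21] at e0 e14 e15 e16 e22 e32 e33 e40 e41
    refine (recordProg_spec (K := K) (N := n) (a := k * K) (R := n * K + 4 * L)
      (Q := n * K + 5 * L) (v := v.take k) (l := distinct (v.take k)) (q := π ⟨k, hk⟩)
      e0 e15 e22 v₁ e32 e33 e41 (fun p => mem_distinct) (by omega) (by omega) (by omega)
      (by omega) ?_ (fun j hj => ?_) (fun i hi j hj => ?_) fun p hp => ?_).mono ?_
    · have : (v.take k).length ≤ k := by simp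
      omega
    · rw [m₁ _ (by omega), gm _ (by omega), hπ k hk j hj]
    · rw [m₁ _ (by omega), gR i hi j hj]
    · rw [m₁ _ (by omega), gC p hp]
    rintro s₂ t₂ ⟨⟨v₂, r₂, c₂, m₂, ht₂⟩, d₂⟩
    have d0 := (d₂ 0 (by decide)).trans e0
    have d15 := (d₂ 15 (by decide)).trans e15
    have d16 := (d₂ 16 (by decide)).trans e16
    have d22 := (d₂ 22 (by decide)).trans e22
    have d40 := (d₂ 40 (by decide)).trans e40
    rw [htake, distinct_append]
    simp [d0, d15, d16, d22, d40]
    refine ⟨by omega, by omega, ⟨by ring, ?_, v₂, r₂, c₂, fun a ha => ?_⟩, by omega⟩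
    · refine i₁.congr (hfit.mono hk) hK (fun r h1 h2 => ?_) fun a h1 h2 => ?_
      · simp only [reg_setReg]
        rw [if_neg (by omega), if_neg (by omega)]
        refine d₂ r ?_
        simp only [recordProg, copyRow, Cmd.writes, List.cons_append, List.nil_append,
          List.mem_cons, List.not_mem_nil, or_false]
        omega
      · simp only [mem_setReg]
        exact m₂ a (by omega)
    · rw [m₂ a (by omega), m₁ a (by omega), gm a ha]
  · rintro s' ⟨g40, -⟩ hf
    have f1 := (hf 1 (by decide)).trans h1
    simp [f1, g40]
  · rintro s' t ⟨⟨⟨-, -, -, gI, -, gR, gC, -⟩, -⟩, ht⟩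
    rw [← hvlen, List.take_length] at gI gR gC
    rw [hvlen] at gR gC
    exact ⟨gI.reg21, gR, gC, ht⟩

/-- With blocks of `4 (n K)²` cells, the input is followed by four blocks for the trie, one for the
distinct rows and one for the counts; hence the offsets `16`, `20` and `24`. -/
theorem tabulate_spec {w K n : ℕ} {s : RamState} {π : Profile K n} (hK : 0 < K) (hn : 0 < n)
    (hs : IsInput π s) (hw : n * K + 24 * ((n * K) * (n * K)) < 2 ^ w) :
    Run w tabulate s fun s' t =>
      (s'.reg 1 = (distinct (List.ofFn π)).length ∧
      s'.reg 2 = n * K + 16 * ((n * K) * (n * K)) ∧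
      s'.reg 3 = n * K + 20 * ((n * K) * (n * K)) ∧
      s'.reg 4 = n * K + 24 * ((n * K) * (n * K)) ∧
      s'.reg 14 = 0 ∧ s'.reg 15 = 1 ∧
      HoldsRows s'.mem (s'.reg 2) (distinct (List.ofFn π)) ∧
      HoldsCounts s'.mem (s'.reg 3) (List.ofFn π) (distinct (List.ofFn π)) ∧
      t ≤ 100 * (n * K)) ∧ ∀ r, r ∉ tabulate.writes → s'.reg r = s.reg r := by
  obtain ⟨L, hL⟩ : ∃ L, L = (n * K) * (n * K) * 4 := ⟨_, rfl⟩
  refine Run.frame ?_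
  have hpos : 0 < n * K := Nat.mul_pos hn hK
  have hnX : n ≤ n * K := Nat.le_mul_of_pos_right _ hK
  have hKX : K ≤ n * K := Nat.le_mul_of_pos_left _ hn
  have hXX : n * K ≤ (n * K) * (n * K) := Nat.le_mul_of_pos_left _ hpos
  have hw0 : w ≠ 0 := by
    rintro rfl
    omega
  have h0 := hs.alternatives
  have h1 := hs.voters
  have hfit : Fits K L n := by
    refine (Nat.mul_le_mul (show n * K + 1 ≤ 2 * (n * K) by omega) hKX).trans ?_
    rw [hL, Nat.mul_assoc]
    omega
  rw [tabulate, run_seq]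
  refine Run.mono (Q := fun s' t => (s'.reg 0 = K ∧ s'.reg 1 = n ∧ s'.reg 4 = n * K + 6 * L ∧
    s'.reg 14 = 0 ∧ s'.reg 15 = 1 ∧ s'.reg 16 = n * K ∧ s'.reg 31 = n * K + 4 * L ∧
    s'.reg 32 = n * K + 5 * L ∧ s'.reg 33 = n * K + 4 * L ∧ s'.reg 22 = 0 ∧ s'.reg 40 = 0) ∧
    Interner (K := K) L 0 [] s' ∧ s'.mem = s.mem ∧ t ≤ 17) ?_ ?_
  · simp [tabulateSetup, h0, h1, ← hL]
    refine ⟨hw0, by omega, by omega, by omega, by omega, by omega, by omega, by omega, by omega,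
      by omega, by omega, by omega, by omega, ?_⟩
    apply Interner.nil <;> simp <;> omega
  · rintro s₁ t₁ ⟨⟨g0, g1, g4, g14, g15, g16, g31, g32, g33, g22, g40⟩, gI, gm, gt⟩
    rw [run_seq]
    refine (countVotes_spec (π := π) hK g0 g1 g14 g15 g16 g31 g32 g33 g22 g40 gI hfit
      (by omega) (by omega) (fun i hi j hj => ?_)).mono ?_
    · rw [gm]
      exact holdsPref_iff.1 (hs.prefs ⟨i, hi⟩) j hj
    rintro s₂ t₂ ⟨⟨v21, vR, vC, ht⟩, f₂⟩
    have f4 := (f₂ 4 (by decide)).trans g4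
    have f14 := (f₂ 14 (by decide)).trans g14
    have f15 := (f₂ 15 (by decide)).trans g15
    have f31 := (f₂ 31 (by decide)).trans g31
    have f32 := (f₂ 32 (by decide)).trans g32
    have hlen : (distinct (List.ofFn π)).length ≤ n := by
      simpa using length_distinct_le (List.ofFn π)
    simp [f4, f14, f15, f31, f32, v21]
    have e : n * (46 * K + 12) = 46 * (n * K) + 12 * n := by ring
    refine ⟨by omega, by omega, by omega, by omega, by omega, by omega, vR, vC, by omega⟩

end

noncomputable section

open scoped Classical
open Preference

/-! ### The order by descending frequency -/

/-- Exchange the `K` cells from the addresses in the registers `33` and `34` on. -/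
def swapRows : Cmd :=
  .seq (.const 43 0) <| .loop (.lt 43 0) <|
    .seq (.op .add 41 33 43) <| .seq (.op .add 42 34 43) <|
    .seq (.load 44 41) <| .seq (.load 45 42) <|
    .seq (.store 41 45) <| .seq (.store 42 44) <| .op .add 43 43 15

theorem swapRows_spec {w K a b : ℕ} {s : RamState} (h0 : s.reg 0 = K) (h15 : s.reg 15 = 1)
    (h33 : s.reg 33 = a) (h34 : s.reg 34 = b) (hab : a + K ≤ b) (hb : b + K < 2 ^ w) :
    Run w swapRows s fun s' t =>
      ((∀ j < K, s'.mem (a + j) = s.mem (b + j)) ∧ (∀ j < K, s'.mem (b + j) = s.mem (a + j)) ∧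
      (∀ x, (x < a ∨ a + K ≤ x) → (x < b ∨ b + K ≤ x) → s'.mem x = s.mem x) ∧
      t ≤ 8 * K + 2) ∧ ∀ r, r ∉ swapRows.writes → s'.reg r = s.reg r := by
  refine Run.frame ?_
  simp only [swapRows, run_seq, run_const]
  refine ⟨by positivity, ?_⟩
  refine (Run.loop (N := K) (B := 7) (I := fun k s' => s'.reg 43 = k ∧
    (∀ j < k, s'.mem (a + j) = s.mem (b + j)) ∧ (∀ j < k, s'.mem (b + j) = s.mem (a + j)) ∧
    ∀ x, (x < a ∨ a + k ≤ x) → (x < b ∨ b + k ≤ x) → s'.mem x = s.mem x) ?_ ?_ ?_).mono ?_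
  · simp
  · rintro k hk s' ⟨h43, hra, hrb, hm⟩ hf
    have f0 := hf 0 (by decide)
    have f15 := hf 15 (by decide)
    have f33 := hf 33 (by decide)
    have f34 := hf 34 (by decide)
    simp [h0, h15, h33, h34] at f0 f15 f33 f34
    have e1 : s'.mem (a + k) = s.mem (a + k) := hm _ (by omega) (by omega)
    have e2 : s'.mem (b + k) = s.mem (b + k) := hm _ (by omega) (by omega)
    simp [f0, f15, f33, f34, h43, e1, e2]
    refine ⟨hk, by omega, by omega, by omega, fun j hj => ?_, fun j hj => ?_, fun x hx hx' => ?_⟩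
    · rw [if_neg (by omega)]
      split_ifs with h
      · rw [h]
      · exact hra j (by omega)
    · split_ifs with h h'
      · rw [h]
      · omega
      · exact hrb j (by omega)
    · rw [if_neg (by omega), if_neg (by omega), hm x (by omega) (by omega)]
  · rintro s' ⟨h43, -⟩ hf
    have f0 := hf 0 (by decide)
    simp [h0] at f0
    simp [f0, h43]
  · rintro s' t ⟨⟨⟨-, hra, hrb, hm⟩, -⟩, ht⟩
    exact ⟨hra, hrb, hm, by omega⟩

/-- The memory holds the preferences `f 0`, …, `f (m - 1)` and their values under `g`. -/
structure IsTable {K : ℕ} (mem : ℕ → ℕ) (R Q m : ℕ) (g : Preference K → ℕ)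
    (f : ℕ → Preference K) : Prop where
  rows : ∀ i < m, ∀ j < K, mem (R + i * K + j) = (f i).code j
  vals : ∀ i < m, mem (Q + i) = g (f i)

/-- `f 0`, …, `f (m - 1)` are the distinct elements of `S`. -/
def Enumerates {α : Type*} (f : ℕ → α) (m : ℕ) (S : Set α) : Prop :=
  (∀ i < m, ∀ j < m, f i = f j → i = j) ∧ ∀ p, p ∈ S ↔ ∃ i < m, f i = p

/-- Exchange two values of a function. -/
def exchangeAt {α : Type*} (f : ℕ → α) (a b i : ℕ) : α :=
  if i = a then f b else if i = b then f a else f i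

theorem Enumerates.exchange {α : Type*} {f : ℕ → α} {m a b : ℕ} {S : Set α} (h : Enumerates f m S)
    (ha : a < m) (hb : b < m) : Enumerates (exchangeAt f a b) m S := by
  obtain ⟨h1, h2⟩ := h
  refine ⟨fun i hi j hj he => ?_, fun p => ?_⟩
  · have := h1 i hi j hj
    have := h1 i hi a ha
    have := h1 i hi b hb
    have := h1 a ha j hj
    have := h1 b hb j hj
    have := h1 a ha b hb
    unfold exchangeAt at he
    grind
  · rw [h2]
    constructor
    · rintro ⟨i, hi, rfl⟩
      by_cases hia : i = a
      · exact ⟨b, hb, by unfold exchangeAt; grind⟩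
      · by_cases hib : i = b
        · exact ⟨a, ha, by unfold exchangeAt; grind⟩
        · exact ⟨i, hi, by unfold exchangeAt; grind⟩
    · rintro ⟨i, hi, rfl⟩
      unfold exchangeAt
      split_ifs
      exacts [⟨b, hb, rfl⟩, ⟨a, ha, rfl⟩, ⟨i, hi, rfl⟩]

/-- The first `a` values dominate all later ones, and value number `a` dominates those before
number `b`. -/
def SortedTo (x : ℕ → ℕ) (m a b : ℕ) : Prop :=
  (∀ i < a, ∀ j, i < j → j < m → x j ≤ x i) ∧ ∀ j, a < j → j < b → x j ≤ x a

/-- Compare the frequencies at the addresses in the registers `35` and `36`, and exchange the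
entries of the table if they are in the wrong order. -/
def compareRows : Cmd :=
  .seq (.load 44 35) <| .seq (.load 45 36) <|
  .ite (.lt 44 45) (.seq (.store 35 45) <| .seq (.store 36 44) swapRows) .skip

theorem compareRows_spec {w K R Q m a b : ℕ} {s : RamState} {g : Preference K → ℕ}
    {f : ℕ → Preference K} {S : Set (Preference K)} (h0 : s.reg 0 = K) (h15 : s.reg 15 = 1)
    (h33 : s.reg 33 = R + a * K) (h34 : s.reg 34 = R + b * K) (h35 : s.reg 35 = Q + a)
    (h36 : s.reg 36 = Q + b) (hab : a < b) (hb : b < m) (hRQ : R + m * K ≤ Q)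
    (hQw : Q + m < 2 ^ w) (ht : IsTable s.mem R Q m g f) (hS : Enumerates f m S)
    (ho : SortedTo (fun i => g (f i)) m a b) :
    Run w compareRows s fun s' t =>
      (∃ f', IsTable s'.mem R Q m g f' ∧ Enumerates f' m S ∧
        SortedTo (fun i => g (f' i)) m a (b + 1)) ∧ t ≤ 8 * K + 7 := by
  have hfa := ht.vals a (by omega)
  have hfb := ht.vals b hb
  have hra := row_le (K := K) hab
  have hrb := row_le (K := K) hb
  simp only [compareRows, run_seq, run_load, run_ite, holds_lt]
  simp only [reg_setReg, mem_setReg, h35, h36, hfa]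
  simp [hfb]
  constructor
  · intro hlt
    refine (swapRows_spec (K := K) (a := R + a * K) (b := R + b * K) (by simp [h0]) (by simp [h15])
      (by simp [h33]) (by simp [h34]) (by omega) (by omega)).mono ?_
    rintro s' t ⟨⟨g1, g2, g3, gt⟩, -⟩
    simp [h35, h36] at g1 g2 g3
    refine ⟨⟨exchangeAt f a b, ⟨fun i hi j hj => ?_, fun i hi => ?_⟩,
      hS.exchange (hab.trans hb) hb, ?_⟩, by omega⟩
    · have hri := row_le (K := K) hi
      unfold exchangeAt
      split_ifs with h h'
      · subst h
        rw [g1 j hj, if_neg (by omega), if_neg (by omega), ht.rows b hb j hj]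
      · subst h'
        rw [g2 j hj, if_neg (by omega), if_neg (by omega), ht.rows a (by omega) j hj]
      -- Different rows occupy disjoint stretches of `K` cells, so the exchange leaves row `i`
      -- intact.
      · have h1 : i * K + K ≤ a * K ∨ a * K + K ≤ i * K := by
          rcases Nat.lt_or_gt_of_ne h with h | h
          · exact Or.inl (row_le h)
          · exact Or.inr (row_le h)
        have h2 : i * K + K ≤ b * K ∨ b * K + K ≤ i * K := by
          rcases Nat.lt_or_gt_of_ne h' with h | h
          · exact Or.inl (row_le h)
          · exact Or.inr (row_le h)
        rw [g3 _ (by omega) (by omega), if_neg (by omega), if_neg (by omega), ht.rows i hi j hj]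
    · rw [g3 _ (by omega) (by omega)]
      unfold exchangeAt
      by_cases h' : i = b
      · subst h'
        simp [show i ≠ a by omega]
      · by_cases h : i = a
        · subst h
          simp [show i ≠ b by omega]
        · simp [h, h', ht.vals i hi]
    · obtain ⟨o1, o2⟩ := ho
      refine ⟨fun i hi j hij hj => ?_, fun j hj hj' => ?_⟩
      · have := o1 i hi j hij hj
        have := o1 i hi a hi (by omega)
        have := o1 i hi b (by omega) hb
        simp only [exchangeAt]
        rw [if_neg (by omega : i ≠ a), if_neg (by omega : i ≠ b)]
        split_ifs <;> assumption
      · simp only [exchangeAt, if_true]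
        rw [if_neg (by omega : j ≠ a)]
        split_ifs with h
        · exact hlt.le
        · exact (o2 j hj (by omega)).trans hlt.le
  · intro hle
    refine ⟨f, ht, hS, ho.1, fun j hj hj' => ?_⟩
    rcases Nat.lt_succ_iff_lt_or_eq.1 hj' with h | rfl
    · exact ho.2 j hj h
    · exact hle

/-- The ordering program. -/
def order : Cmd :=
  .seq (.const 39 0) <| .seq (.op .add 33 2 14) <| .seq (.op .add 35 3 14) <|
  .loop (.lt 39 1) <|
    .seq (.op .add 40 39 15) <| .seq (.op .add 34 33 0) <| .seq (.op .add 36 35 15) <|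
    .seq (.loop (.lt 40 1) <|
      .seq compareRows <| .seq (.op .add 34 34 0) <| .seq (.op .add 36 36 15) <|
        .op .add 40 40 15) <|
    .seq (.op .add 33 33 0) <| .seq (.op .add 35 35 15) <| .op .add 39 39 15

/-- A quadratic exchange sort is good enough: the ordering shares the budget of order `m² K` with
the search, and an exchange moves two rows of `K` cells. -/
theorem order_spec {w K R Q m : ℕ} {s : RamState} {g : Preference K → ℕ}
    {f : ℕ → Preference K} {S : Set (Preference K)} (hK : 0 < K) (hm : 0 < m) (h0 : s.reg 0 = K)
    (h1 : s.reg 1 = m) (h2 : s.reg 2 = R) (h3 : s.reg 3 = Q) (h14 : s.reg 14 = 0)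
    (h15 : s.reg 15 = 1) (hRQ : R + m * K ≤ Q) (hQw : Q + m < 2 ^ w)
    (ht : IsTable s.mem R Q m g f) (hS : Enumerates f m S) :
    Run w order s fun s' t =>
      ((∃ f', IsTable s'.mem R Q m g f' ∧ Enumerates f' m S ∧
        ∀ i j, i < j → j < m → g (f' j) ≤ g (f' i)) ∧ t ≤ 40 * (m * m * K)) ∧
      ∀ r, r ∉ order.writes → s'.reg r = s.reg r := by
  refine Run.frame ?_
  have hmX : m ≤ m * K := Nat.le_mul_of_pos_right _ hK
  have hw0 : 0 < 2 ^ w := by positivity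
  simp only [order, run_seq, run_const, run_add]
  refine ⟨hw0, ?_⟩
  refine ⟨by simp [h2, h14]; omega, by simp [h3, h14]; omega, ?_⟩
  refine (Run.loop (N := m) (B := m * (8 * K + 11) + 7) (I := fun a s' => s'.reg 39 = a ∧
    s'.reg 33 = R + a * K ∧ s'.reg 35 = Q + a ∧ ∃ f', IsTable s'.mem R Q m g f' ∧
    Enumerates f' m S ∧ SortedTo (fun i => g (f' i)) m a (a + 1)) ?_ ?_ ?_).mono ?_
  · refine ⟨by simp, by simp [h2, h14], by simp [h3, h14], f, ht, hS, ?_, fun j _ _ => by omega⟩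
    simp
  · rintro a ha s' ⟨g39, g33, g35, hI⟩ hf
    have f0 := hf 0 (by decide)
    have f1 := hf 1 (by decide)
    have f15 := hf 15 (by decide)
    simp [h0, h1, h15] at f0 f1 f15
    have hra := row_le (K := K) ha
    refine ⟨by simp [g39, f1, ha], ?_⟩
    simp only [run_seq, run_add]
    refine ⟨by omega, by simp [g33, f0]; omega, by simp [g35, f15]; omega, ?_⟩
    refine (Run.loop (N := m - (a + 1)) (B := 8 * K + 10) (I := fun k s₁ =>
      s₁.reg 40 = a + 1 + k ∧ s₁.reg 34 = R + (a + 1 + k) * K ∧ s₁.reg 36 = Q + (a + 1 + k) ∧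
      ∃ f', IsTable s₁.mem R Q m g f' ∧ Enumerates f' m S ∧
        SortedTo (fun i => g (f' i)) m a (a + 1 + k)) ?_ ?_ ?_).mono ?_
    · refine ⟨by simp [g39, f15], ?_, by simp [g35, f15]; omega, hI⟩
      simp [g33, f0]
      ring
    · rintro k hk s₁ ⟨e40, e34, e36, f', e1, e2, e3⟩ he
      have d0 := he 0 (by decide)
      have d1 := he 1 (by decide)
      have d15 := he 15 (by decide)
      have d33 := he 33 (by decide)
      have d35 := he 35 (by decide)
      simp [f0, f1, f15, g33, g35] at d0 d1 d15 d33 d35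
      have hrb := row_le (K := K) (show a + 1 + k < m by omega)
      refine ⟨by simp [e40, d1]; omega, ?_⟩
      simp only [run_seq, run_add]
      refine (compareRows_spec d0 d15 d33 e34 d35 e36 (by omega) (by omega) hRQ hQw e1 e2
        e3).frame.mono ?_
      rintro s₂ t ⟨⟨hf', ht'⟩, hb⟩
      have b0 := (hb 0 (by decide)).trans d0
      have b15 := (hb 15 (by decide)).trans d15
      have b34 := (hb 34 (by decide)).trans e34
      have b36 := (hb 36 (by decide)).trans e36
      have b40 := (hb 40 (by decide)).trans e40
      simp [b0, b15, b34, b36, b40]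
      refine ⟨by omega, by omega, by omega, ⟨by omega, by ring, by omega, hf'⟩, by omega⟩
    · rintro s₁ ⟨e40, -⟩ he
      have d1 := he 1 (by decide)
      simp [f1] at d1
      simp [d1, e40]
      omega
    · rintro s₁ t ⟨⟨⟨e40, e34, e36, f', e1, e2, e3⟩, he⟩, ht⟩
      have d0 := he 0 (by decide)
      have d15 := he 15 (by decide)
      have d33 := he 33 (by decide)
      have d35 := he 35 (by decide)
      have d39 := he 39 (by decide)
      simp [f0, f15, g33, g35, g39] at d0 d15 d33 d35 d39
      simp [d0, d15, d33, d35, d39]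
      have ht' : (m - (a + 1)) * (8 * K + 11) ≤ m * (8 * K + 11) :=
        Nat.mul_le_mul_right _ (by omega)
      have ht2 : (m - (a + 1)) * (8 * K + 10 + 1) = (m - (a + 1)) * (8 * K + 11) := rfl
      rw [ht2] at ht
      refine ⟨by omega, by omega, by omega, ⟨by ring, by omega, f', e1, e2, ?_, ?_⟩, by omega⟩
      · intro i hi j hij hj
        rcases Nat.lt_succ_iff_lt_or_eq.1 hi with h | rfl
        · exact e3.1 i h j hij hj
        · exact e3.2 j hij (by omega)
      · intro j _ _
        omega
  · rintro s' ⟨g39, -⟩ hf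
    have f1 := hf 1 (by decide)
    simp [h1] at f1
    simp [f1, g39]
  · rintro s' t ⟨⟨⟨-, -, -, f', e1, e2, e3⟩, -⟩, ht⟩
    refine ⟨⟨f', e1, e2, fun i j hij hj => e3.1 i (by omega) j hij hj⟩, ?_⟩
    have e : m * (m * (8 * K + 11) + 7 + 1) = 8 * (m * m * K) + 11 * (m * m) + 8 * m := by ring
    have hmm : m * m ≤ m * m * K := Nat.le_mul_of_pos_right _ hK
    have hm2 : m ≤ m * m := Nat.le_mul_of_pos_left _ hm
    omega

end

noncomputable section

open scoped Classical
open Preference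

/-! ### The search through the candidates -/

theorem RamState.IsWord.setReg {w r v : ℕ} {s : RamState} (hs : s.IsWord w) (hv : v < 2 ^ w) :
    (s.setReg r v).IsWord w := by
  refine ⟨fun x => ?_, hs.2⟩
  rw [reg_setReg]
  split_ifs
  exacts [hv, hs.1 x]

theorem Exec.isWord {w : ℕ} {c : Cmd} {s s' : RamState} {t : ℕ} (h : Exec w c s s' t)
    (hs : s.IsWord w) : s'.IsWord w := by
  have hpos : 0 < 2 ^ w := by positivity
  induction h with
  | skip => exact hs
  | const => exact hs.setReg (Nat.mod_lt _ hpos)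
  | op o r a b s =>
    refine hs.setReg ?_
    cases o <;> exact Nat.mod_lt _ hpos
  | load r a s => exact hs.setReg (hs.2 _)
  | store a r s =>
    refine ⟨hs.1, fun x => ?_⟩
    rw [mem_setMem]
    split_ifs
    exacts [hs.1 r, hs.2 x]
  | seq _ _ h₁ h₂ => exact h₂ (h₁ hs)
  | iteTrue _ _ h => exact h hs
  | iteFalse _ _ h => exact h hs
  | loopDone => exact hs
  | loopStep _ _ _ h₁ h₂ => exact h₂ (h₁ hs)

theorem Run.isWord {w : ℕ} {c : Cmd} {s : RamState} {Q : RamState → ℕ → Prop}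
    (h : Run w c s Q) (hs : s.IsWord w) : Run w c s fun s' t => s'.IsWord w ∧ Q s' t := by
  obtain ⟨s', t, h, hq⟩ := h
  exact ⟨s', t, h, h.exec.isWord hs, hq⟩

/-- Loops whose number of iterations is only bounded. -/
theorem Run.loop_le {w : ℕ} {b : RegTest} {c : Cmd} {s : RamState} (N B : ℕ)
    (I : ℕ → RamState → Prop) (h0 : I N s)
    (hstep : ∀ k s', I k s' → (∀ r, r ∉ c.writes → s'.reg r = s.reg r) → b.Holds s' →
      Run w c s' fun s'' t => (∃ k' < k, I k' s'') ∧ t ≤ B) :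
    Run w (.loop b c) s fun s' t => ((∃ k, I k s' ∧ ¬ b.Holds s') ∧
      ∀ r, r ∉ c.writes → s'.reg r = s.reg r) ∧ t ≤ N * (B + 1) + 1 := by
  have key : ∀ k s', I k s' → (∀ r, r ∉ c.writes → s'.reg r = s.reg r) →
      Run w (.loop b c) s' fun s' t => ((∃ k, I k s' ∧ ¬ b.Holds s') ∧
        ∀ r, r ∉ c.writes → s'.reg r = s.reg r) ∧ t ≤ k * (B + 1) + 1 := by
    intro k
    induction k using Nat.strong_induction_on with
    | _ k ih =>
      intro s' hI hf
      by_cases hb : b.Holds s'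
      · obtain ⟨s'', t, he, ⟨k', hk, hI'⟩, ht⟩ := hstep k s' hI hf hb
        obtain ⟨s₃, t₃, he₃, h₃, ht₃⟩ := ih k' hk s'' hI'
          fun r hr => (he.reg_eq r hr).trans (hf r hr)
        have := Nat.mul_le_mul_right (B + 1) (Nat.succ_le_of_lt hk)
        rw [Nat.succ_mul] at this
        exact ⟨s₃, _, .loopStep hb he he₃, h₃, by omega⟩
      · exact ⟨s', 1, .loopDone hb, ⟨⟨k, hI, hb⟩, hf⟩, by omega⟩
  exact key N s h0 fun _ _ => rfl

/-- The search loop interleaves `takeWhile` with `find?`. Its invariant says that all rows before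
`i` have maximal frequency and failed the check; from this, the answer is read off at a success
here, and at exhaustion in the companion lemma. -/
theorem find?_takeWhile_eq_some {α : Type*} {p c : α → Bool} :
    ∀ {l : List α} {i : ℕ} (hi : i < l.length),
      (∀ (j : ℕ) (h : j < l.length), j < i → p l[j] ∧ ¬ c l[j]) → p l[i] → c l[i] →
      (l.takeWhile p).find? c = some l[i]
  | a :: l, 0, _, _, hp, hc => by simp_all
  | a :: l, i + 1, hi, h, hp, hc => by
    have h0 := h 0 (by simp) (by omega)
    have ih := find?_takeWhile_eq_some (l := l) (i := i) (by simpa using hi)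
      (fun j hj hji => h (j + 1) (Nat.succ_lt_succ hj) (Nat.succ_lt_succ hji))
      (by simpa using hp) (by simpa using hc)
    simp_all

theorem find?_takeWhile_eq_none {α : Type*} {p c : α → Bool} :
    ∀ {l : List α} {i : ℕ},
      (∀ (j : ℕ) (h : j < l.length), j < i → p l[j] ∧ ¬ c l[j]) →
      (∀ h : i < l.length, ¬ p l[i]) → (l.takeWhile p).find? c = none
  | [], _, _, _ => by simp
  | a :: l, 0, _, hp => by
    have := hp (by simp)
    simp_all
  | a :: l, i + 1, h, hp => by
    have h0 := h 0 (by simp) (by omega)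
    have ih := find?_takeWhile_eq_none (l := l) (i := i) (p := p) (c := c)
      (fun j hj hji => h (j + 1) (Nat.succ_lt_succ hj) (Nat.succ_lt_succ hji))
      (fun hi => hp (Nat.succ_lt_succ hi))
    simp_all

theorem HoldsTable.congr {K n : ℕ} {π : Profile K n} {l : List (Preference K)}
    {s s' : RamState} (h : HoldsTable π l s) (hr : ∀ r < 5, s'.reg r = s.reg r)
    (hm : ∀ a < s.reg 4, s'.mem a = s.mem a) : HoldsTable π l s' := by
  have hp := h.prefs_le
  have hq := h.freqs_le
  refine ⟨(hr 0 (by omega)).trans h.alternatives, (hr 1 (by omega)).trans h.rows,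
    fun i hi => ?_, fun i hi => ?_, ?_, ?_⟩
  · have := row_le (K := K) hi
    rw [hr 2 (by omega), holdsPref_iff]
    intro j hj
    rw [hm _ (by omega), h.holdsRows i hi j hj]
  · rw [hr 3 (by omega), hm _ (by omega), h.freqs i hi]
  · rw [hr 2 (by omega), hr 4 (by omega)]
    exact hp
  · rw [hr 3 (by omega), hr 4 (by omega)]
    exact hq

theorem notMem_writes_checkProg {r : ℕ} (h : r < 13) : r ∉ checkProg.writes := by
  interval_cases r <;> decide

theorem searchProg_spec {w K n : ℕ} {s : RamState} {π : Profile K n} {l : List (Preference K)}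
    {ord : Preference K → List (Preference K)} (hK : 3 ≤ K) (hn : 0 < n) (hl : IsFreqOrder π l)
    (ho : ∀ p₀, IsFreqDistOrder π p₀ (ord p₀)) (hW : s.IsWord w) (ht : HoldsTable π l s)
    (hw : s.reg 4 + 44 * ((l.length * K) * (l.length * K)) ≤ 2 ^ w) :
    Run w (searchProg checkProg) s fun s' t =>
      Reports s' (detectAlg π l ord) ∧ t ≤ 320 * (l.length * l.length * K) := by
  obtain ⟨m, hm⟩ : ∃ m, l.length = m := ⟨_, rfl⟩
  have hmpos : 0 < m := hm ▸ hl.1.length_pos hn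
  have hmX : m ≤ m * K := Nat.le_mul_of_pos_right _ (by omega)
  have hXX : 3 * (m * K) ≤ (m * K) * (m * K) :=
    Nat.mul_le_mul_right _ (by have := Nat.mul_le_mul hmpos hK; omega)
  have hple := ht.prefs_le
  have hfle := ht.freqs_le
  have hr1 := ht.rows
  have hr0 := ht.alternatives
  have hf0 := ht.freqs 0 (by omega)
  rw [hm] at hw hple hfle hr1 ⊢
  have hw0 : w ≠ 0 := by
    rintro rfl
    omega
  obtain ⟨M, hM⟩ : ∃ M, (l.map fun p => freq π p).headD 0 = M := ⟨_, rfl⟩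
  have hl0 : freq π (l[0]'(by omega)) = M := by
    rw [← hM]
    cases l with
    | nil => simp at hm; omega
    | cons => rfl
  rw [Nat.add_zero, hl0] at hf0
  have hsome : ∀ i (hi : i < l.length), (∀ (j : ℕ) (h : j < l.length), j < i →
      freq π l[j] = M ∧ ¬ FlexibleConsensusAround π l[j]) → freq π l[i] = M →
      FlexibleConsensusAround π l[i] → detectAlg π l ord = some l[i] := by
    intro i hi h1 h2 h3
    unfold detectAlg
    simp only [hM]
    exact find?_takeWhile_eq_some hi (fun j hj hji => by
      simpa [← checkAlg_iff hn (ho l[j])] using h1 j hj hji) (by simpa using h2)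
      ((checkAlg_iff hn (ho _)).2 h3)
  have hnone : ∀ i, (∀ (j : ℕ) (h : j < l.length), j < i →
      freq π l[j] = M ∧ ¬ FlexibleConsensusAround π l[j]) →
      (∀ h : i < l.length, freq π l[i] ≠ M) → detectAlg π l ord = none := by
    intro i h1 h2
    unfold detectAlg
    simp only [hM]
    exact find?_takeWhile_eq_none (i := i) (fun j hj hji => by
      simpa [← checkAlg_iff hn (ho l[j])] using h1 j hj hji) (by simpa using h2)
  rw [searchProg]
  refine Run.mono (Q := fun s' t => Reports s' (detectAlg π l ord) ∧
    t ≤ m * (300 * (m * K) + 9) + 8) ?_ ?_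
  · simp [hw0]
    refine ⟨by omega, ?_⟩
    generalize hs₁ : RamState.setReg _ 8 1 = s₁
    have hW₁ : s₁.IsWord w := by
      have hp : 1 < 2 ^ w := Nat.one_lt_two_pow hw0
      rw [← hs₁]
      repeat apply RamState.IsWord.setReg
      all_goals first | exact hW | omega | exact hW.2 _
    have g2 : s₁.reg 2 = s.reg 2 := by simp [← hs₁]
    have g4 : s₁.reg 4 = s.reg 4 := by simp [← hs₁]
    have g5 : s₁.reg 5 = s.reg 2 := by simp [← hs₁]
    have g6 : s₁.reg 6 = 0 := by simp [← hs₁]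
    have g7 : s₁.reg 7 = M := by simp [← hs₁, hf0]
    have g8 : s₁.reg 8 = 1 := by simp [← hs₁]
    have g9 : s₁.reg 9 = 0 := by simp [← hs₁]
    have g11 : s₁.reg 11 = 1 := by simp [← hs₁]
    have ht₁ : HoldsTable π l s₁ := ht.congr
      (fun r hr => by
        simp only [← hs₁, reg_setReg]
        repeat rw [if_neg (by omega)])
      fun a _ => by simp [← hs₁]
    clear hs₁
    -- The counter `k` is the number of rows left. An iteration that clears the loop flag may jump
    -- to `0`, so early stopping respects the bound.
    refine (Run.loop_le (N := m) (B := 300 * (m * K) + 8) (I := fun k s' => s'.IsWord w ∧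
      HoldsTable π l s' ∧ s'.reg 4 = s.reg 4 ∧
      ((s'.reg 8 = 1 ∧ s'.reg 9 = 0 ∧ ∃ i, i + k = m ∧ s'.reg 6 = i ∧
        s'.reg 5 = s'.reg 2 + i * K ∧ (∀ (j : ℕ) (h : j < l.length), j < i →
          freq π l[j] = M ∧ ¬ FlexibleConsensusAround π l[j]) ∧
        ∃ h : i < l.length, freq π l[i] = M) ∨
      (s'.reg 8 = 0 ∧ Reports s' (detectAlg π l ord)))) ?_ ?_).mono ?_
    · refine ⟨hW₁, ht₁, g4, Or.inl ⟨g8, g9, 0, by omega, g6, by simp [g5, g2], ?_, by omega, hl0⟩⟩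
      intro j _ hj
      omega
    · rintro k s' ⟨hW', ht', e4, hI⟩ hf hb
      have e11 := (hf 11 (by decide)).trans g11
      have e7 := (hf 7 (by decide)).trans g7
      simp only [holds_eq, e11] at hb
      obtain ⟨e8, e9, i, hik, e6, e5, hprev, hil, hfi⟩ : _ ∧ _ :=
        hI.resolve_right fun h => by omega
      have e0 := ht'.alternatives
      have e1 := ht'.rows.trans hm
      have hrow := row_le (K := K) hil
      rw [hm] at hrow
      have ple := ht'.prefs_le
      have fle := ht'.freqs_le
      rw [hm] at ple fle
      have hpref := ht'.prefs i hil
      rw [← e5] at hpref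
      -- The check needs every cell to hold a word; this is carried along for arbitrary executions
      -- instead of being part of each specification.
      refine Run.mono (Run.isWord (Q := fun s'' t => (∃ k' < k, HoldsTable π l s'' ∧
        s''.reg 4 = s.reg 4 ∧
      ((s''.reg 8 = 1 ∧ s''.reg 9 = 0 ∧ ∃ i, i + k' = m ∧ s''.reg 6 = i ∧
        s''.reg 5 = s''.reg 2 + i * K ∧ (∀ (j : ℕ) (h : j < l.length), j < i →
          freq π l[j] = M ∧ ¬ FlexibleConsensusAround π l[j]) ∧
        ∃ h : i < l.length, freq π l[i] = M) ∨
      (s''.reg 8 = 0 ∧ Reports s'' (detectAlg π l ord)))) ∧ t ≤ 300 * (m * K) + 8) ?_ hW')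
        fun s'' t ⟨hw, ⟨k', hk', h⟩, ht⟩ => ⟨⟨k', hk', hw, h⟩, ht⟩
      rw [run_seq]
      refine (checkProg_spec (q := l[i]) hK hn hl hW'.2 ht' hpref (by omega)
        (by rw [e4, hm]; exact hw)).mono ?_
      rintro s₂ t ⟨⟨v13, low, hlt⟩, hf₂⟩
      have ht₂ : HoldsTable π l s₂ := ht'.congr
        (fun r hr => hf₂ r (notMem_writes_checkProg (by omega))) low
      have d0 := (hf₂ 0 (by decide)).trans e0
      have d1 := (hf₂ 1 (by decide)).trans e1
      have d2 := hf₂ 2 (by decide)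
      have d4 := (hf₂ 4 (by decide)).trans e4
      have d5 := (hf₂ 5 (by decide)).trans e5
      have d6 := (hf₂ 6 (by decide)).trans e6
      have d7 := (hf₂ 7 (by decide)).trans e7
      have d8 := (hf₂ 8 (by decide)).trans e8
      have d9 := (hf₂ 9 (by decide)).trans e9
      have d11 := (hf₂ 11 (by decide)).trans e11
      rw [hm] at hlt
      have hcongr : ∀ s₃ : RamState, (∀ r < 5, s₃.reg r = s₂.reg r) → s₃.mem = s₂.mem →
          HoldsTable π l s₃ := fun s₃ h h' => ht₂.congr h fun a _ => by rw [h']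
      by_cases hfc : FlexibleConsensusAround π l[i]
      · rw [if_pos hfc] at v13
        simp [v13, d11, hw0]
        refine ⟨⟨⟨0, by omega⟩, hcongr _ (fun r hr => ?_) rfl, d4, ?_⟩, by omega⟩
        · simp only [reg_setReg]
          rw [if_neg (by omega), if_neg (by omega)]
        · rw [hsome i hil hprev hfi hfc]
          refine ⟨by simp, ?_⟩
          have h5 : ((s₂.setReg 9 1).setReg 8 0).reg 5 = s'.reg 5 := by simp [d5, e5]
          rw [h5, e5]
          exact d2 ▸ ht₂.prefs i hil
      · rw [if_neg hfc] at v13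
        simp [v13, d0, d1, d5, d6, d7, d11, hw0]
        have hprev' : ∀ (j : ℕ) (h : j < l.length), j < i + 1 →
            freq π l[j] = M ∧ ¬ FlexibleConsensusAround π l[j] := by
          intro j hj hji
          rcases Nat.lt_succ_iff_lt_or_eq.1 hji with h | rfl
          exacts [hprev j hj h, ⟨hfi, hfc⟩]
        have hreg : ∀ (s₃ : RamState) (r v : ℕ), 5 ≤ r →
            (∀ x < 5, s₃.reg x = s₂.reg x) → ∀ x < 5, (s₃.setReg r v).reg x = s₂.reg x := by
          intro s₃ r v hr h x hx
          rw [reg_setReg, if_neg (by omega), h x hx]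
        have d3 := hf₂ 3 (by decide)
        refine ⟨by omega, by omega, fun hi' => ⟨by omega, fun hM' => ?_, fun hM' => ?_⟩,
          fun hi' => ?_⟩
        · refine ⟨⟨k - 1, by omega, hcongr _ ?_ rfl, d4, Or.inl ⟨d8, d9, by omega, ?_, ?_, ?_⟩⟩,
            by omega⟩
          · repeat refine hreg _ _ _ (by omega) ?_
            exact fun _ _ => rfl
          · rw [d2]
            ring
          · exact fun j hj hji => hprev' j hj (by omega)
          · exact ⟨by omega, by rw [← ht₂.freqs (i + 1) (by omega), hM']⟩
        · refine ⟨⟨⟨0, by omega⟩, hcongr _ ?_ rfl, d4, ?_⟩, by omega⟩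
          · repeat refine hreg _ _ _ (by omega) ?_
            exact fun _ _ => rfl
          · rw [hnone (i + 1) hprev' fun h => by rwa [← ht₂.freqs (i + 1) h]]
            simpa [Reports] using d9
        · refine ⟨⟨⟨0, by omega⟩, hcongr _ ?_ rfl, d4, ?_⟩, by omega⟩
          · repeat refine hreg _ _ _ (by omega) ?_
            exact fun _ _ => rfl
          · rw [hnone (i + 1) hprev' fun h => by omega]
            simpa [Reports] using d9
    · rintro s' t ⟨⟨⟨k, ⟨-, -, -, hI⟩, hb⟩, hf⟩, ht⟩
      simp only [holds_eq, (hf 11 (by decide)).trans g11] at hb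
      have e : m * (300 * (m * K) + 8 + 1) = m * (300 * (m * K) + 9) := rfl
      exact ⟨(hI.resolve_left fun h => hb h.1).2, by omega⟩
  · rintro s' t ⟨h, ht⟩
    refine ⟨h, ?_⟩
    have e : m * (300 * (m * K) + 9) = 300 * (m * m * K) + 9 * m := by ring
    have e2 : m ≤ m * m := Nat.le_mul_of_pos_left _ hmpos
    have e3 : 3 * (m * m) ≤ m * m * K := by
      rw [Nat.mul_comm]
      exact Nat.mul_le_mul_left _ hK
    omega

end

noncomputable section

open scoped Classical
open Preference

/-! ### Time bounds -/

/-- Here `K ≥ 3` enters through `e < 3`; it makes bounds linear in `K` sufficient. -/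
theorem one_le_sqrt_log {K : ℕ} (hK : 3 ≤ K) : 1 ≤ √(Real.log K) := by
  rw [Real.one_le_sqrt, Real.le_log_iff_exp_le (by positivity)]
  have h := Real.exp_one_lt_d9
  have hK : (3 : ℝ) ≤ K := by exact_mod_cast hK
  linarith

theorem le_checkTime {K : ℕ} (hK : 3 ≤ K) (m : ℕ) : (m * K : ℝ) ≤ checkTime m K := by
  have h1 := one_le_sqrt_log hK
  have h2 : (0 : ℝ) ≤ m * Real.log m := mul_nonneg (by positivity) (Real.log_natCast_nonneg m)
  have h3 : (m * K : ℝ) * 1 ≤ m * K * √(Real.log K) := by gcongr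
  unfold checkTime
  linarith

theorem le_detectTime {K : ℕ} (hK : 3 ≤ K) (m : ℕ) : (m * m * K : ℝ) ≤ detectTime m K := by
  have h1 := one_le_sqrt_log hK
  have h2 : (0 : ℝ) ≤ (m : ℝ) ^ 2 * Real.log m :=
    mul_nonneg (by positivity) (Real.log_natCast_nonneg m)
  have h3 : (m ^ 2 * K : ℝ) * 1 ≤ (m : ℝ) ^ 2 * K * √(Real.log K) := by gcongr
  unfold detectTime
  linarith

/-- The cells counted are `24 X²` after the input for the tabulation and `44 X²` for the check.
Since `69 < 81 = 3 ^ 4`, the sixth power covers them from `X = 3` on. -/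
theorem sq_le_pow_six {X : ℕ} (hX : 3 ≤ X) : X + 68 * (X * X) < X ^ 6 := by
  have h1 : 3 ^ 4 ≤ X ^ 4 := Nat.pow_le_pow_left hX 4
  have h2 : 3 * 3 ≤ X * X := Nat.mul_le_mul hX hX
  have h3 : X ≤ X * X := Nat.le_mul_of_pos_left _ (by omega)
  have h4 : X ^ 6 = X ^ 4 * (X * X) := by ring
  have h5 : 81 * (X * X) ≤ X ^ 4 * (X * X) := Nat.mul_le_mul_right _ h1
  omega

/-- The program decides Flexible Consensus itself, and by `checkAlg_iff` this is the verdict of the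
procedure on every admissible order, so any existing one serves as `l'`. The constant `500` leaves
room for the total of the detection program. -/
theorem isCheckProg_checkProg : IsCheckProg 6 500 checkProg := by
  intro K n w π l p₀ s hK hn hl hW ht hq h5 hw
  have hpos := hl.1.length_pos hn
  have hX : 3 ≤ l.length * K := hK.trans (Nat.le_mul_of_pos_left _ hpos)
  have := sq_le_pow_six hX
  obtain ⟨s', t, he, ⟨hv, hm, ht'⟩, hf⟩ :=
    checkProg_spec hK hn hl hW.2 ht hq h5 (by omega)
  obtain ⟨l', hl'⟩ := exists_isFreqDistOrder hl.1 p₀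
  refine ⟨s', t, he.exec, ?_, hm, fun r hr => hf r (notMem_writes_checkProg hr), l', hl', ?_⟩
  · have h1 : (t : ℝ) ≤ 300 * (l.length * K) := by exact_mod_cast ht'
    have h2 := le_checkTime hK l.length
    have h3 : (0 : ℝ) ≤ l.length * K := by positivity
    linarith
  · simp only [hv, checkAlg_iff hn hl']

/-! ### Listings of the distinct preferences, and the detection program as a whole -/

theorem Preference.length_le_factorial {K : ℕ} {l : List (Preference K)} (hl : l.Nodup) :
    l.length ≤ K.factorial := by
  have h := hl.length_le_card
  rwa [Fintype.card_congr (equivPerm (K := K)), Fintype.card_perm, Fintype.card_fin] at h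

theorem Enumerates.isListing {K n m : ℕ} {π : Profile K n} {f : ℕ → Preference K}
    (h : Enumerates f m (Set.range π)) : IsListing π (List.ofFn fun i : Fin m => f i) := by
  refine ⟨List.nodup_ofFn.2 fun i j hij => Fin.ext (h.1 i i.2 j j.2 hij), fun p => ?_⟩
  rw [List.mem_ofFn, ← Set.mem_range, ← Set.mem_range, h.2]
  exact ⟨fun ⟨i, hi⟩ => ⟨i, i.2, hi⟩, fun ⟨i, hi, he⟩ => ⟨⟨i, hi⟩, he⟩⟩

theorem IsListing.enumerates {K n : ℕ} {π : Profile K n} {l : List (Preference K)}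
    (h : IsListing π l) (p₀ : Preference K) :
    Enumerates (fun i => l.getD i p₀) l.length (Set.range π) := by
  refine ⟨fun i hi j hj he => ?_, fun p => ?_⟩
  · beta_reduce at he
    rw [List.getD_eq_getElem _ _ hi, List.getD_eq_getElem _ _ hj] at he
    exact (h.1.getElem_inj_iff).1 he
  · rw [Set.mem_range, ← h.2, List.mem_iff_getElem]
    constructor
    · rintro ⟨i, hi, rfl⟩
      exact ⟨i, hi, List.getD_eq_getElem _ _ hi⟩
    · rintro ⟨i, hi, rfl⟩
      exact ⟨i, hi, (List.getD_eq_getElem _ _ hi).symm⟩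

theorem detectProg_spec {K n w : ℕ} {π : Profile K n} {s₀ : RamState} (hK : 3 ≤ K) (hn : 0 < n)
    (hw : (n * K) ^ 6 ≤ 2 ^ w) (hs : IsInput π s₀) :
    ∃ (s₁ s₂ s₃ : RamState) (t₁ t₂ t₃ : ℕ) (l₁ l : List (Preference K))
      (ord : Preference K → List (Preference K)),
      Exec w tabulate s₀ s₁ t₁ ∧ IsListing π l₁ ∧ HoldsTable π l₁ s₁ ∧
      Exec w order s₁ s₂ t₂ ∧ IsFreqOrder π l ∧ HoldsTable π l s₂ ∧
      Exec w (searchProg checkProg) s₂ s₃ t₃ ∧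
      (∀ p₀, IsFreqDistOrder π p₀ (ord p₀)) ∧ Reports s₃ (detectAlg π l ord) ∧
      l.length ≤ n ∧ t₁ ≤ 100 * (n * K) ∧ t₂ + t₃ ≤ 360 * (l.length * l.length * K) := by
  obtain ⟨X, hX⟩ : ∃ X, X = n * K := ⟨_, rfl⟩
  have hX3 : 3 ≤ X := hX ▸ hK.trans (Nat.le_mul_of_pos_left _ hn)
  have hnX : n ≤ X := hX ▸ Nat.le_mul_of_pos_right _ (by omega)
  have hKX : K ≤ X := hX ▸ Nat.le_mul_of_pos_left _ hn
  have hXX : X ≤ X * X := Nat.le_mul_of_pos_left _ (by omega)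
  have hX6 := sq_le_pow_six hX3
  rw [← hX] at hw
  -- The start state contains only `K`, `n`, letters below `K`, and zeros.
  have hW₀ : s₀.IsWord w := by
    have h : ∀ i : Fin n, ∀ j < K, s₀.mem (i * K + j) = (π i).code j := fun i =>
      holdsPref_iff.1 (hs.prefs i)
    refine ⟨fun r => ?_, fun a => ?_⟩
    · rcases Nat.lt_or_ge r 2 with hr | hr
      · interval_cases r
        · rw [hs.alternatives]
          omega
        · rw [hs.voters]
          omega
      · rw [hs.regs_zero r hr]
        positivity
    · rcases Nat.lt_or_ge a (n * K) with ha | ha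
      · have h1 : a / K < n := (Nat.div_lt_iff_lt_mul (by omega)).2 ha
        have h2 : a % K < K := Nat.mod_lt _ (by omega)
        have h3 := h ⟨a / K, h1⟩ (a % K) h2
        rw [Nat.mul_comm, Nat.div_add_mod] at h3
        have := (π ⟨a / K, h1⟩).code_lt h2
        omega
      · rw [hs.mem_zero a ha]
        positivity
  obtain ⟨s₁, t₁, e₁, ⟨g1, g2, g3, g4, g14, g15, gR, gC, ht₁⟩, f₁⟩ :=
    tabulate_spec (w := w) (by omega) hn hs (by rw [← hX]; omega)
  obtain ⟨l₁, hl₁⟩ : ∃ l₁, l₁ = distinct (List.ofFn π) := ⟨_, rfl⟩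
  have hlist : IsListing π l₁ := hl₁ ▸ isListing_distinct π
  obtain ⟨m, hm⟩ : ∃ m, l₁.length = m := ⟨_, rfl⟩
  have hmn : m ≤ n := by
    rw [← hm, hl₁]
    simpa using length_distinct_le (List.ofFn π)
  have hmpos : 0 < m := hm ▸ hlist.length_pos hn
  have hmK : m * K ≤ X := hX ▸ Nat.mul_le_mul_right K hmn
  have hmX : m * K * (m * K) ≤ X * X := Nat.mul_le_mul hmK hmK
  rw [← hl₁, hm] at g1
  rw [← hl₁] at gR gC
  rw [← hX] at g2 g3 g4 ht₁
  have g0 := (f₁ 0 (by decide)).trans hs.alternatives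
  have hfreq : ∀ (i : ℕ) (h : i < l₁.length), s₁.mem (s₁.reg 3 + i) = freq π l₁[i] := by
    intro i hi
    have := gC l₁[i] (List.getElem_mem hi)
    rwa [hlist.1.idxOf_getElem, ← freq_eq_count] at this
  have hT₁ : HoldsTable π l₁ s₁ := by
    refine ⟨g0, g1.trans hm.symm, fun i hi => holdsPref_iff.2 (gR i hi), hfreq, ?_, ?_⟩ <;>
    · rw [hm]
      omega
  obtain ⟨s₂, t₂, e₂, ⟨⟨f, hf1, hf2, hf3⟩, ht₂⟩, f₂⟩ :=
    order_spec (w := w) (R := s₁.reg 2) (Q := s₁.reg 3) (m := m) (g := freq π)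
      (f := fun i => l₁.getD i (π ⟨0, hn⟩)) (S := Set.range π) (by omega) hmpos g0 g1 rfl rfl
      g14 g15 (by omega) (by omega) ⟨fun i hi j hj => by
        rw [List.getD_eq_getElem _ _ (by omega)]
        exact gR i (by omega) j hj, fun i hi => by
        rw [List.getD_eq_getElem _ _ (by omega)]
        exact hfreq i (by omega)⟩ (hm ▸ hlist.enumerates _)
  obtain ⟨l, hl⟩ : ∃ l, l = List.ofFn fun i : Fin m => f i := ⟨_, rfl⟩
  have hlen : l.length = m := by simp [hl]
  have hget : ∀ (i : ℕ) (h : i < l.length), l[i] = f i := fun i h => by simp [hl]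
  have hord : IsFreqOrder π l := by
    refine ⟨hl ▸ hf2.isListing, List.pairwise_iff_getElem.2 fun i j hi hj hij => ?_⟩
    rw [hget, hget]
    exact hf3 i j hij (by omega)
  have r0 := f₂ 0 (by decide)
  have r1 := f₂ 1 (by decide)
  have r2 := f₂ 2 (by decide)
  have r3 := f₂ 3 (by decide)
  have r4 := f₂ 4 (by decide)
  have hT₂ : HoldsTable π l s₂ := by
    refine ⟨r0.trans g0, by rw [r1, g1, hlen], fun i hi => ?_, fun i hi => ?_, ?_, ?_⟩
    · rw [r2, hget, holdsPref_iff]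
      exact hf1.rows i (by omega)
    · rw [r3, hget]
      exact hf1.vals i (by omega)
    · rw [hlen]
      omega
    · rw [hlen]
      omega
  choose ord ho using fun p₀ => exists_isFreqDistOrder hord.1 p₀
  obtain ⟨s₃, t₃, e₃, hrep, ht₃⟩ := searchProg_spec hK hn hord ho
    (e₂.exec.isWord (e₁.exec.isWord hW₀)) hT₂ (by rw [hlen]; omega)
  refine ⟨s₁, s₂, s₃, t₁, t₂, t₃, l₁, l, ord, e₁.exec, hlist, hT₁, e₂.exec, hord, hT₂, e₃.exec,
    ho, hrep, by omega, hX ▸ ht₁, ?_⟩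
  rw [hlen] at ht₃ ⊢
  omega

end

theorem mainTheorem6 :
    -- Correctness, whatever way the ordering steps break ties.
    (∀ (K n : ℕ) (π : Profile K n), 3 ≤ K → 0 < n →
      (∀ (p₀ : Preference K) (l : List (Preference K)), IsFreqDistOrder π p₀ l →
        (checkAlg π p₀ l = true ↔ FlexibleConsensusAround π p₀)) ∧
      (∀ (l : List (Preference K)) (ord : Preference K → List (Preference K)),
        IsFreqOrder π l → (∀ p₀, IsFreqDistOrder π p₀ (ord p₀)) →
          (∀ p, detectAlg π l ord = some p → FlexibleConsensusAround π p) ∧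
          (detectAlg π l ord = none ↔ ¬ FlexibleConsensus π))) ∧
    -- Running time on the word RAM.
    (∃ (tabulate order check : Cmd) (c : ℕ) (C : ℝ),
      IsCheckProg c C check ∧
      ∀ (K n w : ℕ) (π : Profile K n) (s₀ : RamState),
        3 ≤ K → 0 < n → (n * K) ^ c ≤ 2 ^ w → IsInput π s₀ →
        ∃ (s₁ s₂ s₃ : RamState) (t₁ t₂ t₃ : ℕ) (l₁ l : List (Preference K))
          (ord : Preference K → List (Preference K)),
          -- the frequencies of the distinct preferences
          Exec w tabulate s₀ s₁ t₁ ∧ IsListing π l₁ ∧ HoldsTable π l₁ s₁ ∧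
          -- the order by descending frequency
          Exec w order s₁ s₂ t₂ ∧ IsFreqOrder π l ∧ HoldsTable π l s₂ ∧
          -- the search through the candidates
          Exec w (searchProg check) s₂ s₃ t₃ ∧
          (∀ p₀, IsFreqDistOrder π p₀ (ord p₀)) ∧ Reports s₃ (detectAlg π l ord) ∧
          -- the whole program, and the time bounds
          Exec w (detectProg tabulate order check) s₀ s₃ (t₁ + t₂ + t₃) ∧
          (t₁ : ℝ) ≤ C * (n * K) ∧
          ((t₂ + t₃ : ℕ) : ℝ) ≤ C * detectTime l.length K ∧
          (n ≤ K.factorial ^ 2 →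
            ((t₁ + t₂ + t₃ : ℕ) : ℝ) ≤ C * detectTime (min K.factorial n) K)) := by
  refine ⟨fun K n π _ hn => ⟨fun p₀ l h => checkAlg_iff hn h,
    fun l ord h ho => detectAlg_correct hn h ho⟩, tabulate, order, checkProg, 6, 500,
    isCheckProg_checkProg, fun K n w π s₀ hK hn hw hs => ?_⟩
  obtain ⟨s₁, s₂, s₃, t₁, t₂, t₃, l₁, l, ord, e₁, h₁, hT₁, e₂, h₂, hT₂, e₃, ho, hr, hln, ht₁,
    ht₂⟩ := detectProg_spec hK hn hw hs
  have h1 : (t₁ : ℝ) ≤ 100 * (n * K) := by exact_mod_cast ht₁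
  have h2 : ((t₂ + t₃ : ℕ) : ℝ) ≤ 360 * (l.length * l.length * K) := by exact_mod_cast ht₂
  refine ⟨s₁, s₂, s₃, t₁, t₂, t₃, l₁, l, ord, e₁, h₁, hT₁, e₂, h₂, hT₂, e₃, ho, hr, ?_, ?_, ?_,
    fun hnK => ?_⟩
  · rw [Nat.add_assoc]
    exact .seq e₁ (.seq e₂ e₃)
  · have : (0 : ℝ) ≤ n * K := by positivity
    linarith
  · have := le_detectTime hK l.length
    have : (0 : ℝ) ≤ l.length * l.length * K := by positivity
    linarith
  · obtain ⟨N, hN⟩ : ∃ N, N = min K.factorial n := ⟨_, rfl⟩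
    have hlN : l.length ≤ N := hN ▸ le_min (Preference.length_le_factorial h₂.1.1) hln
    -- If the minimum is `K!`, this is the hypothesis on `n`; if it is `n`, it is trivial. It turns
    -- the tabulation cost `n K` into at most `N² K`.
    have hnN : n ≤ N * N := by
      rw [hN]
      rcases min_choice K.factorial n with h | h <;> rw [h]
      · rwa [← sq]
      · exact Nat.le_mul_of_pos_left _ hn
    have h3 : t₁ + t₂ + t₃ ≤ 460 * (N * N * K) := by
      have := Nat.mul_le_mul_right K hnN
      have := Nat.mul_le_mul_right K (Nat.mul_le_mul hlN hlN)
      omega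
    have h4 : ((t₁ + t₂ + t₃ : ℕ) : ℝ) ≤ 460 * (N * N * K) := by exact_mod_cast h3
    have := le_detectTime hK N
    have : (0 : ℝ) ≤ N * N * K := by positivity
    rw [← hN]
    linarith
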